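/- **Setting.** A partition $\lambda=(\lambda_1\ge\lambda_2\ge\dots)$ is identified with its Young diagram; $\widehat\lambda_j$ is the length of its $j$-th column. For partitions $\lambda,\mu$ of the same integer $n$, $\lambda\ge\mu$ denotes the dominance order: $\sum_{i\le j}\lambda_i\ge\sum_{i\le j}\mu_i$ for all $j$. For a box $B$ let $c(B)$ and $r(B)$ be its column and row number (starting from $1$), and put $$q(\lambda,\mu)=\tfrac12\sum_i|\lambda_i-\mu_i|,\qquad c(\lambda,\mu)=\sum_{B\in\lambda}c(B)-\sum_{B\in\mu}c(B),\qquad r(\lambda,\mu)=\sum_{B\in\mu}r(B)-\sum_{B\in\lambda}r(B).$$ Let $t=\lambda_1$, $n_i=\sum_{j=i+1}^{t}\widehat\lambda_j$ for $0\le i\le t$, and let $V_0,\dots,V_t$ be complex vector spaces with $\dim V_i=n_i$, each with a non-degenerate symmetric bilinear form. Let $Z=Z^{(\lambda)}$ be the variety of all sequences $(A_1,B_1;\dots;A_t,B_t)$ of linear maps $A_i:V_{i-1}\to V_i$, $B_i:V_i\to V_{i-1}$ such that $B_i=A_i^*$ is the adjoint of $A_i$ for $1\le i\le t$, and $A_iB_i=B_{i+1}A_{i+1}$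 for $1\le i<t$. An $ab$-string is a non-empty string in which the letters $a$ and $b$ alternate; an $ab$-diagram is a finite multiset of $ab$-strings. A pair of linear maps $A:V\to U$, $B:U\to V$ has $ab$-diagram $\delta$ if there are a basis of $V$ indexed by the occurrences of $a$ in $\delta$ and a basis of $U$ indexed by the occurrences of $b$ in $\delta$ such that $A$ and $B$ send the basis vector of each letter to that of the next letter in its string, and to $0$ if the letter is the last one. Let $\pi(\delta)$ be the partition whose parts are the numbers of $a$'s in the strings of $\delta$ (zeros omitted). For $\tau=(\tau_1,\dots,\tau_t)$ a sequence of $ab$-diagrams, let $Z_\tau\subseteq Z$ be the set of points for which $(A_i,B_i)$ has $ab$-diagram $\tau_i$ for every $i$; the non-empty $Z_\tau$ are the strata of $Z$. (If $n=0$, then $t=0$ and $\pi(\tau_1)$ is read as the empty partition.) The dimension of $Z_\tau$ is its dimension as an algebraic set, i.e. that of its Zariski closure. **Proposition.** Let $\lambda\ge\mu$ be two partitions of $n$ and let $Z=Z^{(\lambda)}$. There is exactly one stratum $Z_{\tau^0}$ of $Z$ with $\pi(\tau^0_1)=\lambda$. Let $Z_\tau$ be a stratum of $Z$ with $\pi(\tau_1)=\mu$.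 Then, for each real number $x$, $$2r(\lambda,\mu)-c(\lambda,\mu)-q(\lambda,\mu)\ge 4x\quad\Longrightarrow\quad\dim Z_{\tau^0}-\dim Z_\tau\ge x.$$ -/

import Mathlib

namespace OrthoStrata

/-! ### Partitions

Partitions are Young diagrams. Rows and columns are indexed from `0`, so the usual
`λ_i` is `lam.rowLen (i - 1)` and the dual part `λ̂_j` is `lam.colLen (j - 1)`. -/

/-- Dominance order `mu ≤ lam` on partitions of the same integer. -/
def Dominates (lam mu : YoungDiagram) : Prop :=
  lam.card = mu.card ∧
    ∀ j : ℕ, ∑ i ∈ Finset.range j, mu.rowLen i ≤ ∑ i ∈ Finset.range j, lam.rowLen i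

/-- `q(λ, μ) = (1/2) ∑ |λ_i - μ_i|`; beyond the given range both parts vanish. -/
noncomputable def qDiff (lam mu : YoungDiagram) : ℝ :=
  (1 / 2) * ∑ i ∈ Finset.range (max (lam.colLen 0) (mu.colLen 0)),
    |(lam.rowLen i : ℝ) - (mu.rowLen i : ℝ)|

/-- `c(λ, μ)`: sum of the column numbers of the boxes of `λ` minus that for `μ`. -/
def cDiff (lam mu : YoungDiagram) : ℤ :=
  ∑ B ∈ lam.cells, ((B.2 : ℤ) + 1) - ∑ B ∈ mu.cells, ((B.2 : ℤ) + 1)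

/-- `r(λ, μ)`: sum of the row numbers of the boxes of `μ` minus that for `λ`. -/
def rDiff (lam mu : YoungDiagram) : ℤ :=
  ∑ B ∈ mu.cells, ((B.1 : ℤ) + 1) - ∑ B ∈ lam.cells, ((B.1 : ℤ) + 1)

/-- The number `t = λ_1` of columns. -/
def numCols (lam : YoungDiagram) : ℕ := lam.rowLen 0

/-- `n_i = ∑_{j > i} λ̂_j` (with `j` running from `1` to `t`). -/
def dimVec (lam : YoungDiagram) (i : ℕ) : ℕ :=
  ∑ j ∈ Finset.Ico i (numCols lam), lam.colLen j

/-! ### `ab`-diagrams -/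

/-- The two letters. -/
inductive Letter
  | a
  | b
  deriving DecidableEq

/-- The other letter. -/
def Letter.swap : Letter → Letter
  | .a => .b
  | .b => .a

/-- An `ab`-string: a nonempty string in which `a` and `b` alternate. It is recorded by its
first letter and its length. -/
@[ext]
structure ABString where
  first : Letter
  len : ℕ
  len_pos : 0 < len

/-- The letter in position `j` (counted from `0`). -/
def ABString.letter (s : ABString) (j : ℕ) : Letter :=
  if Even j then s.first else s.first.swap

/-- The number of `a`'s in an `ab`-string. -/
def ABString.countA (s : ABString) : ℕ :=
  ((Finset.range s.len).filter fun j => s.letter j = Letter.a).card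

/-- An `ab`-diagram: a list of `ab`-strings, up to reordering. -/
abbrev ABDiagram := Multiset ABString

/-- The Young diagram obtained from an `ab`-diagram by suppressing the `b`'s. -/
def piDiagram (δ : ABDiagram) : YoungDiagram :=
  YoungDiagram.ofRowLens ((δ.map ABString.countA).sort (fun x y => x ≥ y))
    (Multiset.pairwise_sort _ _).sortedGE

/-- `δ` is the `ab`-diagram of the pair of maps `A : V → U`, `B : U → V`: for some listing
`row` of the strings of `δ` there are basis vectors, one for each letter of each string,
those for the letters `a` forming a basis of `V` and those for the letters `b` a basis of `U`
(together: a basis of `V × U`), such that `A` resp. `B` sends the vector of a letter to the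
vector of the next letter of its string, and the vector of a last letter to `0`. -/
def HasABDiagram {V U : Type*} [AddCommGroup V] [Module ℂ V] [AddCommGroup U] [Module ℂ U]
    (A : V →ₗ[ℂ] U) (B : U →ₗ[ℂ] V) (δ : ABDiagram) : Prop :=
  ∃ (k : ℕ) (row : Fin k → ABString) (e : Module.Basis (Σ i, Fin (row i).len) ℂ (V × U)),
    Multiset.map row Finset.univ.val = δ ∧
    (∀ i (j : Fin (row i).len), (row i).letter j = Letter.a → (e ⟨i, j⟩).2 = 0) ∧
    (∀ i (j : Fin (row i).len), (row i).letter j = Letter.b → (e ⟨i, j⟩).1 = 0) ∧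
    ∀ i (j : Fin (row i).len),
      (B (e ⟨i, j⟩).2, A (e ⟨i, j⟩).1) =
        if h : (j : ℕ) + 1 < (row i).len then e ⟨i, ⟨j + 1, h⟩⟩ else 0

/-! ### The variety `Z` and its strata -/

/-- Sequences `(A_1, B_1; …; A_t, B_t)` with `A_i : V_{i-1} → V_i` and `B_i : V_i → V_{i-1}`;
the pair `(A_i, B_i)` sits at the index `i - 1`. -/
abbrev RepSpace (t : ℕ) (V : ℕ → Type*) [∀ i, AddCommGroup (V i)] [∀ i, Module ℂ (V i)] :=
  ∀ i : Fin t, (V i →ₗ[ℂ] V (i + 1)) × (V (i + 1) →ₗ[ℂ] V i)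

/-- The variety `Z`: the sequences with `B_i = A_i^*` for all `i` and
`A_i B_i = B_{i+1} A_{i+1}` for `1 ≤ i < t`. -/
def varietyZ (t : ℕ) (V : ℕ → Type*) [∀ i, AddCommGroup (V i)] [∀ i, Module ℂ (V i)]
    (form : ∀ i, LinearMap.BilinForm ℂ (V i)) : Set (RepSpace t V) :=
  {z | (∀ i : Fin t, LinearMap.IsAdjointPair (form i) (form (i + 1)) (z i).1 (z i).2) ∧
    ∀ (i : ℕ) (h : i + 1 < t),
      (z ⟨i, Nat.lt_of_succ_lt h⟩).1 ∘ₗ (z ⟨i, Nat.lt_of_succ_lt h⟩).2 =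
        (z ⟨i + 1, h⟩).2 ∘ₗ (z ⟨i + 1, h⟩).1}

/-- `Z_τ`: the points of `Z` whose `i`-th `ab`-diagram is `τ_i` for all `i`. -/
def stratum (t : ℕ) (V : ℕ → Type*) [∀ i, AddCommGroup (V i)] [∀ i, Module ℂ (V i)]
    (form : ∀ i, LinearMap.BilinForm ℂ (V i)) (τ : Fin t → ABDiagram) : Set (RepSpace t V) :=
  {z | z ∈ varietyZ t V form ∧ ∀ i : Fin t, HasABDiagram (z i).1 (z i).2 (τ i)}

/-- `π(τ_1)`; for the empty string `τ` (only `n = 0`) it is the empty partition. -/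
def firstPartition {t : ℕ} (τ : Fin t → ABDiagram) : YoungDiagram :=
  if h : 0 < t then piDiagram (τ ⟨0, h⟩) else ⊥

/-! ### Dimension -/

/-- The ring of polynomial functions on a subset `X` of a complex vector space `W`, that is,
the coordinate ring of the Zariski closure of `X`. -/
def polyFunctions {W : Type*} [AddCommGroup W] [Module ℂ W] (X : Set W) :
    Subalgebra ℂ (X → ℂ) :=
  Algebra.adjoin ℂ (Set.range fun (φ : Module.Dual ℂ W) (x : X) => φ (x : W))

/-- The dimension of a locally closed (or constructible) subset of a finite-dimensional
complex vector space: the dimension of its Zariski closure. It is `⊥` for the empty set. -/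
noncomputable def zariskiDim {W : Type*} [AddCommGroup W] [Module ℂ W] (X : Set W) :
    WithBot ℕ∞ :=
  ringKrullDim (polyFunctions X)

end OrthoStrata

namespace OrthoStrata

section

/-! ### Krull dimension and algebraic independence -/

section KrullDimension

variable {k R : Type*} [Field k] [CommRing R] [Algebra k R]

/-! Orthonormal bases turn a point of Z into matrices A_i with A_i A_iᵀ = A_{i+1}ᵀ A_{i+1}
(`stratum_eq_image`). Two matrices with the same ab-diagram, taken together with their transposes,
are orthogonally equivalent (`exists_orthogonal_of_hasABDiagram`). So one point A of a stratum
yields all others: act by any orthogonal matrix at each target, and by an orthogonal matrix at each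
source that commutes with `moment A` (`act`, `exists_act_eq`). Cayley transforms make this a
rational chart on the vector space `paramSpace A`, and the directions that do not move A form a copy
of `stabSpace A`. Hence dim Z_τ = dim `paramSpace A` - dim `stabSpace A` (`zariskiDim_matStratum`).
The rank of the chart at 0 gives enough independent functions. Conversely, finitely many charts
cover the stratum and each can be replaced by a slice of the right dimension, on which more
functions satisfy a relation.

Both spaces are built from skew matrices commuting with symmetric ones. In a string basis these
become alternating forms with self-adjoint shift, counted by pairs of strings
(`finrank_skewForm_eq_card`). Summing over the arrows telescopes (`four_mul_finrank_sub`): 4 dim Z_τ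
= C(n) - ∑ min(p, p') + ∑_i (o_i - w_i). Here p, p' run over ordered pairs of parts of π(τ_1), o_i
counts the odd strings of τ_i, and w_i counts the ordered pairs of odd strings of τ_i of equal
length and different first letter.

The sum of the minima is the sum of the squares of the columns, so its increase from λ to μ is 2r.
For π(τ_1) = λ all strings are odd and begin with a (`forall_isDown`); this fixes τ⁰ and gives w_i =
0 and o_i = n_i - n_{i+1}. Twice the sum of the column numbers is ∑ p(p+1), which telescopes over
the diagrams as well. The comparison 4 (dim Z_τ⁰ - dim Z_τ) ≥ 2r - c then follows from ∑_i `defect`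
≥ 0 (`sum_defect_nonneg`). There only strings consisting of a single b count negatively; they are
paid for by single a's in the same diagram or by strings of the next one. The nonnegative q is
dropped at the end. That τ⁰ occurs at all is shown by an explicit model on the boxes of λ. -/

theorem ringKrullDim_eq_of_isIntegral_of_injective {A : Type*} [CommRing A] (g : A →+* R)
    (hg : Function.Injective g) (hint : g.IsIntegral) : ringKrullDim R = ringKrullDim A := by
  algebraize [g]
  have : Algebra.IsIntegral A R := ⟨hint⟩
  have : FaithfulSMul A R := (faithfulSMul_iff_algebraMap_injective A R).mpr hg
  -- Incomparability of primes in an integral extension gives one inequality, going up the other.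
  refine le_antisymm ?_ ?_
  · refine Order.krullDim_le_of_strictMono
      (PrimeSpectrum.comap (algebraMap A R) : PrimeSpectrum R → PrimeSpectrum A) ?_
    intro p q hpq
    exact Ideal.IsIntegral.comap_lt_comap (R := A) (I := p.asIdeal) (J := q.asIdeal) hpq
  · refine iSup_le fun l => ?_
    obtain ⟨Q, hQ, hQ'⟩ := (inferInstance : Nonempty (Ideal.primesOver l.head.asIdeal R))
    obtain ⟨L, hL, -, -⟩ := Ideal.exists_ltSeries_of_hasGoingUp (S := R) l Q
    rw [← hL]
    exact Order.LTSeries.length_le_krullDim L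

/-- R need not be a domain. A prime avoiding all nonzero polynomials in `f` keeps `f` independent in
the quotient domain, which is algebraic over the subalgebra generated by d elements; transcendence
degree then bounds m. -/
theorem AlgebraicIndependent.le_of_isIntegral {d m : ℕ} (g : MvPolynomial (Fin d) k →ₐ[k] R)
    (hint : g.IsIntegral) {f : Fin m → R} (hf : AlgebraicIndependent k f) : m ≤ d := by
  let S : Submonoid R := (nonZeroDivisors (MvPolynomial (Fin m) k)).map (MvPolynomial.aeval f)
  have hdisj : Disjoint ((⊥ : Ideal R) : Set R) (S : Set R) := by
    rw [Set.disjoint_left]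
    rintro x hx ⟨p, hp, rfl⟩
    have hx' : MvPolynomial.aeval f p = 0 := by simpa using hx
    exact nonZeroDivisors.ne_zero hp (hf (by simpa using hx'))
  obtain ⟨P, hP, -, hPS⟩ := Ideal.exists_le_prime_disjoint _ _ hdisj
  have hind : AlgebraicIndependent k fun i => Ideal.Quotient.mkₐ k P (f i) := by
    rw [algebraicIndependent_iff]
    intro p hp
    by_contra hne
    have h1 : Ideal.Quotient.mkₐ k P (MvPolynomial.aeval f p) = 0 := by
      rw [← hp]
      exact MvPolynomial.comp_aeval_apply f (Ideal.Quotient.mkₐ k P) p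
    rw [Ideal.Quotient.mkₐ_eq_mk, Ideal.Quotient.eq_zero_iff_mem] at h1
    exact Set.disjoint_left.mp hPS h1 ⟨p, mem_nonZeroDivisors_of_ne_zero hne, rfl⟩
  let y : Fin d → R ⧸ P := fun i => Ideal.Quotient.mkₐ k P (g (MvPolynomial.X i))
  have hadj : ∀ p, Ideal.Quotient.mkₐ k P (g p) ∈ Algebra.adjoin k (Set.range y) := by
    intro p
    have : (Ideal.Quotient.mkₐ k P).comp g = MvPolynomial.aeval y := by
      ext i; simp [y]
    rw [← AlgHom.comp_apply, this, Algebra.adjoin_range_eq_range_aeval]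
    exact ⟨p, rfl⟩
  have hcomp : ((Ideal.Quotient.mkₐ k P).comp g).toRingHom.IsIntegral :=
    RingHom.IsIntegral.trans _ _ hint
      (RingHom.isIntegral_of_surjective _ (Ideal.Quotient.mkₐ_surjective k P))
  have halg : Algebra.IsAlgebraic (Algebra.adjoin k (Set.range y)) (R ⧸ P) := by
    let φ : MvPolynomial (Fin d) k →+* Algebra.adjoin k (Set.range y) :=
      (((Ideal.Quotient.mkₐ k P).comp g).codRestrict _ hadj).toRingHom
    have hφ : ((Ideal.Quotient.mkₐ k P).comp g).toRingHom
        = (algebraMap (Algebra.adjoin k (Set.range y)) (R ⧸ P)).comp φ := by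
      ext <;> rfl
    rw [hφ] at hcomp
    have : Algebra.IsIntegral (Algebra.adjoin k (Set.range y)) (R ⧸ P) :=
      ⟨RingHom.IsIntegral.tower_top _ _ hcomp⟩
    exact Algebra.IsIntegral.isAlgebraic
  have h1 := Algebra.IsAlgebraic.trdeg_le_cardinalMk k (Set.range y)
  have h2 := hind.lift_cardinalMk_le_trdeg
  have h3 : Cardinal.mk (Set.range y) ≤ d := by
    have := Cardinal.mk_range_le_lift (f := y)
    simpa using this
  simpa using h2.trans (Cardinal.lift_le.mpr (h1.trans h3))

/-- The Krull dimension of a finitely generated algebra is the largest size of an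
algebraically independent family. -/
theorem exists_ringKrullDim_eq_natCast [Nontrivial R] [Algebra.FiniteType k R] :
    ∃ d : ℕ, ringKrullDim R = d ∧ (∃ f : Fin d → R, AlgebraicIndependent k f) ∧
      ∀ (m : ℕ) (f : Fin m → R), AlgebraicIndependent k f → m ≤ d := by
  obtain ⟨d, g, hg, hint⟩ := exists_integral_inj_algHom_of_fg k R
  refine ⟨d, ?_, ⟨fun i => g (MvPolynomial.X i), ?_⟩, fun m f hf =>
    AlgebraicIndependent.le_of_isIntegral g hint hf⟩
  · rw [ringKrullDim_eq_of_isIntegral_of_injective g.toRingHom hg hint]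
    simp
  · have : MvPolynomial.aeval (fun i => g (MvPolynomial.X i)) = g := by ext i; simp
    rw [AlgebraicIndependent, this]
    exact hg

end KrullDimension

/-! ### Polynomial functions -/

section PolyFunctions

variable {W : Type*} [AddCommGroup W] [Module ℂ W]

theorem linear_mem_polyFunctions (X : Set W) (φ : Module.Dual ℂ W) :
    (fun x : X => φ (x : W)) ∈ polyFunctions X :=
  Algebra.subset_adjoin ⟨φ, rfl⟩

instance polyFunctions_finiteType [FiniteDimensional ℂ W] (X : Set W) :
    Algebra.FiniteType ℂ (polyFunctions X) := by
  let b := Module.finBasis ℂ (Module.Dual ℂ W)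
  have hfin : polyFunctions X
      = Algebra.adjoin ℂ (Set.range fun i => (fun x : X => b i (x : W))) := by
    refine le_antisymm (Algebra.adjoin_le ?_) (Algebra.adjoin_mono ?_)
    · rintro _ ⟨φ, rfl⟩
      have : (fun x : X => φ (x : W)) = ∑ i, b.repr φ i • (fun x : X => b i (x : W)) := by
        funext x
        have := LinearMap.congr_fun (b.sum_repr φ) (x : W)
        simp only [LinearMap.sum_apply, LinearMap.smul_apply] at this
        simpa only [Finset.sum_apply, Pi.smul_apply] using this.symm
      simp only [this]
      exact Subalgebra.sum_mem _ fun i _ =>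
        Subalgebra.smul_mem _ (Algebra.subset_adjoin (Set.mem_range_self i)) _
    · rintro _ ⟨i, rfl⟩
      exact ⟨b i, rfl⟩
  rw [← Subalgebra.fg_iff_finiteType, hfin]
  exact Subalgebra.fg_def.mpr ⟨_, Set.finite_range _, rfl⟩

theorem polyFunctions_comp {W' : Type*} [AddCommGroup W'] [Module ℂ W'] {X : Set W} {X' : Set W'}
    (L : W →ₗ[ℂ] W') (hL : ∀ x ∈ X, L x ∈ X') {f : X' → ℂ} (hf : f ∈ polyFunctions X') :
    (fun x : X => f ⟨L x, hL x x.2⟩) ∈ polyFunctions X := by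
  let Φ : (X' → ℂ) →ₐ[ℂ] (X → ℂ) :=
    AlgHom.pi fun x : X => Pi.evalAlgHom ℂ (fun _ : X' => ℂ) ⟨L x, hL x x.2⟩
  have : polyFunctions X' ≤ (polyFunctions X).comap Φ := by
    refine Algebra.adjoin_le ?_
    rintro _ ⟨φ, rfl⟩
    exact linear_mem_polyFunctions X (φ.comp L)
  exact this hf

theorem zariskiDim_image {W' : Type*} [AddCommGroup W'] [Module ℂ W'] (L : W →ₗ[ℂ] W')
    (hL : Function.Injective L) (X : Set W) : zariskiDim (L '' X) = zariskiDim X := by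
  obtain ⟨M, hM⟩ := L.exists_leftInverse_of_injective (LinearMap.ker_eq_bot.mpr hL)
  have hM' : ∀ x, M (L x) = x := fun x => LinearMap.congr_fun hM x
  have h1 : ∀ x ∈ X, L x ∈ L '' X := fun x hx => ⟨x, hx, rfl⟩
  have h2 : ∀ y ∈ L '' X, M y ∈ X := by rintro _ ⟨x, hx, rfl⟩; rwa [hM']
  have h3 : ∀ y ∈ L '' X, L (M y) = y := by rintro _ ⟨x, hx, rfl⟩; rw [hM']
  refine ringKrullDim_eq_of_ringEquiv
    { toFun := fun f => ⟨_, polyFunctions_comp L h1 f.2⟩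
      invFun := fun f => ⟨_, polyFunctions_comp M h2 f.2⟩
      left_inv := ?_
      right_inv := ?_
      map_mul' := fun _ _ => rfl
      map_add' := fun _ _ => rfl }
  · intro f
    ext ⟨y, hy⟩
    simp [h3 y hy]
  · intro f
    ext ⟨y, hy⟩
    simp [hM']

end PolyFunctions

end

section

open Filter Topology

/-! ### Polynomial and rational maps on finite-dimensional spaces -/

section Rational

variable {W E : Type*} [AddCommGroup W] [Module ℂ W] [AddCommGroup E] [Module ℂ E]

/-- The algebra of polynomial functions on a vector space. -/
def polyMaps (E : Type*) [AddCommGroup E] [Module ℂ E] : Subalgebra ℂ (E → ℂ) :=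
  Algebra.adjoin ℂ (Set.range fun (φ : Module.Dual ℂ E) (x : E) => φ x)

theorem linear_mem_polyMaps (φ : Module.Dual ℂ E) : (fun x => φ x) ∈ polyMaps E :=
  Algebra.subset_adjoin ⟨φ, rfl⟩

theorem const_mem_polyMaps (c : ℂ) : (fun _ => c) ∈ polyMaps E :=
  (polyMaps E).algebraMap_mem c

theorem polyMaps_comp (L : E →ₗ[ℂ] W) {f : W → ℂ} (hf : f ∈ polyMaps W) :
    (fun x => f (L x)) ∈ polyMaps E := by
  let Φ : (W → ℂ) →ₐ[ℂ] (E → ℂ) := AlgHom.pi fun x : E => Pi.evalAlgHom ℂ (fun _ : W => ℂ) (L x)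
  have : polyMaps W ≤ (polyMaps E).comap Φ := by
    refine Algebra.adjoin_le ?_
    rintro _ ⟨φ, rfl⟩
    exact linear_mem_polyMaps (φ.comp L)
  exact this hf

theorem exists_polyMaps_of_mem_polyFunctions {X : Set W} {f : X → ℂ} (hf : f ∈ polyFunctions X) :
    ∃ F ∈ polyMaps W, ∀ x : X, f x = F x := by
  induction hf using Algebra.adjoin_induction with
  | mem f h =>
    obtain ⟨φ, rfl⟩ := h
    exact ⟨_, linear_mem_polyMaps φ, fun _ => rfl⟩
  | algebraMap c => exact ⟨_, const_mem_polyMaps c, fun _ => rfl⟩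
  | add f g _ _ hf hg =>
    obtain ⟨F, hF, hF'⟩ := hf
    obtain ⟨G, hG, hG'⟩ := hg
    exact ⟨F + G, add_mem hF hG, fun x => by simp [hF', hG']⟩
  | mul f g _ _ hf hg =>
    obtain ⟨F, hF, hF'⟩ := hf
    obtain ⟨G, hG, hG'⟩ := hg
    exact ⟨F * G, mul_mem hF hG, fun x => by simp [hF', hG']⟩

theorem polyMaps_eval_line {f : E → ℂ} (hf : f ∈ polyMaps E) (w : E) :
    ∃ p : Polynomial ℂ, ∀ ζ : ℂ, f (ζ • w) = p.eval ζ := by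
  induction hf using Algebra.adjoin_induction with
  | mem f h =>
    obtain ⟨φ, rfl⟩ := h
    exact ⟨Polynomial.X * Polynomial.C (φ w), fun ζ => by
      simp only [map_smul, smul_eq_mul, Polynomial.eval_mul, Polynomial.eval_X, Polynomial.eval_C]⟩
  | algebraMap c => exact ⟨Polynomial.C c, fun ζ => by simp⟩
  | add f g _ _ hf hg =>
    obtain ⟨F, hF⟩ := hf
    obtain ⟨G, hG⟩ := hg
    exact ⟨F + G, fun x => by simp [hF, hG]⟩
  | mul f g _ _ hf hg =>
    obtain ⟨F, hF⟩ := hf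
    obtain ⟨G, hG⟩ := hg
    exact ⟨F * G, fun x => by simp [hF, hG]⟩

/-- On each line through the origin the function is a polynomial in one variable with infinitely
many zeros. -/
theorem polyMaps_eq_zero_of_eventually [TopologicalSpace E] [ContinuousSMul ℂ E] {f : E → ℂ}
    (hf : f ∈ polyMaps E) (h0 : ∀ᶠ x in 𝓝 (0 : E), f x = 0) (w : E) : f w = 0 := by
  obtain ⟨p, hp⟩ := polyMaps_eval_line hf w
  have hlim : Tendsto (fun ζ : ℂ => ζ • w) (𝓝 0) (𝓝 0) := by
    have : Continuous fun ζ : ℂ => ζ • w := by fun_prop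
    simpa using this.tendsto 0
  have hev : ∀ᶠ ζ in 𝓝 (0 : ℂ), p.eval ζ = 0 := by
    filter_upwards [hlim.eventually h0] with ζ hζ
    rw [← hp, hζ]
  have hp0 : p = 0 := by
    refine Polynomial.eq_zero_of_infinite_isRoot p ?_
    exact infinite_of_mem_nhds 0 hev
  simpa [hp0] using hp 1

theorem exists_mvPolynomial_of_mem_polyMaps {s : ℕ} (b : Module.Basis (Fin s) ℂ E) {f : E → ℂ}
    (hf : f ∈ polyMaps E) : ∃ p : MvPolynomial (Fin s) ℂ, ∀ x, f x = MvPolynomial.eval (b.repr x) p := by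
  induction hf using Algebra.adjoin_induction with
  | mem f h =>
    obtain ⟨φ, rfl⟩ := h
    refine ⟨∑ i, MvPolynomial.C (φ (b i)) * MvPolynomial.X i, fun x => ?_⟩
    have := congrArg φ (b.sum_repr x)
    rw [map_sum] at this
    refine this.symm.trans ?_
    simp only [map_smul, smul_eq_mul, map_sum, map_mul, MvPolynomial.eval_C, MvPolynomial.eval_X]
    exact Finset.sum_congr rfl fun i _ => mul_comm _ _
  | algebraMap c => exact ⟨MvPolynomial.C c, fun ζ => by simp⟩
  | add f g _ _ hf hg =>
    obtain ⟨F, hF⟩ := hf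
    obtain ⟨G, hG⟩ := hg
    exact ⟨F + G, fun x => by simp [hF, hG]⟩
  | mul f g _ _ hf hg =>
    obtain ⟨F, hF⟩ := hf
    obtain ⟨G, hG⟩ := hg
    exact ⟨F * G, fun x => by simp [hF, hG]⟩

/-- `f` is a quotient of polynomial functions on `D`, with denominator nowhere zero on `D`. -/
def RatOn (D : Set E) (f : E → ℂ) : Prop :=
  ∃ p ∈ polyMaps E, ∃ q ∈ polyMaps E, ∀ x ∈ D, q x ≠ 0 ∧ f x * q x = p x

namespace RatOn

variable {D : Set E} {f g : E → ℂ}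

theorem of_polyMaps (hf : f ∈ polyMaps E) : RatOn D f :=
  ⟨f, hf, fun _ => 1, const_mem_polyMaps 1, fun x _ => ⟨one_ne_zero, by simp⟩⟩

theorem const (c : ℂ) : RatOn D fun _ => c := of_polyMaps (const_mem_polyMaps c)

theorem add (hf : RatOn D f) (hg : RatOn D g) : RatOn D fun x => f x + g x := by
  obtain ⟨p, hp, q, hq, h⟩ := hf
  obtain ⟨p', hp', q', hq', h'⟩ := hg
  refine ⟨p * q' + p' * q, add_mem (mul_mem hp hq') (mul_mem hp' hq), q * q', mul_mem hq hq',
    fun x hx => ⟨mul_ne_zero (h x hx).1 (h' x hx).1, ?_⟩⟩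
  simp only [Pi.add_apply, Pi.mul_apply, ← (h x hx).2, ← (h' x hx).2]
  ring

theorem mul (hf : RatOn D f) (hg : RatOn D g) : RatOn D fun x => f x * g x := by
  obtain ⟨p, hp, q, hq, h⟩ := hf
  obtain ⟨p', hp', q', hq', h'⟩ := hg
  refine ⟨p * p', mul_mem hp hp', q * q', mul_mem hq hq',
    fun x hx => ⟨mul_ne_zero (h x hx).1 (h' x hx).1, ?_⟩⟩
  simp only [Pi.mul_apply, ← (h x hx).2, ← (h' x hx).2]
  ring

theorem inv (hf : RatOn D f) (h0 : ∀ x ∈ D, f x ≠ 0) : RatOn D fun x => (f x)⁻¹ := by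
  obtain ⟨p, hp, q, hq, h⟩ := hf
  refine ⟨q, hq, p, hp, fun x hx => ⟨?_, ?_⟩⟩
  · rw [← (h x hx).2]
    exact mul_ne_zero (h0 x hx) (h x hx).1
  · rw [← (h x hx).2, inv_mul_cancel_left₀ (h0 x hx)]

theorem sum {ι : Type*} (s : Finset ι) {f : ι → E → ℂ} (hf : ∀ i ∈ s, RatOn D (f i)) :
    RatOn D fun x => ∑ i ∈ s, f i x := by
  classical
  induction s using Finset.induction_on with
  | empty => simpa using const 0
  | insert a s ha ih =>
    simp only [Finset.sum_insert ha]
    exact (hf a (Finset.mem_insert_self a s)).add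
      (ih fun i hi => hf i (Finset.mem_insert_of_mem hi))

theorem comp_linear {E' : Type*} [AddCommGroup E'] [Module ℂ E'] (hf : RatOn D f)
    (L : E' →ₗ[ℂ] E) : RatOn (L ⁻¹' D) fun x => f (L x) := by
  obtain ⟨p, hp, q, hq, h⟩ := hf
  exact ⟨_, polyMaps_comp L hp, _, polyMaps_comp L hq, fun x hx => h _ hx⟩

theorem comp_polyMaps {Φ : E → W} (hΦ : ∀ φ : Module.Dual ℂ W, RatOn D fun x => φ (Φ x))
    {F : W → ℂ} (hF : F ∈ polyMaps W) : RatOn D fun x => F (Φ x) := by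
  induction hF using Algebra.adjoin_induction with
  | mem f h =>
    obtain ⟨φ, rfl⟩ := h
    exact hΦ φ
  | algebraMap c => exact const c
  | add f g _ _ hf hg => exact hf.add hg
  | mul f g _ _ hf hg => exact hf.mul hg

theorem eq_zero_of_eventually [TopologicalSpace E] [ContinuousSMul ℂ E] (hf : RatOn D f)
    (hD : D ∈ 𝓝 (0 : E)) (h0 : ∀ᶠ x in 𝓝 (0 : E), f x = 0) {w : E} (hw : w ∈ D) : f w = 0 := by
  obtain ⟨p, hp, q, hq, h⟩ := hf
  have : p w = 0 := by
    refine polyMaps_eq_zero_of_eventually hp ?_ w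
    filter_upwards [h0, hD] with x hx hxD
    rw [← (h x hxD).2, hx, zero_mul]
  rw [← (h w hw).2] at this
  exact (mul_eq_zero.mp this).resolve_right (h w hw).1

/-- More rational functions than the dimension satisfy a polynomial relation. -/
theorem exists_relation [FiniteDimensional ℂ E] {m : ℕ} (hm : Module.finrank ℂ E < m)
    {f : Fin m → E → ℂ} (hf : ∀ i, RatOn D (f i)) :
    ∃ P : MvPolynomial (Fin m) ℂ, P ≠ 0 ∧ ∀ x ∈ D, MvPolynomial.eval (fun i => f i x) P = 0 := by
  obtain rfl | ⟨x₀, hx₀⟩ := D.eq_empty_or_nonempty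
  · exact ⟨1, one_ne_zero, by simp⟩
  let s := Module.finrank ℂ E
  let b : Module.Basis (Fin s) ℂ E := Module.finBasis ℂ E
  choose p hp q hq h using hf
  choose p' hp' using fun i => exists_mvPolynomial_of_mem_polyMaps b (hp i)
  choose q' hq' using fun i => exists_mvPolynomial_of_mem_polyMaps b (hq i)
  -- Inverting exactly the polynomials without zeros on `D` gives a ring that contains all the given
  -- functions, still has transcendence degree s, and can be evaluated at every point of `D`.
  let M : Submonoid (MvPolynomial (Fin s) ℂ) :=
    { carrier := {r | ∀ x ∈ D, MvPolynomial.eval (b.repr x) r ≠ 0}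
      mul_mem' := fun {r r'} hr hr' x hx => by
        rw [map_mul]; exact mul_ne_zero (hr x hx) (hr' x hx)
      one_mem' := fun x _ => by simp }
  have hM : M ≤ nonZeroDivisors (MvPolynomial (Fin s) ℂ) := fun r hr =>
    mem_nonZeroDivisors_of_ne_zero fun h0 => hr x₀ hx₀ (by rw [h0, map_zero])
  let A := Localization M
  have hdom : IsDomain A := IsLocalization.isDomain_localization hM
  have hinj : Function.Injective (algebraMap (MvPolynomial (Fin s) ℂ) A) :=
    IsLocalization.injective A hM
  have : FaithfulSMul (MvPolynomial (Fin s) ℂ) A :=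
    (faithfulSMul_iff_algebraMap_injective _ _).mpr hinj
  have halg : Algebra.IsAlgebraic (MvPolynomial (Fin s) ℂ) A := IsLocalization.isAlgebraic _ M
  have htr : Algebra.trdeg ℂ A = s := by
    have := trdeg_add_eq ℂ (MvPolynomial (Fin s) ℂ) (A := A)
    rw [trdeg_eq_zero (R := MvPolynomial (Fin s) ℂ) (A := A)] at this
    rw [← this]
    simp
  let qM : Fin m → M := fun i => ⟨q' i, fun x hx => by rw [← hq']; exact (h i x hx).1⟩
  let g : Fin m → A := fun i => IsLocalization.mk' A (p' i) (qM i)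
  have hdep : ¬ AlgebraicIndependent ℂ g := by
    intro hind
    have := hind.lift_cardinalMk_le_trdeg
    rw [htr] at this
    have : m ≤ s := by simpa using this
    omega
  rw [algebraicIndependent_iff] at hdep
  push Not at hdep
  obtain ⟨P, hP, hP0⟩ := hdep
  refine ⟨P, hP0, fun x hx => ?_⟩
  have hunit : ∀ y : M, IsUnit ((MvPolynomial.eval (b.repr x)) (y : MvPolynomial (Fin s) ℂ)) :=
    fun y => (y.2 x hx).isUnit
  let ev : A →+* ℂ := IsLocalization.lift hunit
  have hev : ∀ i, ev (g i) = f i x := by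
    intro i
    have hne := (h i x hx).1
    rw [IsLocalization.lift_mk'_spec, ← hp', ← (h i x hx).2, mul_comm (f i x), hq']
  have hevC : ev.comp (algebraMap ℂ A) = RingHom.id ℂ := by
    ext c
    have : (algebraMap ℂ A) c = algebraMap (MvPolynomial (Fin s) ℂ) A (MvPolynomial.C c) :=
      IsScalarTower.algebraMap_apply ℂ (MvPolynomial (Fin s) ℂ) A c
    rw [RingHom.comp_apply, this, IsLocalization.lift_eq]
    simp
  have := congrArg ev hP
  rw [map_zero, MvPolynomial.aeval_def, MvPolynomial.hom_eval₂, hevC] at this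
  rw [MvPolynomial.eval, ← this]
  simp only [MvPolynomial.coe_eval₂Hom]
  congr 1
  funext i
  exact (hev i).symm

end RatOn

end Rational

/-! ### Dimension bounds from local parametrizations -/

section Charts

variable {W : Type*} [AddCommGroup W] [Module ℂ W]

/-- A submersion is locally open, so a relation between the coordinates of L on X is a polynomial
vanishing on an open subset of ℂ^s, hence zero. -/
theorem algebraicIndependent_of_hasStrictFDerivAt {E : Type*} [NormedAddCommGroup E]
    [NormedSpace ℂ E] [CompleteSpace E] {X : Set W} {s : ℕ} {Ψ : E → W}
    (hΨ : ∀ᶠ w in 𝓝 (0 : E), Ψ w ∈ X) (L : W →ₗ[ℂ] Fin s → ℂ) {f' : E →L[ℂ] Fin s → ℂ}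
    (hf : HasStrictFDerivAt (fun w => L (Ψ w)) f' 0) (hf' : Function.Surjective f') :
    AlgebraicIndependent ℂ fun i : Fin s =>
      (⟨_, linear_mem_polyFunctions X (LinearMap.proj i ∘ₗ L)⟩ : polyFunctions X) := by
  rw [algebraicIndependent_iff]
  intro P hP
  have hnhds := hf.map_nhds_eq_of_surj (LinearMap.range_eq_top.mpr hf')
  have hval : ∀ x : X, MvPolynomial.eval (L x) P = 0 := by
    intro x
    let ev : polyFunctions X →ₐ[ℂ] ℂ :=
      (Pi.evalAlgHom ℂ (fun _ : X => ℂ) x).comp (polyFunctions X).val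
    have h1 := congrArg ev hP
    rw [map_zero, ← AlgHom.comp_apply, MvPolynomial.comp_aeval] at h1
    rw [← h1, ← MvPolynomial.aeval_eq_eval]
    rfl
  have hev : ∀ᶠ y in 𝓝 (L (Ψ 0)), MvPolynomial.eval y P = 0 := by
    rw [← hnhds, eventually_map]
    filter_upwards [hΨ] with w hw
    exact hval ⟨_, hw⟩
  obtain ⟨ε, hε, hball⟩ := Metric.eventually_nhds_iff_ball.mp hev
  refine MvPolynomial.funext_set (fun i => Metric.ball (L (Ψ 0) i) ε)
    (fun i => infinite_of_mem_nhds _ (Metric.ball_mem_nhds _ hε)) fun y hy => ?_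
  rw [map_zero]
  refine hball y ?_
  rw [Metric.mem_ball, dist_pi_lt_iff hε]
  exact fun i => hy i trivial

/-- A set carrying `s` independent polynomial functions, in which finitely many rational
images of `s`-dimensional spaces are Zariski dense, has dimension `s`. -/
theorem zariskiDim_eq_of_charts [FiniteDimensional ℂ W] {X : Set W} (hX : X.Nonempty) {s : ℕ}
    (hlow : ∃ f : Fin s → polyFunctions X, AlgebraicIndependent ℂ f)
    {ι : Type*} [Finite ι] (E : ι → Type*) [∀ j, AddCommGroup (E j)] [∀ j, Module ℂ (E j)]
    [∀ j, FiniteDimensional ℂ (E j)] (hE : ∀ j, Module.finrank ℂ (E j) = s)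
    (D : ∀ j, Set (E j)) (Φ : ∀ j, E j → W)
    (hrat : ∀ j (φ : Module.Dual ℂ W), RatOn (D j) fun x => φ (Φ j x))
    (hdense : ∀ F ∈ polyMaps W, (∀ j, ∀ x ∈ D j, F (Φ j x) = 0) → ∀ x ∈ X, F x = 0) :
    zariskiDim X = s := by
  have : Nonempty X := hX.to_subtype
  obtain ⟨d, hd, ⟨f, hf⟩, hmax⟩ :=
    exists_ringKrullDim_eq_natCast (k := ℂ) (R := polyFunctions X)
  obtain ⟨f₀, hf₀⟩ := hlow
  have hsd : s ≤ d := hmax s f₀ hf₀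
  have hds : d ≤ s := by
    by_contra! hlt
    choose F hF hF' using fun i => exists_polyMaps_of_mem_polyFunctions (f i).2
    choose P hP0 hP using fun j => RatOn.exists_relation (E := E j) (D := D j)
      (by rw [hE j]; exact hlt) (fun i => RatOn.comp_polyMaps (hrat j) (hF i))
    have := Fintype.ofFinite ι
    -- If d > s, each chart gives a nonzero relation between the d independent functions. The
    -- product of these relations holds on every chart, hence on X by density, a contradiction.
    have hprod : ∏ j, P j ≠ 0 := Finset.prod_ne_zero_iff.mpr fun j _ => hP0 j
    refine hprod ?_
    rw [algebraicIndependent_iff] at hf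
    refine hf _ ?_
    have hG : ∀ Q : MvPolynomial (Fin d) ℂ, (fun w => MvPolynomial.eval (fun i => F i w) Q)
        ∈ polyMaps W := by
      intro Q
      have : (fun w => MvPolynomial.eval (fun i => F i w) Q)
          = MvPolynomial.aeval F Q := by
        funext w
        have := MvPolynomial.comp_aeval_apply F (Pi.evalAlgHom ℂ (fun _ : W => ℂ) w) Q
        rw [← MvPolynomial.aeval_eq_eval]
        exact this.symm
      rw [this]
      have h2 := MvPolynomial.comp_aeval_apply (fun i => (⟨F i, hF i⟩ : polyMaps W))
        (polyMaps W).val Q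
      have h3 : MvPolynomial.aeval F Q = (polyMaps W).val
        (MvPolynomial.aeval (fun i => (⟨F i, hF i⟩ : polyMaps W)) Q) := h2.symm
      rw [h3]
      exact Subtype.property _
    have hvan := hdense _ (hG (∏ j, P j)) fun j x hx => by
      rw [map_prod]
      exact Finset.prod_eq_zero (Finset.mem_univ j) (hP j x hx)
    ext x
    have h1 := MvPolynomial.comp_aeval_apply f
      ((Pi.evalAlgHom ℂ (fun _ : X => ℂ) x).comp (polyFunctions X).val) (∏ j, P j)
    have h2 : ((MvPolynomial.aeval f (∏ j, P j) : polyFunctions X) : X → ℂ) x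
      = MvPolynomial.aeval (fun i => (f i : X → ℂ) x) (∏ j, P j) := h1
    rw [h2, MvPolynomial.aeval_eq_eval]
    simp only [hF']
    exact hvan x x.2
  rw [zariskiDim, hd, le_antisymm hds hsd]

end Charts

end

section

open Filter Topology

/-! ### Polynomial square roots and orthogonal equivalence -/

section SquareRoot

open Polynomial

/-- Lagrange interpolation gives q with q(a)² = a at every root a of m, so q² - X is nilpotent
modulo m. As no root is 0, the derivative 2q is a unit there, and Newton's method corrects q to an
exact square root of X modulo m. -/
theorem exists_dvd_sq_sub_X {m : ℂ[X]} (hm : m.Monic) (h0 : m.eval 0 ≠ 0) :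
    ∃ p : ℂ[X], m ∣ p ^ 2 - X := by
  have hroot : ∀ a ∈ m.roots, a ≠ 0 := by
    rintro a ha rfl
    exact h0 (isRoot_of_mem_roots ha)
  have hprod : (m.roots.map fun a => X - C a).prod = m :=
    ((IsAlgClosed.splits m).eq_prod_roots_of_monic hm).symm
  choose sq hsq using fun a : ℂ => IsAlgClosed.exists_pow_nat_eq a (n := 2) (by norm_num)
  let q : ℂ[X] := Lagrange.interpolate m.roots.toFinset id sq
  have hq : ∀ a ∈ m.roots, q.eval a = sq a := fun a ha => by
    exact Lagrange.eval_interpolate_at_node (s := m.roots.toFinset) (v := id) (i := a) sq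
      (Function.injective_id.injOn) (Multiset.mem_toFinset.mpr ha)
  have hdvd : m ∣ (q ^ 2 - X) ^ Multiset.card m.roots := by
    rw [← Multiset.prod_replicate, ← Multiset.map_const']
    conv_lhs => rw [← hprod]
    refine Multiset.prod_dvd_prod_of_dvd _ _ fun a ha => ?_
    rw [dvd_iff_isRoot]
    simp [IsRoot, hq a ha, hsq]
  have hcop : IsCoprime q m := by
    rw [← hprod]
    refine Multiset.prod_induction (fun r => IsCoprime q r) _ (fun a b ha hb => ha.mul_right hb)
      isCoprime_one_right ?_
    intro r hr
    obtain ⟨a, ha, rfl⟩ := Multiset.mem_map.mp hr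
    refine ((Polynomial.prime_X_sub_C a).coprime_iff_not_dvd.mpr ?_).symm
    rw [dvd_iff_isRoot, IsRoot, hq a ha]
    intro h
    exact hroot a ha (by rw [← hsq a, h]; simp)
  have hnil : IsNilpotent (aeval (AdjoinRoot.mk m q)
      (X ^ 2 - C (AdjoinRoot.root m) : (AdjoinRoot m)[X])) := by
    refine ⟨Multiset.card m.roots, ?_⟩
    have : aeval (AdjoinRoot.mk m q) (X ^ 2 - C (AdjoinRoot.root m) : (AdjoinRoot m)[X])
        = AdjoinRoot.mk m (q ^ 2 - X) := by simp
    rw [this, ← map_pow]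
    exact AdjoinRoot.mk_eq_zero.mpr hdvd
  have hunit : IsUnit (aeval (AdjoinRoot.mk m q)
      (derivative (X ^ 2 - C (AdjoinRoot.root m) : (AdjoinRoot m)[X]))) := by
    have hq' : IsUnit (AdjoinRoot.mk m q) := by
      obtain ⟨u, v, huv⟩ := hcop
      refine IsUnit.of_mul_eq_one (AdjoinRoot.mk m u) ?_
      have := congrArg (AdjoinRoot.mk m) huv
      simpa [mul_comm] using this
    have h2 : IsUnit (algebraMap ℂ (AdjoinRoot m) 2) :=
      (isUnit_iff_ne_zero.mpr two_ne_zero).map _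
    rw [map_ofNat] at h2
    have := h2.mul hq'
    simpa [one_add_one_eq_two] using this
  obtain ⟨r, ⟨-, hr⟩, -⟩ := existsUnique_nilpotent_sub_and_aeval_eq_zero hnil hunit
  obtain ⟨p, rfl⟩ := AdjoinRoot.mk_surjective r
  refine ⟨p, AdjoinRoot.mk_eq_zero.mp ?_⟩
  simpa using hr

/-- The minimal polynomial of a unit does not vanish at 0, so X has a square root modulo it. The
point is that the root is a polynomial in x: it inherits symmetry and intertwining relations. -/
theorem exists_aeval_sq_eq {𝔸 : Type*} [Ring 𝔸] [Algebra ℂ 𝔸] [FiniteDimensional ℂ 𝔸] {x : 𝔸}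
    (hx : IsUnit x) : ∃ p : ℂ[X], aeval x p ^ 2 = x := by
  obtain _ | _ := subsingleton_or_nontrivial 𝔸
  · exact ⟨0, Subsingleton.elim _ _⟩
  have hint : IsIntegral ℂ x := Algebra.IsIntegral.isIntegral x
  have h0 : (minpoly ℂ x).eval 0 ≠ 0 := by
    intro h
    obtain ⟨g, hg⟩ := dvd_iff_isRoot.mpr h
    rw [C_0, sub_zero] at hg
    have h1 : aeval x g = 0 := by
      have := minpoly.aeval ℂ x
      rw [hg, map_mul, aeval_X] at this
      exact hx.mul_right_eq_zero.mp this
    have hmon : g.Monic := by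
      have := minpoly.monic hint
      rw [hg] at this
      exact Monic.of_mul_monic_left monic_X this
    have := minpoly.min ℂ x hmon h1
    rw [hg, degree_mul, degree_X, degree_eq_natDegree hmon.ne_zero] at this
    norm_cast at this
    omega
  obtain ⟨p, hp⟩ := exists_dvd_sq_sub_X (minpoly.monic hint) h0
  refine ⟨p, ?_⟩
  have := aeval_eq_zero_of_dvd_aeval_eq_zero hp (minpoly.aeval ℂ x)
  simpa [sub_eq_zero] using this

end SquareRoot

open Matrix Polynomial in
/-- Rectangular matrices which are equivalent, together with their transposes, are
orthogonally equivalent. -/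
theorem exists_orthogonal_equivalence {m n : Type*} [Fintype m] [Fintype n] [DecidableEq m]
    [DecidableEq n] {A A' : Matrix m n ℂ} {P : Matrix n n ℂ} {Q : Matrix m m ℂ} (hP : IsUnit P)
    (hQ : IsUnit Q) (h1 : Q * A = A' * P) (h2 : P * Aᵀ = A'ᵀ * Q) :
    ∃ (a : Matrix n n ℂ) (b : Matrix m m ℂ), aᵀ * a = 1 ∧ bᵀ * b = 1 ∧ b * A = A' * a := by
  have hPt : IsUnit Pᵀ := (Matrix.isUnit_transpose P).mpr hP
  have hQt : IsUnit Qᵀ := (Matrix.isUnit_transpose Q).mpr hQ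
  have h2' : A * Pᵀ = Qᵀ * A' := by
    have := congrArg Matrix.transpose h2
    simpa using this
  have hcomm : (Qᵀ * Q) * A = A * (Pᵀ * P) := by
    rw [Matrix.mul_assoc, h1, ← Matrix.mul_assoc, ← h2', Matrix.mul_assoc]
  -- Taking the root in the product algebra yields one polynomial p for both PᵀP and QᵀQ; only then
  -- do the two roots intertwine with A.
  have hu : IsUnit ((Pᵀ * P, Qᵀ * Q) : Matrix n n ℂ × Matrix m m ℂ) :=
    Prod.isUnit_iff.mpr ⟨hPt.mul hP, hQt.mul hQ⟩
  obtain ⟨p, hp⟩ := exists_aeval_sq_eq hu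
  have hp1 : aeval (Pᵀ * P) p ^ 2 = Pᵀ * P := by
    have := congrArg Prod.fst hp
    have h3 := aeval_algHom_apply (AlgHom.fst ℂ (Matrix n n ℂ) (Matrix m m ℂ)) (Pᵀ * P, Qᵀ * Q) p
    simp only [AlgHom.fst_apply] at h3
    rw [h3]
    exact this
  have hp2 : aeval (Qᵀ * Q) p ^ 2 = Qᵀ * Q := by
    have := congrArg Prod.snd hp
    have h3 := aeval_algHom_apply (AlgHom.snd ℂ (Matrix n n ℂ) (Matrix m m ℂ)) (Pᵀ * P, Qᵀ * Q) p
    simp only [AlgHom.snd_apply] at h3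
    rw [h3]
    exact this
  have hpow : ∀ k : ℕ, (Qᵀ * Q) ^ k * A = A * (Pᵀ * P) ^ k := by
    intro k
    induction k with
    | zero => simp
    | succ k ih =>
      rw [pow_succ, Matrix.mul_assoc, hcomm, ← Matrix.mul_assoc, ih, Matrix.mul_assoc, pow_succ]
  have hinter : ∀ r : ℂ[X], aeval (Qᵀ * Q) r * A = A * aeval (Pᵀ * P) r := by
    intro r
    simp only [aeval_eq_sum_range, Matrix.sum_mul, Matrix.mul_sum, Matrix.smul_mul,
      Matrix.mul_smul, hpow]
  set S := aeval (Pᵀ * P) p with hS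
  set T := aeval (Qᵀ * Q) p with hT
  have hSt : Sᵀ = S := by
    simp only [hS, aeval_eq_sum_range, Matrix.transpose_sum, Matrix.transpose_smul,
      Matrix.transpose_pow, Matrix.transpose_mul, Matrix.transpose_transpose]
  have hTt : Tᵀ = T := by
    simp only [hT, aeval_eq_sum_range, Matrix.transpose_sum, Matrix.transpose_smul,
      Matrix.transpose_pow, Matrix.transpose_mul, Matrix.transpose_transpose]
  have hSu : IsUnit S := (isUnit_pow_iff two_ne_zero).mp (hp1 ▸ hPt.mul hP)
  have hTu : IsUnit T := (isUnit_pow_iff two_ne_zero).mp (hp2 ▸ hQt.mul hQ)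
  have hSd := (Matrix.isUnit_iff_isUnit_det S).mp hSu
  have hTd := (Matrix.isUnit_iff_isUnit_det T).mp hTu
  -- The orthogonal factors of the polar decompositions of P and Q.
  refine ⟨P * S⁻¹, Q * T⁻¹, ?_, ?_, ?_⟩
  · rw [Matrix.transpose_mul, Matrix.transpose_nonsing_inv, hSt, Matrix.mul_assoc,
      ← Matrix.mul_assoc Pᵀ, ← hp1, pow_two, Matrix.mul_assoc S, Matrix.mul_nonsing_inv _ hSd,
      Matrix.mul_one, Matrix.nonsing_inv_mul _ hSd]
  · rw [Matrix.transpose_mul, Matrix.transpose_nonsing_inv, hTt, Matrix.mul_assoc,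
      ← Matrix.mul_assoc Qᵀ, ← hp2, pow_two, Matrix.mul_assoc T, Matrix.mul_nonsing_inv _ hTd,
      Matrix.mul_one, Matrix.nonsing_inv_mul _ hTd]
  · have hTS : T⁻¹ * A = A * S⁻¹ := by
      have := hinter p
      calc T⁻¹ * A = T⁻¹ * (A * S) * S⁻¹ := by
            rw [Matrix.mul_assoc, Matrix.mul_assoc, Matrix.mul_nonsing_inv _ hSd, Matrix.mul_one]
        _ = A * S⁻¹ := by
            rw [← this, ← Matrix.mul_assoc, Matrix.nonsing_inv_mul _ hTd, Matrix.one_mul]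
    rw [Matrix.mul_assoc, hTS, ← Matrix.mul_assoc, h1, Matrix.mul_assoc]

end

section

open Filter Topology Matrix

/-! ### The Cayley transform -/

section Cayley

variable {n m : Type*} [Fintype n] [DecidableEq n] [Fintype m] [DecidableEq m]

/-- The Cayley transform. -/
noncomputable def cay (a : Matrix n n ℂ) : Matrix n n ℂ := (1 + a) * (1 - a)⁻¹

/-- The inverse of the Cayley transform. -/
noncomputable def cayInv (g : Matrix n n ℂ) : Matrix n n ℂ := (g - 1) * (g + 1)⁻¹

@[simp] theorem cay_zero : cay (0 : Matrix n n ℂ) = 1 := by simp [cay]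

theorem cay_eq (a : Matrix n n ℂ) : cay a = (1 - a)⁻¹ * (1 + a) := by
  have h : Commute (1 + a) (1 - a) := by
    rw [commute_iff_eq]; noncomm_ring
  rw [cay]
  by_cases hu : IsUnit (1 - a).det
  · calc (1 + a) * (1 - a)⁻¹ = (1 - a)⁻¹ * ((1 - a) * (1 + a)) * (1 - a)⁻¹ := by
          rw [Matrix.nonsing_inv_mul_cancel_left _ _ hu]
      _ = (1 - a)⁻¹ * (1 + a) := by
          rw [← h.eq, Matrix.mul_assoc, Matrix.mul_nonsing_inv_cancel_right _ _ hu]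
  · rw [Matrix.nonsing_inv_apply_not_isUnit _ hu]; simp

theorem isUnit_det_one_add {a : Matrix n n ℂ} (ha : aᵀ = -a) (hu : IsUnit (1 - a).det) :
    IsUnit (1 + a).det := by
  rw [← Matrix.det_transpose]
  simpa [ha, sub_eq_add_neg] using hu

theorem cay_transpose {a : Matrix n n ℂ} (ha : aᵀ = -a) : (cay a)ᵀ = (1 + a)⁻¹ * (1 - a) := by
  rw [cay, Matrix.transpose_mul, Matrix.transpose_nonsing_inv]
  simp [ha, sub_eq_add_neg]

theorem cay_transpose_mul_cay {a : Matrix n n ℂ} (ha : aᵀ = -a) (hu : IsUnit (1 - a).det) :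
    (cay a)ᵀ * cay a = 1 := by
  rw [cay_transpose ha, cay_eq, Matrix.mul_assoc, Matrix.mul_nonsing_inv_cancel_left _ _ hu,
    Matrix.nonsing_inv_mul _ (isUnit_det_one_add ha hu)]

theorem cay_intertwine {a : Matrix n n ℂ} {b : Matrix m m ℂ} {A : Matrix m n ℂ}
    (hA : b * A = A * a) (ha : IsUnit (1 - a).det) (hb : IsUnit (1 - b).det) :
    cay b * A = A * cay a := by
  have h1 : (1 - b)⁻¹ * A = A * (1 - a)⁻¹ := by
    have h2 : (1 - b) * A = A * (1 - a) := by simp [Matrix.sub_mul, Matrix.mul_sub, hA]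
    calc (1 - b)⁻¹ * A = (1 - b)⁻¹ * (A * (1 - a)) * (1 - a)⁻¹ := by
          rw [Matrix.mul_assoc, Matrix.mul_nonsing_inv_cancel_right _ _ ha]
      _ = A * (1 - a)⁻¹ := by
          rw [← h2, Matrix.nonsing_inv_mul_cancel_left _ _ hb]
  rw [cay, cay, Matrix.mul_assoc, h1, ← Matrix.mul_assoc, ← Matrix.mul_assoc]
  congr 1
  simp [Matrix.add_mul, Matrix.mul_add, hA]

theorem one_sub_cayInv {g : Matrix n n ℂ} (hu : IsUnit (g + 1).det) :
    1 - cayInv g = (2 : ℂ) • (g + 1)⁻¹ := by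
  have : (1 : Matrix n n ℂ) = (g + 1) * (g + 1)⁻¹ := (Matrix.mul_nonsing_inv _ hu).symm
  conv_lhs => rw [this]
  rw [cayInv, ← Matrix.sub_mul]
  have : g + 1 - (g - 1) = (2 : ℂ) • (1 : Matrix n n ℂ) := by
    rw [two_smul]; abel
  rw [this, Matrix.smul_mul, Matrix.one_mul]

theorem one_add_cayInv {g : Matrix n n ℂ} (hu : IsUnit (g + 1).det) :
    1 + cayInv g = (2 : ℂ) • (g * (g + 1)⁻¹) := by
  have : (1 : Matrix n n ℂ) = (g + 1) * (g + 1)⁻¹ := (Matrix.mul_nonsing_inv _ hu).symm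
  conv_lhs => rw [this]
  rw [cayInv, ← Matrix.add_mul]
  have : g + 1 + (g - 1) = (2 : ℂ) • g := by
    rw [two_smul]; abel
  rw [this, Matrix.smul_mul]

theorem isUnit_det_one_sub_cayInv {g : Matrix n n ℂ} (hu : IsUnit (g + 1).det) :
    IsUnit (1 - cayInv g).det := by
  rw [one_sub_cayInv hu, Matrix.det_smul]
  exact ((isUnit_iff_ne_zero.mpr two_ne_zero).pow _).mul
    ((Matrix.isUnit_nonsing_inv_det _ hu))

theorem cay_cayInv {g : Matrix n n ℂ} (hu : IsUnit (g + 1).det) : cay (cayInv g) = g := by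
  have h1 : 1 + cayInv g = g * (1 - cayInv g) := by
    rw [one_sub_cayInv hu, one_add_cayInv hu, Matrix.mul_smul]
  rw [cay, h1, Matrix.mul_nonsing_inv_cancel_right _ _ (isUnit_det_one_sub_cayInv hu)]

theorem cayInv_transpose {g : Matrix n n ℂ} (hg : gᵀ * g = 1) (hu : IsUnit (g + 1).det) :
    (cayInv g)ᵀ = - cayInv g := by
  have hg' : g * gᵀ = 1 := mul_eq_one_comm.mp hg
  have hut : IsUnit (gᵀ + 1).det := by
    rw [← Matrix.det_transpose]
    simpa using hu
  have h1 : (g + 1)⁻¹ = (gᵀ + 1)⁻¹ * gᵀ := by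
    have h2 : gᵀ * (g + 1) = gᵀ + 1 := by rw [Matrix.mul_add, hg, Matrix.mul_one, add_comm]
    calc (g + 1)⁻¹ = (gᵀ + 1)⁻¹ * (gᵀ + 1) * (g + 1)⁻¹ := by
          rw [Matrix.nonsing_inv_mul _ hut, Matrix.one_mul]
      _ = (gᵀ + 1)⁻¹ * gᵀ := by
          rw [← h2, Matrix.mul_assoc, Matrix.mul_assoc, Matrix.mul_nonsing_inv _ hu,
            Matrix.mul_one, h2]
  have hc : Commute (g - 1) (g + 1)⁻¹ := by
    have h3 : Commute (g - 1) (g + 1) := by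
      rw [commute_iff_eq]; noncomm_ring
    have h4 := (Matrix.isUnit_iff_isUnit_det _).mpr hu
    obtain ⟨u, hu'⟩ := h4
    rw [← hu'] at h3 ⊢
    rw [← Matrix.coe_units_inv]
    exact h3.units_inv_right
  rw [cayInv, Matrix.transpose_mul, Matrix.transpose_nonsing_inv, hc.eq, h1]
  simp only [Matrix.transpose_add, Matrix.transpose_sub, Matrix.transpose_one]
  rw [Matrix.mul_assoc, ← Matrix.mul_neg, Matrix.mul_sub gᵀ, hg, Matrix.mul_one, neg_sub]

theorem cayInv_commute {g c : Matrix n n ℂ} (hc : g * c = c * g) :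
    cayInv g * c = c * cayInv g := by
  have h1 : (g + 1)⁻¹ * c = c * (g + 1)⁻¹ := by
    by_cases hu : IsUnit (g + 1).det
    · have h2 : (g + 1) * c = c * (g + 1) := by simp [add_mul, mul_add, hc]
      calc (g + 1)⁻¹ * c = (g + 1)⁻¹ * (c * (g + 1)) * (g + 1)⁻¹ := by
            rw [Matrix.mul_assoc, Matrix.mul_nonsing_inv_cancel_right _ _ hu]
        _ = c * (g + 1)⁻¹ := by
            rw [← h2, Matrix.nonsing_inv_mul_cancel_left _ _ hu]
    · rw [Matrix.nonsing_inv_apply_not_isUnit _ hu]; simp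
  rw [cayInv, Matrix.mul_assoc, h1, ← Matrix.mul_assoc, ← Matrix.mul_assoc]
  congr 1
  simp [sub_mul, mul_sub, hc]

end Cayley

/-! ### Derivatives of the Cayley transform at the origin -/

section CayleyDerivative

open scoped Matrix.Norms.Operator

variable {n : Type*} [Fintype n] [DecidableEq n]
variable {F : Type*} [NormedAddCommGroup F] [NormedSpace ℂ F]

/-- All derivatives are needed only where the value is a scalar matrix; there noncommutativity plays
no role and the formulas are those of scalar calculus. -/
theorem hasStrictFDerivAt_inv_of_eq {f : F → Matrix n n ℂ} {f' : F →L[ℂ] Matrix n n ℂ} {c : ℂ}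
    (hc : c ≠ 0) (hf : HasStrictFDerivAt f f' 0) (h0 : f 0 = c • 1) :
    HasStrictFDerivAt (fun x => (f x)⁻¹) (-(c⁻¹ ^ 2) • f') 0 := by
  let u : (Matrix n n ℂ)ˣ := ⟨c • 1, c⁻¹ • 1, by simp [hc, smul_smul], by simp [hc, smul_smul]⟩
  have h1 := hasStrictFDerivAt_ringInverse (𝕜 := ℂ) u
  have hu : (u : Matrix n n ℂ) = f 0 := h0.symm
  rw [hu] at h1
  have h3 := h1.comp (0 : F) hf
  have h4 : (fun x => (f x)⁻¹) = Ring.inverse ∘ f := by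
    funext x; simp [Matrix.nonsing_inv_eq_ringInverse]
  rw [h4]
  refine h3.congr_fderiv (ContinuousLinearMap.ext fun x => ?_)
  change -((c⁻¹ • (1 : Matrix n n ℂ)) * f' x * (c⁻¹ • (1 : Matrix n n ℂ))) = -(c⁻¹ ^ 2) • f' x
  simp [smul_smul, pow_two]

theorem hasStrictFDerivAt_mul_of_eq {f g : F → Matrix n n ℂ} {f' g' : F →L[ℂ] Matrix n n ℂ}
    {c d : ℂ} (hf : HasStrictFDerivAt f f' 0) (hg : HasStrictFDerivAt g g' 0) (h0 : f 0 = c • 1)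
    (h1 : g 0 = d • 1) : HasStrictFDerivAt (fun x => f x * g x) (d • f' + c • g') 0 := by
  refine (hf.mul' hg).congr_fderiv (ContinuousLinearMap.ext fun x => ?_)
  change f 0 * g' x + f' x * g 0 = d • f' x + c • g' x
  simp [h0, h1, add_comm]

theorem hasStrictFDerivAt_cay (L : F →L[ℂ] Matrix n n ℂ) :
    HasStrictFDerivAt (fun x => cay (L x)) ((2 : ℂ) • L) 0 := by
  have h1 : HasStrictFDerivAt (fun x => 1 + L x) L 0 := L.hasStrictFDerivAt.const_add 1
  have h2 : HasStrictFDerivAt (fun x => 1 - L x) (-L) 0 := L.hasStrictFDerivAt.const_sub 1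
  have h3 := hasStrictFDerivAt_inv_of_eq (c := 1) one_ne_zero h2 (by simp)
  have h4 := hasStrictFDerivAt_mul_of_eq (c := 1) (d := 1) h1 h3 (by simp) (by simp)
  refine h4.congr_fderiv (ContinuousLinearMap.ext fun x => ?_)
  change (1 : ℂ) • L x + (1 : ℂ) • (-(1⁻¹ ^ 2 : ℂ) • (- L x)) = (2 : ℂ) • L x
  simp [two_smul]

theorem hasStrictFDerivAt_cayInv {f : F → Matrix n n ℂ} {f' : F →L[ℂ] Matrix n n ℂ}
    (hf : HasStrictFDerivAt f f' 0) (h0 : f 0 = 1) :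
    HasStrictFDerivAt (fun x => cayInv (f x)) ((2⁻¹ : ℂ) • f') 0 := by
  have h1 : HasStrictFDerivAt (fun x => f x - 1) f' 0 := hf.sub_const 1
  have h2 : HasStrictFDerivAt (fun x => f x + 1) f' 0 := hf.add_const 1
  have h3 := hasStrictFDerivAt_inv_of_eq (c := 2) two_ne_zero h2 (by rw [h0, two_smul])
  have h4 := hasStrictFDerivAt_mul_of_eq (c := 0) (d := 2⁻¹) h1 h3 (by simp [h0]) (by
    rw [h0]
    refine Matrix.inv_eq_right_inv ?_
    rw [← two_smul ℂ (1 : Matrix n n ℂ)]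
    simp [smul_smul])
  refine h4.congr_fderiv (ContinuousLinearMap.ext fun x => ?_)
  change (2⁻¹ : ℂ) • f' x + (0 : ℂ) • (-(2⁻¹ ^ 2 : ℂ) • f' x) = (2⁻¹ : ℂ) • f' x
  simp

theorem eventually_isUnit_det {T : Type*} [TopologicalSpace T] {f : T → Matrix n n ℂ} {x₀ : T} (hf : ContinuousAt f x₀)
    (h0 : IsUnit (f x₀).det) : ∀ᶠ x in 𝓝 x₀, IsUnit (f x).det := by
  simp only [isUnit_iff_ne_zero] at h0 ⊢
  have hdet : Continuous fun M : Matrix n n ℂ => M.det := continuous_id.matrix_det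
  exact (hdet.continuousAt.comp hf).eventually_ne h0

end CayleyDerivative

/-! ### Matrices with rational entries -/

section RationalMatrices

variable {E : Type*} [AddCommGroup E] [Module ℂ E] {D : Set E}
variable {l m n : Type*}

theorem RatOn.prod {ι : Type*} (s : Finset ι) {f : ι → E → ℂ} (hf : ∀ i ∈ s, RatOn D (f i)) :
    RatOn D fun x => ∏ i ∈ s, f i x := by
  classical
  induction s using Finset.induction_on with
  | empty => simpa using RatOn.const 1
  | insert a s ha ih =>
    simp only [Finset.prod_insert ha]
    exact (hf a (Finset.mem_insert_self a s)).mul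
      (ih fun i hi => hf i (Finset.mem_insert_of_mem hi))

/-- A matrix-valued function with rational entries. -/
def RatMat (D : Set E) (M : E → Matrix m n ℂ) : Prop := ∀ a b, RatOn D fun x => M x a b

namespace RatMat

theorem linear (L : E →ₗ[ℂ] Matrix m n ℂ) : RatMat D fun x => L x := fun a b =>
  RatOn.of_polyMaps (linear_mem_polyMaps
    (LinearMap.proj b ∘ₗ LinearMap.proj a ∘ₗ (Matrix.ofLinearEquiv ℂ).symm.toLinearMap ∘ₗ L))

theorem const (M : Matrix m n ℂ) : RatMat D fun _ : E => M := fun a b => RatOn.const (M a b)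

theorem add {M N : E → Matrix m n ℂ} (hM : RatMat D M) (hN : RatMat D N) :
    RatMat D fun x => M x + N x := fun a b => (hM a b).add (hN a b)

theorem mul [Fintype n] {M : E → Matrix m n ℂ} {N : E → Matrix n l ℂ} (hM : RatMat D M)
    (hN : RatMat D N) : RatMat D fun x => M x * N x := fun a b => by
  simp only [Matrix.mul_apply]
  exact RatOn.sum _ fun i _ => (hM a i).mul (hN i b)

theorem transpose {M : E → Matrix m n ℂ} (hM : RatMat D M) : RatMat D fun x => (M x)ᵀ :=
  fun a b => hM b a

variable [Fintype n] [DecidableEq n]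

theorem det {M : E → Matrix n n ℂ} (hM : RatMat D M) : RatOn D fun x => (M x).det := by
  simp only [Matrix.det_apply']
  exact RatOn.sum _ fun σ _ => (RatOn.const _).mul (RatOn.prod _ fun i _ => hM _ _)

theorem inv {M : E → Matrix n n ℂ} (hM : RatMat D M) (hu : ∀ x ∈ D, IsUnit (M x).det) :
    RatMat D fun x => (M x)⁻¹ := by
  intro a b
  have h1 : RatOn D fun x => ((M x).det)⁻¹ := hM.det.inv fun x hx => (hu x hx).ne_zero
  have h2 : RatOn D fun x => (M x).adjugate a b := by
    simp only [Matrix.adjugate_apply]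
    refine det fun c d => ?_
    by_cases hc : c = b
    · subst hc
      simp only [Matrix.updateRow_self]
      exact RatOn.const _
    · simp only [Matrix.updateRow_ne hc]
      exact hM c d
  simp only [Matrix.inv_def, Matrix.smul_apply, smul_eq_mul, Ring.inverse_eq_inv']
  exact h1.mul h2

theorem cay {M : E → Matrix n n ℂ} (hM : RatMat D M) (hu : ∀ x ∈ D, IsUnit (1 - M x).det) :
    RatMat D fun x => OrthoStrata.cay (M x) := by
  have h1 : RatMat D fun x => 1 - M x := by
    have : (fun x => 1 - M x) = fun x => 1 + (-1 : Matrix n n ℂ) * M x := by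
      funext x; simp [sub_eq_add_neg]
    rw [this]
    exact (const 1).add ((const _).mul hM)
  exact ((const 1).add hM).mul (h1.inv hu)

end RatMat

end RationalMatrices

end

section

open Filter Topology Matrix

/-! ### Families of matrices along the quiver -/

section Families

variable {t : ℕ} {n : ℕ → ℕ}

/-- Square matrices at the sources of the arrows. -/
abbrev SqSrc (t : ℕ) (n : ℕ → ℕ) := ∀ i : Fin t, Matrix (Fin (n i)) (Fin (n i)) ℂ

/-- Square matrices at the targets of the arrows. -/
abbrev SqTgt (t : ℕ) (n : ℕ → ℕ) :=
  ∀ i : Fin t, Matrix (Fin (n (i + 1))) (Fin (n (i + 1))) ℂ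

/-- Rectangular matrices along the arrows. -/
abbrev RectFam (t : ℕ) (n : ℕ → ℕ) := ∀ i : Fin t, Matrix (Fin (n (i + 1))) (Fin (n i)) ℂ

/-- Reindexing from targets to sources, with a prescribed value at the first source. -/
def shift (x₀ : Matrix (Fin (n 0)) (Fin (n 0)) ℂ) (g : SqTgt t n) : SqSrc t n
  | ⟨0, _⟩ => x₀
  | ⟨j + 1, h⟩ => g ⟨j, Nat.lt_of_succ_lt h⟩

/-- `shift 0` as a linear map. -/
def shiftL (t : ℕ) (n : ℕ → ℕ) : SqTgt t n →ₗ[ℂ] SqSrc t n where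
  toFun := shift 0
  map_add' x y := by
    funext ⟨i, hi⟩
    cases i <;> simp [shift]
  map_smul' c x := by
    funext ⟨i, hi⟩
    cases i <;> simp [shift]

theorem shiftL_apply (g : SqTgt t n) : shiftL t n g = shift 0 g := rfl

theorem cay_shiftL (k : SqTgt t n) (i : Fin t) :
    cay (shiftL t n k i) = shift 1 (fun j => cay (k j)) i := by
  obtain ⟨i, hi⟩ := i
  cases i <;> simp [shiftL_apply, shift]

theorem shift_orthogonal {g : SqTgt t n} (hg : ∀ i, (g i)ᵀ * g i = 1) (i : Fin t) :
    (shift 1 g i)ᵀ * shift 1 g i = 1 := by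
  obtain ⟨i, hi⟩ := i
  cases i with
  | zero => simp [shift]
  | succ j => exact hg _

/-- The commutation relation between consecutive arrows. -/
def IsLinked (A : RectFam t n) : Prop :=
  ∀ (i : ℕ) (h : i + 1 < t),
    A ⟨i, Nat.lt_of_succ_lt h⟩ * (A ⟨i, Nat.lt_of_succ_lt h⟩)ᵀ
      = (A ⟨i + 1, h⟩)ᵀ * A ⟨i + 1, h⟩

/-- The operators `A Aᵀ`, placed at the sources; zero at the first source. -/
def moment (A : RectFam t n) : SqSrc t n := shift 0 fun i => A i * (A i)ᵀ

/-- Infinitesimal parameters of a stratum at the point `A`. -/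
def paramSpace (A : RectFam t n) : Submodule ℂ (SqTgt t n × SqSrc t n) where
  carrier := {w | (∀ i, (w.1 i)ᵀ = -w.1 i) ∧ (∀ i, (w.2 i)ᵀ = -w.2 i) ∧
    ∀ i, w.2 i * moment A i = moment A i * w.2 i}
  add_mem' := fun {a b} ha hb => ⟨fun i => by simp [ha.1 i, hb.1 i, add_comm],
    fun i => by simp [ha.2.1 i, hb.2.1 i, add_comm],
    fun i => by simp [add_mul, mul_add, ha.2.2 i, hb.2.2 i]⟩
  zero_mem' := ⟨by simp, by simp, by simp⟩
  smul_mem' := fun c a ha => ⟨fun i => by simp [ha.1 i], fun i => by simp [ha.2.1 i],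
    fun i => by simp [ha.2.2 i]⟩

/-- Infinitesimal stabilizers of the single arrows of `A`. -/
def stabSpace (A : RectFam t n) : Submodule ℂ (SqSrc t n × SqTgt t n) where
  carrier := {w | (∀ i, (w.1 i)ᵀ = -w.1 i) ∧ (∀ i, (w.2 i)ᵀ = -w.2 i) ∧
    ∀ i, w.2 i * A i = A i * w.1 i}
  add_mem' := fun {a b} ha hb => ⟨fun i => by simp [ha.1 i, hb.1 i, add_comm],
    fun i => by simp [ha.2.1 i, hb.2.1 i, add_comm],
    fun i => by simp [Matrix.add_mul, Matrix.mul_add, ha.2.2 i, hb.2.2 i]⟩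
  zero_mem' := ⟨by simp, by simp, by simp⟩
  smul_mem' := fun c a ha => ⟨fun i => by simp [ha.1 i], fun i => by simp [ha.2.1 i],
    fun i => by simp [ha.2.2 i]⟩

theorem shift_zero_transpose {g : SqTgt t n} (hg : ∀ i, (g i)ᵀ = -g i) (i : Fin t) :
    (shift 0 g i)ᵀ = -shift 0 g i := by
  obtain ⟨i, hi⟩ := i
  cases i with
  | zero => simp [shift]
  | succ j => exact hg _

/-- Intertwining both A and Aᵀ makes u commute with AᵀA, which by the linking relation is the A Aᵀ
of the preceding arrow. At the first source the moment is 0 and there is nothing to check. -/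
theorem commute_moment {A : RectFam t n} {u : SqSrc t n} {v : SqTgt t n}
    (hA : IsLinked A) (h1 : ∀ i, v i * A i = A i * u i) (h2 : ∀ i, u i * (A i)ᵀ = (A i)ᵀ * v i)
    (i : Fin t) : u i * moment A i = moment A i * u i := by
  obtain ⟨i, hi⟩ := i
  cases i with
  | zero => simp [moment, shift]
  | succ j =>
    simp only [moment, shift]
    rw [hA j hi, ← Matrix.mul_assoc, h2, Matrix.mul_assoc, h1, Matrix.mul_assoc]

theorem commute_moment_shift {A : RectFam t n} (x₀ : Matrix (Fin (n 0)) (Fin (n 0)) ℂ)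
    {u : SqSrc t n} {v : SqTgt t n}
    (h1 : ∀ i, v i * A i = A i * u i) (h2 : ∀ i, u i * (A i)ᵀ = (A i)ᵀ * v i)
    (i : Fin t) : shift x₀ v i * moment A i = moment A i * shift x₀ v i := by
  obtain ⟨i, hi⟩ := i
  cases i with
  | zero => simp [moment, shift]
  | succ j =>
    simp only [moment, shift]
    rw [← Matrix.mul_assoc, h1, Matrix.mul_assoc, h2, Matrix.mul_assoc]

theorem stab_transpose {A : RectFam t n} {w : SqSrc t n × SqTgt t n} (hw : w ∈ stabSpace A)
    (i : Fin t) : w.1 i * (A i)ᵀ = (A i)ᵀ * w.2 i := by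
  have := congrArg Matrix.transpose (hw.2.2 i)
  simp only [Matrix.transpose_mul, hw.1 i, hw.2.1 i, Matrix.mul_neg, Matrix.neg_mul,
    neg_inj] at this
  exact this.symm

/-- The directions in the parameter space which do not move the point. -/
def stabIncl {A : RectFam t n} (hA : IsLinked A) : stabSpace A →ₗ[ℂ] paramSpace A where
  -- The target motion v of one arrow already acts, through the shift, on the source of the next. To
  -- produce the total source motion u the free source parameter must be the difference.
  toFun w := ⟨(w.1.2, w.1.1 - shiftL t n w.1.2), w.2.2.1, fun i => by
      simp only [Pi.sub_apply, Matrix.transpose_sub, w.2.1 i, shiftL_apply,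
        shift_zero_transpose w.2.2.1 i]
      abel, fun i => by
      simp only [Pi.sub_apply, sub_mul, mul_sub, shiftL_apply]
      rw [commute_moment hA w.2.2.2 (stab_transpose w.2),
        commute_moment_shift 0 w.2.2.2 (stab_transpose w.2)]⟩
  map_add' x y := by
    ext1
    simp only [Submodule.coe_add, Prod.fst_add, Prod.snd_add, map_add, Prod.mk_add_mk]
    congr 1
    abel
  map_smul' c x := by
    ext1
    simp [smul_sub]

theorem stabIncl_injective {A : RectFam t n} (hA : IsLinked A) :
    Function.Injective (stabIncl hA) := by
  intro x y hxy
  have h := congrArg Subtype.val hxy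
  have h1 : x.1.2 = y.1.2 := congrArg Prod.fst h
  have h2 : x.1.1 - shiftL t n x.1.2 = y.1.1 - shiftL t n y.1.2 := congrArg Prod.snd h
  rw [h1] at h2
  exact Subtype.ext (Prod.ext (sub_left_injective h2) h1)

/-- The derivative of `chart` at the origin. -/
def chartDeriv (A : RectFam t n) : SqTgt t n × SqSrc t n →ₗ[ℂ] RectFam t n where
  toFun w i := (2 : ℂ) • (w.1 i * A i + A i * ((w.2 i)ᵀ + (shiftL t n w.1 i)ᵀ))
  map_add' x y := by
    funext i
    simp only [Prod.fst_add, Prod.snd_add, map_add, Pi.add_apply, Matrix.transpose_add,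
      Matrix.add_mul, Matrix.mul_add, ← smul_add]
    congr 1
    abel
  map_smul' c x := by
    funext i
    simp only [Prod.smul_fst, Prod.smul_snd, map_smul, Pi.smul_apply, Matrix.transpose_smul,
      Matrix.smul_mul, ← smul_add, Matrix.mul_smul, RingHom.id_apply, smul_comm c (2 : ℂ)]

/-- For skew parameters (k, σ) the derivative vanishes iff k A = A (σ + shift k) on each arrow, that
is, iff (σ + shift k, k) is an infinitesimal stabilizer. -/
theorem ker_chartDeriv {A : RectFam t n} (hA : IsLinked A) :
    LinearMap.ker (chartDeriv A ∘ₗ (paramSpace A).subtype) = LinearMap.range (stabIncl hA) := by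
  ext ⟨w, hw⟩
  have key : chartDeriv A w = 0 ↔ ∀ i, w.1 i * A i = A i * (w.2 i + shift 0 w.1 i) := by
    rw [funext_iff]
    refine forall_congr' fun i => ?_
    change (2 : ℂ) • (w.1 i * A i + A i * ((w.2 i)ᵀ + (shift 0 w.1 i)ᵀ)) = 0 ↔ _
    rw [hw.2.1 i, shift_zero_transpose hw.1 i, ← neg_add, Matrix.mul_neg, ← sub_eq_add_neg,
      smul_eq_zero_iff_right two_ne_zero, sub_eq_zero]
  constructor
  · intro h
    have h' := key.mp (by simpa using h)
    refine ⟨⟨(w.2 + shift 0 w.1, w.1), fun i => ?_, hw.1, h'⟩, ?_⟩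
    · simp only [Pi.add_apply, Matrix.transpose_add, hw.2.1 i, shift_zero_transpose hw.1 i]
      abel
    · refine Subtype.ext (Prod.ext rfl ?_)
      simp [stabIncl, shiftL_apply]
  · rintro ⟨v, hv⟩
    have hv' := congrArg Subtype.val hv
    simp only [stabIncl, LinearMap.coe_mk, AddHom.coe_mk] at hv'
    rw [LinearMap.mem_ker, LinearMap.comp_apply, Submodule.subtype_apply]
    refine key.mpr ?_
    subst hv'
    intro i
    simpa [shiftL_apply] using v.2.2.2 i

/-- The rational parametrization of a stratum around the point `A`. -/
noncomputable def chart (A : RectFam t n) (w : SqTgt t n × SqSrc t n) : RectFam t n := fun i =>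
  cay (w.1 i) * A i * ((cay (w.2 i))ᵀ * (cay (shiftL t n w.1 i))ᵀ)

/-- The domain of definition of `chart`. -/
def chartDom (A : RectFam t n) : Set (paramSpace A) :=
  {w | ∀ i, IsUnit (1 - w.1.1 i).det ∧ IsUnit (1 - w.1.2 i).det}

theorem isUnit_one_sub_shiftL {k : SqTgt t n} (hk : ∀ i, IsUnit (1 - k i).det) (i : Fin t) :
    IsUnit (1 - shiftL t n k i).det := by
  obtain ⟨i, hi⟩ := i
  cases i with
  | zero => simp [shiftL_apply, shift]
  | succ j => exact hk ⟨j, Nat.lt_of_succ_lt hi⟩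

theorem ratOn_dual_of_entries {E : Type*} [AddCommGroup E] [Module ℂ E] {D : Set E}
    {Φ : E → RectFam t n} (hΦ : ∀ i, RatMat D fun x => Φ x i)
    (φ : Module.Dual ℂ (RectFam t n)) : RatOn D fun x => φ (Φ x) := by
  have h : ∀ M : RectFam t n, φ M = ∑ i, ∑ a, ∑ b,
      M i a b * φ (Pi.single i (Matrix.single a b 1)) := by
    intro M
    have h1 : M = ∑ i, ∑ a, ∑ b, M i a b • Pi.single i (Matrix.single a b (1 : ℂ)) := by
      conv_lhs => rw [← Finset.univ_sum_single M]
      refine Finset.sum_congr rfl fun i _ => ?_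
      conv_lhs => rw [Matrix.matrix_eq_sum_single (M i)]
      rw [← LinearMap.coe_single (R := ℂ), map_sum]
      refine Finset.sum_congr rfl fun a _ => ?_
      rw [map_sum]
      refine Finset.sum_congr rfl fun b _ => ?_
      rw [← map_smul, Matrix.smul_single, smul_eq_mul, mul_one]
    conv_lhs => rw [h1]
    simp only [map_sum, map_smul, smul_eq_mul]
  rw [funext fun x => h (Φ x)]
  exact RatOn.sum _ fun i _ => RatOn.sum _ fun a _ => RatOn.sum _ fun b _ =>
    (hΦ i a b).mul (RatOn.const _)

theorem ratMat_chart (A : RectFam t n) (i : Fin t) :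
    RatMat (chartDom A) fun w : paramSpace A => chart A w i := by
  have l1 : RatMat (chartDom A) fun w : paramSpace A => w.1.1 i :=
    RatMat.linear (LinearMap.proj i ∘ₗ LinearMap.fst ℂ _ _ ∘ₗ (paramSpace A).subtype)
  have l2 : RatMat (chartDom A) fun w : paramSpace A => w.1.2 i :=
    RatMat.linear (LinearMap.proj i ∘ₗ LinearMap.snd ℂ _ _ ∘ₗ (paramSpace A).subtype)
  have l3 : RatMat (chartDom A) fun w : paramSpace A => shiftL t n w.1.1 i :=
    RatMat.linear (LinearMap.proj i ∘ₗ shiftL t n ∘ₗ LinearMap.fst ℂ _ _ ∘ₗ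
      (paramSpace A).subtype)
  have h1 := l1.cay fun w hw => (hw i).1
  have h2 := l2.cay fun w hw => (hw i).2
  have h3 := l3.cay fun w hw => isUnit_one_sub_shiftL (fun j => (hw j).1) i
  exact (h1.mul (RatMat.const (A i))).mul (h2.transpose.mul h3.transpose)

end Families

end

section

open Filter Topology Matrix

/-! ### Local analysis of the chart and its slices -/

section ChartAnalysis

open scoped Matrix.Norms.Operator

variable {t : ℕ} {n : ℕ → ℕ}

theorem hasStrictFDerivAt_cay_linear {m : Type*} [Fintype m] [DecidableEq m] {F : Type*}
    [NormedAddCommGroup F] [NormedSpace ℂ F] [FiniteDimensional ℂ F] (L : F →ₗ[ℂ] Matrix m m ℂ) :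
    HasStrictFDerivAt (fun x => cay (L x)) (LinearMap.toContinuousLinearMap ((2 : ℂ) • L)) 0 := by
  refine (hasStrictFDerivAt_cay (LinearMap.toContinuousLinearMap L)).congr_fderiv ?_
  exact ContinuousLinearMap.ext fun x => rfl

theorem hasStrictFDerivAt_cay_transpose {m : Type*} [Fintype m] [DecidableEq m] {F : Type*}
    [NormedAddCommGroup F] [NormedSpace ℂ F] [FiniteDimensional ℂ F] (L : F →ₗ[ℂ] Matrix m m ℂ) :
    HasStrictFDerivAt (fun x => (cay (L x))ᵀ) (LinearMap.toContinuousLinearMap ((2 : ℂ) •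
      ((Matrix.transposeLinearEquiv m m ℂ ℂ).toLinearMap ∘ₗ L))) 0 := by
  have h := (LinearMap.toContinuousLinearMap
    (Matrix.transposeLinearEquiv m m ℂ ℂ).toLinearMap).hasStrictFDerivAt.comp (0 : F)
    (hasStrictFDerivAt_cay_linear L)
  refine h.congr_fderiv ?_
  exact ContinuousLinearMap.ext fun x => rfl

theorem hasStrictFDerivAt_chart (A : RectFam t n) :
    HasStrictFDerivAt (fun w : paramSpace A => chart A w)
      (LinearMap.toContinuousLinearMap (chartDeriv A ∘ₗ (paramSpace A).subtype)) 0 := by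
  refine hasStrictFDerivAt_pi'.mpr fun i => ?_
  let Lk : paramSpace A →ₗ[ℂ] _ := LinearMap.proj i ∘ₗ LinearMap.fst ℂ (SqTgt t n) (SqSrc t n) ∘ₗ
    (paramSpace A).subtype
  let Lσ : paramSpace A →ₗ[ℂ] _ := LinearMap.proj i ∘ₗ LinearMap.snd ℂ (SqTgt t n) (SqSrc t n) ∘ₗ
    (paramSpace A).subtype
  let Ls : paramSpace A →ₗ[ℂ] _ := LinearMap.proj i ∘ₗ shiftL t n ∘ₗ
    LinearMap.fst ℂ (SqTgt t n) (SqSrc t n) ∘ₗ (paramSpace A).subtype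
  have h1 := hasStrictFDerivAt_cay_linear Lk
  have h2 := hasStrictFDerivAt_cay_transpose Lσ
  have h3 := hasStrictFDerivAt_cay_transpose Ls
  have h4 := hasStrictFDerivAt_mul_of_eq (c := 1) (d := 1) h2 h3 (by simp) (by simp)
  let B : Matrix (Fin (n (i + 1))) (Fin (n (i + 1))) ℂ →ₗ[ℂ] Matrix (Fin (n i)) (Fin (n i)) ℂ →ₗ[ℂ]
      Matrix (Fin (n (i + 1))) (Fin (n i)) ℂ :=
    LinearMap.mk₂ ℂ (fun X Y => X * A i * Y)
      (fun _ _ _ => by simp [Matrix.add_mul]) (fun _ _ _ => by simp)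
      (fun _ _ _ => by simp [Matrix.mul_add]) (fun _ _ _ => by simp)
  have h5 := (LinearMap.toContinuousBilinearMap B).hasStrictFDerivAt_of_bilinear h1 h4
  refine h5.congr_fderiv (ContinuousLinearMap.ext fun w => ?_)
  change cay (Lk 0) * A i * ((1 : ℂ) • ((2 : ℂ) • (w.1.2 i)ᵀ)
      + (1 : ℂ) • ((2 : ℂ) • (shiftL t n w.1.1 i)ᵀ))
    + (2 : ℂ) • (w.1.1 i) * A i * ((cay (Lσ 0))ᵀ * (cay (Ls 0))ᵀ)
    = (2 : ℂ) • (w.1.1 i * A i + A i * ((w.1.2 i)ᵀ + (shiftL t n w.1.1 i)ᵀ))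
  simp [Matrix.mul_add, add_comm]

theorem chartDom_mem_nhds (A : RectFam t n) : chartDom A ∈ 𝓝 (0 : paramSpace A) := by
  simp only [chartDom]
  refine eventually_all.mpr fun i => Filter.Eventually.and ?_ ?_
  · refine eventually_isUnit_det (f := fun w : paramSpace A => 1 - w.1.1 i) ?_ (by simp)
    fun_prop
  · refine eventually_isUnit_det (f := fun w : paramSpace A => 1 - w.1.2 i) ?_ (by simp)
    fun_prop

theorem moved_orthogonal_aux {m : Type*} [Fintype m] [DecidableEq m] {a b : Matrix m m ℂ}
    (ha : aᵀ * a = 1) (hb : bᵀ * b = 1) : (a * b)ᵀ * (a * b) = 1 := by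
  rw [Matrix.transpose_mul, Matrix.mul_assoc, ← Matrix.mul_assoc aᵀ, ha, Matrix.one_mul, hb]

theorem hasStrictFDerivAt_matrix_pi {F : Type*} [NormedAddCommGroup F] [NormedSpace ℂ F]
    [FiniteDimensional ℂ F] {a b : Fin t → ℕ} {f : F → ∀ i, Matrix (Fin (a i)) (Fin (b i)) ℂ}
    (L : F →ₗ[ℂ] ∀ i, Matrix (Fin (a i)) (Fin (b i)) ℂ)
    (h : ∀ i, HasStrictFDerivAt (fun x => f x i)
      (LinearMap.toContinuousLinearMap (LinearMap.proj i ∘ₗ L)) 0) :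
    HasStrictFDerivAt f (LinearMap.toContinuousLinearMap L) 0 :=
  hasStrictFDerivAt_pi'.mpr fun i => (h i).congr_fderiv (ContinuousLinearMap.ext fun _ => rfl)

/-- Right translation of the parameters at the targets by the stabilizer. -/
noncomputable def moveTgt (k v : SqTgt t n) : SqTgt t n := fun i => cayInv (cay (k i) * cay (v i))

/-- Right translation of the parameters at the sources by the stabilizer. -/
noncomputable def moveSrc (σ u : SqSrc t n) (v : SqTgt t n) : SqSrc t n := fun i =>
  cayInv ((cay (shiftL t n v i))ᵀ * (cay (σ i) * cay (u i)))

theorem hasStrictFDerivAt_moveTgt {F : Type*} [NormedAddCommGroup F] [NormedSpace ℂ F]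
    [FiniteDimensional ℂ F] (Lk Lv : F →ₗ[ℂ] SqTgt t n) :
    HasStrictFDerivAt (fun x => moveTgt (Lk x) (Lv x))
      (LinearMap.toContinuousLinearMap (Lk + Lv)) 0 := by
  refine hasStrictFDerivAt_matrix_pi (Lk + Lv) fun i => ?_
  have h1 := hasStrictFDerivAt_cay_linear (LinearMap.proj i ∘ₗ Lk)
  have h2 := hasStrictFDerivAt_cay_linear (LinearMap.proj i ∘ₗ Lv)
  have h3 := hasStrictFDerivAt_mul_of_eq (c := 1) (d := 1) h1 h2 (by simp) (by simp)
  have h4 := hasStrictFDerivAt_cayInv h3 (by simp)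
  refine h4.congr_fderiv (ContinuousLinearMap.ext fun w => ?_)
  change (2⁻¹ : ℂ) • ((1 : ℂ) • ((2 : ℂ) • (Lk w i)) + (1 : ℂ) • ((2 : ℂ) • (Lv w i)))
    = Lk w i + Lv w i
  module

theorem hasStrictFDerivAt_moveSrc {F : Type*} [NormedAddCommGroup F] [NormedSpace ℂ F]
    [FiniteDimensional ℂ F] (Lσ Lu : F →ₗ[ℂ] SqSrc t n) (Lv : F →ₗ[ℂ] SqTgt t n)
    (hv : ∀ x i, (Lv x i)ᵀ = -Lv x i) :
    HasStrictFDerivAt (fun x => moveSrc (Lσ x) (Lu x) (Lv x))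
      (LinearMap.toContinuousLinearMap (Lσ + Lu - shiftL t n ∘ₗ Lv)) 0 := by
  refine hasStrictFDerivAt_matrix_pi (Lσ + Lu - shiftL t n ∘ₗ Lv) fun i => ?_
  have h0 := hasStrictFDerivAt_cay_transpose (LinearMap.proj i ∘ₗ shiftL t n ∘ₗ Lv)
  have h1 := hasStrictFDerivAt_cay_linear (LinearMap.proj i ∘ₗ Lσ)
  have h2 := hasStrictFDerivAt_cay_linear (LinearMap.proj i ∘ₗ Lu)
  have h3 := hasStrictFDerivAt_mul_of_eq (c := 1) (d := 1) h1 h2 (by simp) (by simp)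
  have h4 := hasStrictFDerivAt_mul_of_eq (c := 1) (d := 1) h0 h3 (by simp) (by simp)
  have h5 := hasStrictFDerivAt_cayInv h4 (by simp)
  refine h5.congr_fderiv (ContinuousLinearMap.ext fun w => ?_)
  change (2⁻¹ : ℂ) • ((1 : ℂ) • ((2 : ℂ) • (shift 0 (Lv w) i)ᵀ)
      + (1 : ℂ) • ((1 : ℂ) • ((2 : ℂ) • (Lσ w i)) + (1 : ℂ) • ((2 : ℂ) • (Lu w i))))
    = Lσ w i + Lu w i - shift 0 (Lv w) i
  rw [shift_zero_transpose (hv w) i]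
  module

theorem eventually_isUnit_move {F : Type*} [NormedAddCommGroup F] [NormedSpace ℂ F]
    [FiniteDimensional ℂ F] (Lσ Lu : F →ₗ[ℂ] SqSrc t n) (Lk Lv : F →ₗ[ℂ] SqTgt t n) :
    ∀ᶠ x in 𝓝 (0 : F), ∀ i, IsUnit (1 - Lu x i).det ∧ IsUnit (1 - Lv x i).det ∧
      IsUnit (cay (Lk x i) * cay (Lv x i) + 1).det ∧
      IsUnit ((cay (shiftL t n (Lv x) i))ᵀ * (cay (Lσ x i) * cay (Lu x i)) + 1).det := by
  refine eventually_all.mpr fun i => ?_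
  have hk := (hasStrictFDerivAt_cay_linear (LinearMap.proj i ∘ₗ Lk)).continuousAt
  have hv := (hasStrictFDerivAt_cay_linear (LinearMap.proj i ∘ₗ Lv)).continuousAt
  have hσ := (hasStrictFDerivAt_cay_linear (LinearMap.proj i ∘ₗ Lσ)).continuousAt
  have hu := (hasStrictFDerivAt_cay_linear (LinearMap.proj i ∘ₗ Lu)).continuousAt
  have hs := (hasStrictFDerivAt_cay_transpose
    (LinearMap.proj i ∘ₗ shiftL t n ∘ₗ Lv)).continuousAt
  refine .and ?_ (.and ?_ (.and ?_ ?_))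
  · refine eventually_isUnit_det (f := fun x => 1 - Lu x i) ?_ (by simp)
    exact (continuous_const.sub ((LinearMap.toContinuousLinearMap
      (LinearMap.proj i ∘ₗ Lu)).continuous)).continuousAt
  · refine eventually_isUnit_det (f := fun x => 1 - Lv x i) ?_ (by simp)
    exact (continuous_const.sub ((LinearMap.toContinuousLinearMap
      (LinearMap.proj i ∘ₗ Lv)).continuous)).continuousAt
  · refine eventually_isUnit_det (f := fun x => cay (Lk x i) * cay (Lv x i) + 1)
      ((hk.mul hv).add continuousAt_const) ?_
    simp [← two_smul ℂ (1 : Matrix _ _ ℂ)]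
  · refine eventually_isUnit_det (f := fun x => (cay (shiftL t n (Lv x) i))ᵀ *
      (cay (Lσ x i) * cay (Lu x i)) + 1) ((hs.mul (hσ.mul hu)).add continuousAt_const) ?_
    simp [← two_smul ℂ (1 : Matrix _ _ ℂ)]

/-- The orthogonal matrices of the parameters are multiplied on the right by those of a stabilizer
(u, v), with the shift of v compensated at the sources. In the chart the extra factors cancel
because cay(v) A = A cay(u) and cay(u) is orthogonal. -/
theorem move_mem_paramSpace {A : RectFam t n} (hA : IsLinked A) {w : paramSpace A}
    (hw : w ∈ chartDom A) {x : SqSrc t n × SqTgt t n} (hx : x ∈ stabSpace A)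
    (hu : ∀ i, IsUnit (1 - x.1 i).det ∧ IsUnit (1 - x.2 i).det ∧
      IsUnit (cay (w.1.1 i) * cay (x.2 i) + 1).det ∧
      IsUnit ((cay (shiftL t n x.2 i))ᵀ * (cay (w.1.2 i) * cay (x.1 i)) + 1).det) :
    (moveTgt w.1.1 x.2, moveSrc w.1.2 x.1 x.2) ∈ paramSpace A ∧
      chart A (moveTgt w.1.1 x.2, moveSrc w.1.2 x.1 x.2) = chart A w := by
  obtain ⟨⟨k, σ⟩, hkσ⟩ := w
  obtain ⟨u, v⟩ := x
  simp only at hu ⊢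
  have hok : ∀ i, (cay (k i))ᵀ * cay (k i) = 1 := fun i =>
    cay_transpose_mul_cay (hkσ.1 i) (hw i).1
  have hoσ : ∀ i, (cay (σ i))ᵀ * cay (σ i) = 1 := fun i =>
    cay_transpose_mul_cay (hkσ.2.1 i) (hw i).2
  have hou : ∀ i, (cay (u i))ᵀ * cay (u i) = 1 := fun i =>
    cay_transpose_mul_cay (hx.1 i) (hu i).1
  have hov : ∀ i, (cay (v i))ᵀ * cay (v i) = 1 := fun i =>
    cay_transpose_mul_cay (hx.2.1 i) (hu i).2.1
  have hos : ∀ i, (cay (shiftL t n v i))ᵀ * cay (shiftL t n v i) = 1 := fun i => by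
    rw [cay_shiftL]
    exact shift_orthogonal hov i
  have hos' : ∀ i, cay (shiftL t n v i) * (cay (shiftL t n v i))ᵀ = 1 := fun i =>
    mul_eq_one_comm.mp (hos i)
  have hus : ∀ i, IsUnit (1 - shiftL t n v i).det :=
    isUnit_one_sub_shiftL fun i => (hu i).2.1
  refine ⟨⟨fun i => cayInv_transpose (moved_orthogonal_aux (hok i) (hov i)) (hu i).2.2.1,
      fun i => cayInv_transpose (moved_orthogonal_aux (by
        rw [Matrix.transpose_transpose]; exact hos' i) (moved_orthogonal_aux (hoσ i) (hou i)))
        (hu i).2.2.2, fun i => cayInv_commute ?_⟩, ?_⟩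
  · have c1 : cay (σ i) * moment A i = moment A i * cay (σ i) :=
      cay_intertwine (hkσ.2.2 i) (hw i).2 (hw i).2
    have c2 : cay (u i) * moment A i = moment A i * cay (u i) :=
      cay_intertwine (commute_moment hA hx.2.2 (stab_transpose hx) i) (hu i).1 (hu i).1
    have c3 : cay (shiftL t n v i) * moment A i = moment A i * cay (shiftL t n v i) :=
      cay_intertwine (commute_moment_shift 0 hx.2.2 (stab_transpose hx) i) (hus i) (hus i)
    have c4 : (cay (shiftL t n v i))ᵀ * moment A i
        = moment A i * (cay (shiftL t n v i))ᵀ := by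
      calc (cay (shiftL t n v i))ᵀ * moment A i
          = (cay (shiftL t n v i))ᵀ * (moment A i * cay (shiftL t n v i))
            * (cay (shiftL t n v i))ᵀ := by
            rw [Matrix.mul_assoc, Matrix.mul_assoc, hos' i, Matrix.mul_one]
        _ = _ := by rw [← c3, ← Matrix.mul_assoc, hos i, Matrix.one_mul]
    rw [Matrix.mul_assoc, Matrix.mul_assoc, c2, ← Matrix.mul_assoc (cay (σ i)), c1,
      ← Matrix.mul_assoc, ← Matrix.mul_assoc, c4]
    simp only [Matrix.mul_assoc]
  · funext i
    have e1 : ∀ i, cay (moveTgt k v i) = cay (k i) * cay (v i) := fun i =>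
      cay_cayInv (hu i).2.2.1
    have e2 : cay (moveSrc σ u v i) = (cay (shiftL t n v i))ᵀ * (cay (σ i) * cay (u i)) :=
      cay_cayInv (hu i).2.2.2
    have e3 : cay (shiftL t n (moveTgt k v) i)
        = cay (shiftL t n k i) * cay (shiftL t n v i) := by
      obtain ⟨i, hi⟩ := i
      cases i with
      | zero => simp [shiftL_apply, shift]
      | succ j => exact e1 ⟨j, Nat.lt_of_succ_lt hi⟩
    have e4 : cay (v i) * A i = A i * cay (u i) :=
      cay_intertwine (hx.2.2 i) (hu i).1 (hu i).2.1
    have e5 : cay (u i) * (cay (u i))ᵀ = 1 := mul_eq_one_comm.mp (hou i)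
    simp only [chart]
    rw [e1, e2, e3]
    simp only [Matrix.transpose_mul, Matrix.transpose_transpose]
    calc cay (k i) * cay (v i) * A i * ((cay (u i))ᵀ * (cay (σ i))ᵀ
          * cay (shiftL t n v i) * ((cay (shiftL t n v i))ᵀ
          * (cay (shiftL t n k i))ᵀ))
        = cay (k i) * (cay (v i) * A i) * ((cay (u i))ᵀ * (cay (σ i))ᵀ
          * (cay (shiftL t n v i) * (cay (shiftL t n v i))ᵀ)
          * (cay (shiftL t n k i))ᵀ) := by simp only [Matrix.mul_assoc]
      _ = cay (k i) * A i * ((cay (u i) * (cay (u i))ᵀ) * (cay (σ i))ᵀ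
          * (cay (shiftL t n k i))ᵀ) := by
          rw [e4, hos' i, Matrix.mul_one]; simp only [Matrix.mul_assoc]
      _ = _ := by rw [e5, Matrix.one_mul]

/-- Near the origin, the values of `chart` are attained on a complement of the stabilizer
directions. -/
theorem eventually_chart_mem_slice {A : RectFam t n} (hA : IsLinked A)
    (M : Submodule ℂ (paramSpace A)) (hM : IsCompl M (LinearMap.range (stabIncl hA))) :
    ∀ᶠ w : paramSpace A in 𝓝 0, ∃ x ∈ M, x ∈ chartDom A ∧ chart A w = chart A x := by
  let Lk : M × stabSpace A →ₗ[ℂ] SqTgt t n := LinearMap.fst ℂ (SqTgt t n) (SqSrc t n) ∘ₗ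
    (paramSpace A).subtype ∘ₗ M.subtype ∘ₗ LinearMap.fst ℂ _ _
  let Lσ : M × stabSpace A →ₗ[ℂ] SqSrc t n := LinearMap.snd ℂ (SqTgt t n) (SqSrc t n) ∘ₗ
    (paramSpace A).subtype ∘ₗ M.subtype ∘ₗ LinearMap.fst ℂ _ _
  let Lu : M × stabSpace A →ₗ[ℂ] SqSrc t n := LinearMap.fst ℂ (SqSrc t n) (SqTgt t n) ∘ₗ
    (stabSpace A).subtype ∘ₗ LinearMap.snd ℂ _ _
  let Lv : M × stabSpace A →ₗ[ℂ] SqTgt t n := LinearMap.snd ℂ (SqSrc t n) (SqTgt t n) ∘ₗ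
    (stabSpace A).subtype ∘ₗ LinearMap.snd ℂ _ _
  have hd1 := hasStrictFDerivAt_moveTgt (F := M × stabSpace A) Lk Lv
  have hd2 := hasStrictFDerivAt_moveSrc (F := M × stabSpace A) Lσ Lu Lv fun x i => x.2.2.2.1 i
  -- A linear retraction onto the parameter space: the moved pair is known to lie there only when
  -- the relevant matrices are invertible, whereas the derivative needs a map defined everywhere.
  obtain ⟨π, hπ⟩ := (paramSpace A).subtype.exists_leftInverse_of_injective
    (paramSpace A).ker_subtype
  have hd := (LinearMap.toContinuousLinearMap π).hasStrictFDerivAt.comp (0 : M × stabSpace A)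
    (hd1.prodMk hd2)
  have hsurj : Function.Surjective
      (π ∘ₗ (Lk + Lv).prod (Lσ + Lu - shiftL t n ∘ₗ Lv)) := by
    intro y
    have hy : y ∈ M ⊔ LinearMap.range (stabIncl hA) := by rw [hM.sup_eq_top]; trivial
    obtain ⟨a, ha, b, ⟨c, rfl⟩, rfl⟩ := Submodule.mem_sup.mp hy
    refine ⟨(⟨a, ha⟩, c), ?_⟩
    have h1 : ((a + stabIncl hA c : paramSpace A) : SqTgt t n × SqSrc t n)
        = (a.1.1 + c.1.2, a.1.2 + c.1.1 - shiftL t n c.1.2) := by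
      refine Prod.ext rfl ?_
      change a.1.2 + (c.1.1 - shiftL t n c.1.2) = a.1.2 + c.1.1 - shiftL t n c.1.2
      abel
    have h2 := LinearMap.congr_fun hπ (a + stabIncl hA c)
    rw [LinearMap.comp_apply, Submodule.subtype_apply, h1] at h2
    exact h2
  -- The derivative at 0 of (slice point, stabilizer) ↦ moved point is the sum map, surjective
  -- because M is a complement. So the moved points fill a neighbourhood of 0, and moving does not
  -- change the chart value.
  have hnhds := hd.map_nhds_eq_of_surj (LinearMap.range_eq_top.mpr hsurj)
  have hzero : π (moveTgt (Lk 0) (Lv 0), moveSrc (Lσ 0) (Lu 0) (Lv 0)) = 0 := by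
    have h1 : moveTgt (Lk 0) (Lv 0) = 0 := by funext i; simp [moveTgt, cayInv]
    have h2 : moveSrc (Lσ 0) (Lu 0) (Lv 0) = 0 := by funext i; simp [moveSrc, cayInv]
    rw [h1, h2]
    exact map_zero π
  have hnhds' : map (fun x => π (moveTgt (Lk x) (Lv x), moveSrc (Lσ x) (Lu x) (Lv x)))
      (𝓝 (0 : M × stabSpace A)) = 𝓝 (0 : paramSpace A) := by
    rw [← hzero]
    exact hnhds
  rw [← hnhds', eventually_map]
  have hMdom : ∀ᶠ x in 𝓝 (0 : M × stabSpace A), (x.1 : paramSpace A) ∈ chartDom A := by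
    have hcont : Continuous fun x : M × stabSpace A => (x.1 : paramSpace A) := by fun_prop
    have := hcont.tendsto 0
    exact this.eventually (chartDom_mem_nhds A)
  filter_upwards [hMdom, eventually_isUnit_move (F := M × stabSpace A) Lσ Lu Lk Lv] with x hxD hxu
  obtain ⟨hmem, heq⟩ := move_mem_paramSpace hA hxD x.2.2 hxu
  refine ⟨x.1, x.1.2, hxD, ?_⟩
  have hpi : ((π (moveTgt (Lk x) (Lv x), moveSrc (Lσ x) (Lu x) (Lv x)) : paramSpace A) :
      SqTgt t n × SqSrc t n) = (moveTgt (Lk x) (Lv x), moveSrc (Lσ x) (Lu x) (Lv x)) :=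
    congrArg Subtype.val (LinearMap.congr_fun hπ ⟨_, hmem⟩)
  rw [hpi]
  exact heq

end ChartAnalysis

end

section

open Filter Topology Matrix

/-! ### Pairs of maps with the same `ab`-diagram -/

section ABDiagrams

variable {V U V' U' : Type*} [AddCommGroup V] [Module ℂ V] [AddCommGroup U] [Module ℂ U]
  [AddCommGroup V'] [Module ℂ V'] [AddCommGroup U'] [Module ℂ U']

theorem HasABDiagram.of_equiv {A : V →ₗ[ℂ] U} {B : U →ₗ[ℂ] V} {A' : V' →ₗ[ℂ] U'}
    {B' : U' →ₗ[ℂ] V'} {δ : ABDiagram} (h : HasABDiagram A B δ) (eV : V ≃ₗ[ℂ] V')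
    (eU : U ≃ₗ[ℂ] U') (hA : ∀ x, A' (eV x) = eU (A x)) (hB : ∀ y, B' (eU y) = eV (B y)) :
    HasABDiagram A' B' δ := by
  obtain ⟨k, row, e, hrow, ha, hb, hstep⟩ := h
  refine ⟨k, row, e.map (eV.prodCongr eU), hrow, fun i j hj => ?_, fun i j hj => ?_,
    fun i j => ?_⟩
  · simp [ha i j hj]
  · simp [hb i j hj]
  · have h := hstep i j
    simp only [Module.Basis.map_apply, LinearEquiv.prodCongr_apply, hA, hB]
    split_ifs with hlt
    · rw [dif_pos hlt] at h
      rw [← h]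
    · rw [dif_neg hlt] at h
      simp only [Prod.mk_eq_zero] at h
      simp [h.1, h.2]

theorem exists_equiv_of_map_univ_eq {α : Type*} {k k' : ℕ} {row : Fin k → α} {row' : Fin k' → α}
    (h : Multiset.map row Finset.univ.val = Multiset.map row' Finset.univ.val) :
    ∃ σ : Fin k ≃ Fin k', ∀ i, row' (σ i) = row i := by
  classical
  have hcard : ∀ c, Nonempty ({i // row i = c} ≃ {i // row' i = c}) := by
    intro c
    refine Fintype.card_eq.mp ?_
    have := congrArg (Multiset.count c) h
    rw [Multiset.count_map, Multiset.count_map] at this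
    rw [Fintype.card_subtype, Fintype.card_subtype]
    simpa only [Finset.card_def, Finset.filter_val, eq_comm] using this
  let e := fun c => (hcard c).some
  refine ⟨(Equiv.sigmaFiberEquiv row).symm.trans
    ((Equiv.sigmaCongrRight e).trans (Equiv.sigmaFiberEquiv row')), fun i => ?_⟩
  exact (e (row i) ⟨i, rfl⟩).2

/-- Matching equal strings gives an isomorphism of V × U with V' × U'. It respects letters, hence
the projections to V and V', so it splits into two isomorphisms; it respects steps along strings,
hence intertwines A with A' and B with B'. -/
theorem HasABDiagram.exists_equiv {A : V →ₗ[ℂ] U} {B : U →ₗ[ℂ] V} {A' : V' →ₗ[ℂ] U'}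
    {B' : U' →ₗ[ℂ] V'} {δ : ABDiagram} (h : HasABDiagram A B δ) (h' : HasABDiagram A' B' δ) :
    ∃ (eV : V ≃ₗ[ℂ] V') (eU : U ≃ₗ[ℂ] U'),
      (∀ x, A' (eV x) = eU (A x)) ∧ ∀ y, B' (eU y) = eV (B y) := by
  obtain ⟨k, row, e, hrow, ha, hb, hstep⟩ := h
  obtain ⟨k', row', e', hrow', ha', hb', hstep'⟩ := h'
  obtain ⟨σ, hσ⟩ := exists_equiv_of_map_univ_eq (hrow.trans hrow'.symm)
  have hlen : ∀ i, (row i).len = (row' (σ i)).len := fun i => by rw [hσ]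
  let idx : (Σ i, Fin (row i).len) ≃ Σ i, Fin (row' i).len :=
    Equiv.sigmaCongr σ fun i => finCongr (hlen i)
  let E : (V × U) ≃ₗ[ℂ] V' × U' := e.equiv e' idx
  have hE : ∀ κ, E (e κ) = e' (idx κ) := fun κ => e.equiv_apply κ e' idx
  have hlet : ∀ i (j : Fin (row i).len), (row' (σ i)).letter j = (row i).letter j := fun i j => by
    rw [hσ]
  have hcases : ∀ l : Letter, l = Letter.a ∨ l = Letter.b := by rintro (_ | _) <;> simp
  let P : V × U →ₗ[ℂ] V × U := (LinearMap.inl ℂ V U) ∘ₗ (LinearMap.fst ℂ V U)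
  let P' : V' × U' →ₗ[ℂ] V' × U' := (LinearMap.inl ℂ V' U') ∘ₗ (LinearMap.fst ℂ V' U')
  have hP : E.toLinearMap ∘ₗ P = P' ∘ₗ E.toLinearMap := by
    refine e.ext fun κ => ?_
    obtain ⟨i, j⟩ := κ
    have h1 : E (e ⟨i, j⟩) = e' ⟨σ i, finCongr (hlen i) j⟩ := hE _
    rcases hcases ((row i).letter j) with hl | hl
    · have h2 : P (e ⟨i, j⟩) = e ⟨i, j⟩ := Prod.ext rfl (ha i j hl).symm
      have h3 : P' (e' ⟨σ i, finCongr (hlen i) j⟩) = e' ⟨σ i, finCongr (hlen i) j⟩ :=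
        Prod.ext rfl (ha' (σ i) (finCongr (hlen i) j) ((hlet i j).trans hl)).symm
      simp only [LinearMap.comp_apply, LinearEquiv.coe_coe]
      rw [h2, h1, h3]
    · have h2 : P (e ⟨i, j⟩) = 0 := Prod.ext (hb i j hl) rfl
      have h3 : P' (e' ⟨σ i, finCongr (hlen i) j⟩) = 0 :=
        Prod.ext (hb' (σ i) (finCongr (hlen i) j) ((hlet i j).trans hl)) rfl
      simp only [LinearMap.comp_apply, LinearEquiv.coe_coe]
      rw [h2, h1, h3, map_zero]
  let T : V × U →ₗ[ℂ] V × U := (B ∘ₗ LinearMap.snd ℂ V U).prod (A ∘ₗ LinearMap.fst ℂ V U)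
  let T' : V' × U' →ₗ[ℂ] V' × U' := (B' ∘ₗ LinearMap.snd ℂ V' U').prod (A' ∘ₗ LinearMap.fst ℂ V' U')
  have hT : E.toLinearMap ∘ₗ T = T' ∘ₗ E.toLinearMap := by
    refine e.ext fun κ => ?_
    obtain ⟨i, j⟩ := κ
    have h1 : E (e ⟨i, j⟩) = e' ⟨σ i, finCongr (hlen i) j⟩ := hE _
    have h2 : T (e ⟨i, j⟩) = _ := hstep i j
    have h3 : T' (e' ⟨σ i, finCongr (hlen i) j⟩) = _ := hstep' (σ i) (finCongr (hlen i) j)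
    simp only [LinearMap.comp_apply, LinearEquiv.coe_coe]
    rw [h2, h1, h3]
    by_cases hlt : (j : ℕ) + 1 < (row i).len
    · have hlt' : ((finCongr (hlen i) j : Fin _) : ℕ) + 1 < (row' (σ i)).len := by
        simpa [← hlen] using hlt
      rw [dif_pos hlt, dif_pos hlt', hE]
      rfl
    · have hlt' : ¬ ((finCongr (hlen i) j : Fin _) : ℕ) + 1 < (row' (σ i)).len := by
        simpa [← hlen] using hlt
      rw [dif_neg hlt, dif_neg hlt', map_zero]
  have hPx : ∀ x, E (P x) = P' (E x) := fun x => LinearMap.congr_fun hP x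
  have hTx : ∀ x, E (T x) = T' (E x) := fun x => LinearMap.congr_fun hT x
  have hPs : ∀ x, E.symm (P' x) = P (E.symm x) := fun x => by
    rw [LinearEquiv.symm_apply_eq, hPx, LinearEquiv.apply_symm_apply]
  have hV : ∀ v, E (v, 0) = ((E (v, 0)).1, 0) := fun v => hPx (v, 0)
  have hV' : ∀ v, E.symm (v, 0) = ((E.symm (v, 0)).1, 0) := fun v => hPs (v, 0)
  have hU : ∀ u, E (0, u) = (0, (E (0, u)).2) := fun u => by
    have : (0 : V' × U') = P' (E (0, u)) := by rw [← hPx]; exact (map_zero E).symm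
    exact Prod.ext (congrArg Prod.fst this).symm rfl
  have hU' : ∀ u, E.symm (0, u) = (0, (E.symm (0, u)).2) := fun u => by
    have : (0 : V × U) = P (E.symm (0, u)) := by rw [← hPs]; exact (map_zero E.symm).symm
    exact Prod.ext (congrArg Prod.fst this).symm rfl
  let eV : V ≃ₗ[ℂ] V' := LinearEquiv.ofLinearMap
    (LinearMap.fst ℂ V' U' ∘ₗ E.toLinearMap ∘ₗ LinearMap.inl ℂ V U)
    (LinearMap.fst ℂ V U ∘ₗ E.symm.toLinearMap ∘ₗ LinearMap.inl ℂ V' U')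
    (by
      ext v
      simp only [LinearMap.comp_apply, LinearEquiv.coe_coe, LinearMap.inl_apply,
        LinearMap.fst_apply, LinearMap.id_apply]
      rw [← hV', LinearEquiv.apply_symm_apply])
    (by
      ext v
      simp only [LinearMap.comp_apply, LinearEquiv.coe_coe, LinearMap.inl_apply,
        LinearMap.fst_apply, LinearMap.id_apply]
      rw [← hV, LinearEquiv.symm_apply_apply])
  let eU : U ≃ₗ[ℂ] U' := LinearEquiv.ofLinearMap
    (LinearMap.snd ℂ V' U' ∘ₗ E.toLinearMap ∘ₗ LinearMap.inr ℂ V U)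
    (LinearMap.snd ℂ V U ∘ₗ E.symm.toLinearMap ∘ₗ LinearMap.inr ℂ V' U')
    (by
      ext v
      simp only [LinearMap.comp_apply, LinearEquiv.coe_coe, LinearMap.inr_apply,
        LinearMap.snd_apply, LinearMap.id_apply]
      rw [← hU', LinearEquiv.apply_symm_apply])
    (by
      ext v
      simp only [LinearMap.comp_apply, LinearEquiv.coe_coe, LinearMap.inr_apply,
        LinearMap.snd_apply, LinearMap.id_apply]
      rw [← hU, LinearEquiv.symm_apply_apply])
  refine ⟨eV, eU, fun x => ?_, fun y => ?_⟩
  · have h := congrArg Prod.snd (hTx (x, 0))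
    have h1 : T (x, 0) = (0, A x) := by simp [T]
    rw [h1] at h
    exact h.symm
  · have h := congrArg Prod.fst (hTx (0, y))
    have h1 : T (0, y) = (B y, 0) := by simp [T]
    rw [h1] at h
    exact h.symm

end ABDiagrams

/-! ### Strata in matrix form -/

section MatStratum

variable {t : ℕ} {n : ℕ → ℕ}

/-- The stratum attached to `τ`, for the standard symmetric forms. -/
def matStratum (n : ℕ → ℕ) (τ : Fin t → ABDiagram) : Set (RectFam t n) :=
  {A | IsLinked A ∧ ∀ i, HasABDiagram (Matrix.toLin' (A i)) (Matrix.toLin' (A i)ᵀ) (τ i)}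

theorem exists_orthogonal_of_hasABDiagram {p q : ℕ} {A A' : Matrix (Fin p) (Fin q) ℂ}
    {δ : ABDiagram} (h : HasABDiagram (Matrix.toLin' A) (Matrix.toLin' Aᵀ) δ)
    (h' : HasABDiagram (Matrix.toLin' A') (Matrix.toLin' A'ᵀ) δ) :
    ∃ (a : Matrix (Fin q) (Fin q) ℂ) (b : Matrix (Fin p) (Fin p) ℂ),
      aᵀ * a = 1 ∧ bᵀ * b = 1 ∧ b * A = A' * a := by
  obtain ⟨eV, eU, h1, h2⟩ := h.exists_equiv h'
  have hunit : ∀ {r : ℕ} (e : (Fin r → ℂ) ≃ₗ[ℂ] (Fin r → ℂ)),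
      IsUnit (LinearMap.toMatrix' e.toLinearMap) := by
    intro r e
    refine IsUnit.of_mul_eq_one (LinearMap.toMatrix' e.symm.toLinearMap) ?_
    rw [← LinearMap.toMatrix'_comp, LinearEquiv.comp_symm, LinearMap.toMatrix'_id]
  refine exists_orthogonal_equivalence (P := LinearMap.toMatrix' eV.toLinearMap)
    (Q := LinearMap.toMatrix' eU.toLinearMap) (hunit eV) (hunit eU) ?_ ?_
  · apply Matrix.toLin'.injective
    rw [Matrix.toLin'_mul, Matrix.toLin'_mul, Matrix.toLin'_toMatrix', Matrix.toLin'_toMatrix']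
    exact LinearMap.ext fun x => (h1 x).symm
  · apply Matrix.toLin'.injective
    rw [Matrix.toLin'_mul, Matrix.toLin'_mul, Matrix.toLin'_toMatrix', Matrix.toLin'_toMatrix']
    exact LinearMap.ext fun x => (h2 x).symm

/-- The action of orthogonal families on representations. -/
def act (g : SqTgt t n) (s : SqSrc t n) (A : RectFam t n) : RectFam t n := fun i =>
  g i * A i * ((s i)ᵀ * (shift 1 g i)ᵀ)

theorem act_mul_transpose {g : SqTgt t n} {s : SqSrc t n} {A : RectFam t n}
    (hg : ∀ i, (g i)ᵀ * g i = 1) (hs : ∀ i, (s i)ᵀ * s i = 1) (i : Fin t) :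
    act g s A i * (act g s A i)ᵀ = g i * (A i * (A i)ᵀ) * (g i)ᵀ := by
  have h1 := shift_orthogonal hg i
  simp only [act, Matrix.transpose_mul, Matrix.transpose_transpose]
  calc g i * A i * ((s i)ᵀ * (shift 1 g i)ᵀ) * (shift 1 g i * s i * ((A i)ᵀ * (g i)ᵀ))
      = g i * A i * ((s i)ᵀ * ((shift 1 g i)ᵀ * shift 1 g i) * s i) * ((A i)ᵀ * (g i)ᵀ) := by
        simp only [Matrix.mul_assoc]
    _ = g i * (A i * (A i)ᵀ) * (g i)ᵀ := by
        rw [h1, Matrix.mul_one, hs i]; simp only [Matrix.mul_one, Matrix.mul_assoc]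

theorem act_transpose_mul {g : SqTgt t n} {s : SqSrc t n} {A : RectFam t n}
    (hg : ∀ i, (g i)ᵀ * g i = 1) (i : Fin t) :
    (act g s A i)ᵀ * act g s A i
      = shift 1 g i * (s i * ((A i)ᵀ * A i) * (s i)ᵀ) * (shift 1 g i)ᵀ := by
  simp only [act, Matrix.transpose_mul, Matrix.transpose_transpose]
  calc shift 1 g i * s i * ((A i)ᵀ * (g i)ᵀ) * (g i * A i * ((s i)ᵀ * (shift 1 g i)ᵀ))
      = shift 1 g i * s i * ((A i)ᵀ * ((g i)ᵀ * g i) * A i) * ((s i)ᵀ * (shift 1 g i)ᵀ) := by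
        simp only [Matrix.mul_assoc]
    _ = _ := by rw [hg i]; simp only [Matrix.mul_one, Matrix.mul_assoc]

/-- The linear automorphism of `ℂ^r` given by an orthogonal matrix. -/
noncomputable def orthoEquiv {r : ℕ} (g : Matrix (Fin r) (Fin r) ℂ) (hg : gᵀ * g = 1) :
    (Fin r → ℂ) ≃ₗ[ℂ] (Fin r → ℂ) :=
  LinearEquiv.ofLinearMap (Matrix.toLin' g) (Matrix.toLin' gᵀ)
    (by rw [← Matrix.toLin'_mul, mul_eq_one_comm.mp hg, Matrix.toLin'_one])
    (by rw [← Matrix.toLin'_mul, hg, Matrix.toLin'_one])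

theorem act_mem_matStratum {τ : Fin t → ABDiagram} {g : SqTgt t n} {s : SqSrc t n}
    {A : RectFam t n} (hA : A ∈ matStratum n τ) (hg : ∀ i, (g i)ᵀ * g i = 1)
    (hs : ∀ i, (s i)ᵀ * s i = 1) (hc : ∀ i, s i * moment A i = moment A i * s i) :
    act g s A ∈ matStratum n τ := by
  have hs' : ∀ i, s i * (s i)ᵀ = 1 := fun i => mul_eq_one_comm.mp (hs i)
  refine ⟨fun i hi => ?_, fun i => ?_⟩
  · rw [act_mul_transpose hg hs, act_transpose_mul hg, ← hA.1 i hi]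
    have h := hc ⟨i + 1, hi⟩
    simp only [moment, shift] at h
    have h' := (congrArg (· * (s ⟨i + 1, hi⟩)ᵀ) h).trans ((Matrix.mul_assoc _ _ _).trans
      ((congrArg (_ * ·) (hs' _)).trans (Matrix.mul_one _)))
    rw [h']
    rfl
  · have h1 := shift_orthogonal hg i
    have hu : (shift 1 g i * s i)ᵀ * (shift 1 g i * s i) = 1 := moved_orthogonal_aux h1 (hs i)
    refine (hA.2 i).of_equiv (orthoEquiv _ hu) (orthoEquiv _ (hg i)) (fun x => ?_) fun y => ?_
    · have : act g s A i * (shift 1 g i * s i) = g i * A i := by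
        have h2 : (s i)ᵀ * (shift 1 g i)ᵀ * (shift 1 g i * s i) = 1 := by
          rw [← Matrix.transpose_mul]; exact hu
        rw [act, Matrix.mul_assoc, h2, Matrix.mul_one]
      change Matrix.toLin' (act g s A i) (Matrix.toLin' (shift 1 g i * s i) x)
        = Matrix.toLin' (g i) (Matrix.toLin' (A i) x)
      rw [← Matrix.toLin'_mul_apply, ← Matrix.toLin'_mul_apply, this]
    · have : (act g s A i)ᵀ * g i = (shift 1 g i * s i) * (A i)ᵀ := by
        simp only [act, Matrix.transpose_mul, Matrix.transpose_transpose]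
        simp only [Matrix.mul_assoc, hg i, Matrix.mul_one]
      change Matrix.toLin' (act g s A i)ᵀ (Matrix.toLin' (g i) y)
        = Matrix.toLin' (shift 1 g i * s i) (Matrix.toLin' (A i)ᵀ y)
      rw [← Matrix.toLin'_mul_apply, ← Matrix.toLin'_mul_apply, this]

/-- Each arrow of A is carried to that of A' by orthogonal a_i and b_i, chosen arrow by arrow. At a
common vertex a_{i+1} and b_i may differ, but by linkedness both conjugate A_i A_iᵀ to the
corresponding matrix of A', so the discrepancy b_iᵀ a_{i+1} commutes with the moment. -/
theorem exists_act_eq {τ : Fin t → ABDiagram} {A A' : RectFam t n} (hA : A ∈ matStratum n τ)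
    (hA' : A' ∈ matStratum n τ) : ∃ (g : SqTgt t n) (s : SqSrc t n),
      (∀ i, (g i)ᵀ * g i = 1) ∧ (∀ i, (s i)ᵀ * s i = 1) ∧
      (∀ i, s i * moment A i = moment A i * s i) ∧ act g s A = A' := by
  choose a b ha hb hab using fun i => exists_orthogonal_of_hasABDiagram (hA.2 i) (hA'.2 i)
  have hb1 := shift_orthogonal hb
  have hb2 : ∀ i, shift 1 b i * (shift 1 b i)ᵀ = 1 := fun i => mul_eq_one_comm.mp (hb1 i)
  have hs : ∀ i, ((shift 1 b i)ᵀ * a i)ᵀ * ((shift 1 b i)ᵀ * a i) = 1 := fun i =>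
    moved_orthogonal_aux (by rw [Matrix.transpose_transpose]; exact hb2 i) (ha i)
  refine ⟨b, fun i => (shift 1 b i)ᵀ * a i, hb, hs, fun i => ?_, ?_⟩
  · obtain ⟨i, hi⟩ := i
    cases i with
    | zero => simp [moment, shift]
    | succ j =>
      have hj : j < t := Nat.lt_of_succ_lt hi
      have h1 : ∀ i, A' i = b i * A i * (a i)ᵀ := fun i => by
        rw [hab, Matrix.mul_assoc, mul_eq_one_comm.mp (ha i), Matrix.mul_one]
      have h2 := hA'.1 j hi
      have h3 := hA.1 j hi
      rw [h1 ⟨j, hj⟩, h1 ⟨j + 1, hi⟩] at h2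
      simp only [Matrix.transpose_mul, Matrix.transpose_transpose] at h2
      have h4 : b ⟨j, hj⟩ * (A ⟨j, hj⟩ * (A ⟨j, hj⟩)ᵀ) * (b ⟨j, hj⟩)ᵀ
          = a ⟨j + 1, hi⟩ * (A ⟨j, hj⟩ * (A ⟨j, hj⟩)ᵀ) * (a ⟨j + 1, hi⟩)ᵀ := by
        calc _ = b ⟨j, hj⟩ * A ⟨j, hj⟩ * (((a ⟨j, hj⟩)ᵀ * a ⟨j, hj⟩) *
              ((A ⟨j, hj⟩)ᵀ * (b ⟨j, hj⟩)ᵀ)) := by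
              rw [ha]; simp only [Matrix.one_mul, Matrix.mul_assoc]
          _ = a ⟨j + 1, hi⟩ * ((A ⟨j + 1, hi⟩)ᵀ * (b ⟨j + 1, hi⟩)ᵀ) *
              (b ⟨j + 1, hi⟩ * A ⟨j + 1, hi⟩ * (a ⟨j + 1, hi⟩)ᵀ) := by
              rw [← h2]; simp only [Matrix.mul_assoc]
          _ = a ⟨j + 1, hi⟩ * ((A ⟨j + 1, hi⟩)ᵀ * ((b ⟨j + 1, hi⟩)ᵀ * b ⟨j + 1, hi⟩) *
              A ⟨j + 1, hi⟩) * (a ⟨j + 1, hi⟩)ᵀ := by simp only [Matrix.mul_assoc]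
          _ = _ := by rw [hb, Matrix.mul_one, ← h3]
      simp only [moment, shift]
      set x := A ⟨j, hj⟩ * (A ⟨j, hj⟩)ᵀ
      have h5 : (b ⟨j, hj⟩)ᵀ * b ⟨j, hj⟩ = 1 := hb _
      calc (b ⟨j, hj⟩)ᵀ * a ⟨j + 1, hi⟩ * x
          = (b ⟨j, hj⟩)ᵀ * (a ⟨j + 1, hi⟩ * x * ((a ⟨j + 1, hi⟩)ᵀ * a ⟨j + 1, hi⟩)) := by
            rw [ha]; simp only [Matrix.mul_one, Matrix.mul_assoc]
        _ = (b ⟨j, hj⟩)ᵀ * (a ⟨j + 1, hi⟩ * x * (a ⟨j + 1, hi⟩)ᵀ) * a ⟨j + 1, hi⟩ := by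
            simp only [Matrix.mul_assoc]
        _ = ((b ⟨j, hj⟩)ᵀ * b ⟨j, hj⟩) * x * ((b ⟨j, hj⟩)ᵀ * a ⟨j + 1, hi⟩) := by
            rw [← h4]; simp only [Matrix.mul_assoc]
        _ = x * ((b ⟨j, hj⟩)ᵀ * a ⟨j + 1, hi⟩) := by rw [h5, Matrix.one_mul]
  · funext i
    simp only [act, Matrix.transpose_mul, Matrix.transpose_transpose]
    rw [Matrix.mul_assoc (a i)ᵀ, hb2 i, Matrix.mul_one, hab, Matrix.mul_assoc,
      mul_eq_one_comm.mp (ha i), Matrix.mul_one]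

/-- A set of orthogonal matrices is covered by finitely many translates of the domain of the
inverse Cayley transform. -/
theorem exists_finite_cover {r : ℕ} (S : Set (Matrix (Fin r) (Fin r) ℂ))
    (hS : ∀ s ∈ S, sᵀ * s = 1) :
    ∃ F : Set (Matrix (Fin r) (Fin r) ℂ), F.Finite ∧ F ⊆ S ∧
      ∀ s ∈ S, ∃ f ∈ F, IsUnit (s * fᵀ + 1).det := by
  let R := MvPolynomial (Fin r × Fin r) ℂ
  let gen : Matrix (Fin r) (Fin r) R := Matrix.of fun a b => MvPolynomial.X (a, b)
  -- The failure locus of the translate by f is the zero set of one polynomial in the entries of s.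
  -- By noetherianity finitely many f in S generate the ideal of all these polynomials.
  let P : Matrix (Fin r) (Fin r) ℂ → R := fun f => (gen * fᵀ.map MvPolynomial.C + 1).det
  have hP : ∀ f s, MvPolynomial.eval (fun ab => s ab.1 ab.2) (P f) = (s * fᵀ + 1).det := by
    intro f s
    simp only [P]
    rw [RingHom.map_det]
    congr 1
    ext a b
    simp [gen, Matrix.mul_apply, Matrix.one_apply, apply_ite]
  obtain ⟨G, hG, hspan⟩ := (Submodule.fg_span_iff_fg_span_finset_subset (R := R) (P '' S)).mp
    (IsNoetherian.noetherian _)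
  obtain ⟨F, hFS, hFG⟩ := (Set.subset_image_iff).mp hG
  obtain ⟨F', hF'F, hF'fin, hF'G⟩ : ∃ F' ⊆ F, F'.Finite ∧ P '' F' = (G : Set R) := by
    obtain ⟨F', h1, h2⟩ := Set.SurjOn.exists_bijOn_subset (f := P) (s := F) (t := (G : Set R))
      (by rw [← hFG]; exact Set.surjOn_image P F)
    refine ⟨F', h1, ?_, h2.image_eq⟩
    refine Set.Finite.of_finite_image ?_ h2.injOn
    rw [h2.image_eq]; exact G.finite_toSet
  refine ⟨F', hF'fin, hF'F.trans hFS, fun s hs => ?_⟩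
  by_contra! hno
  have hker : Submodule.span R (P '' S) ≤
      (RingHom.ker (MvPolynomial.eval fun ab : Fin r × Fin r => s ab.1 ab.2) : Ideal R) := by
    rw [hspan, Submodule.span_le, ← hF'G]
    rintro _ ⟨f, hf, rfl⟩
    rw [SetLike.mem_coe, RingHom.mem_ker, hP]
    by_contra hne
    exact hno f hf (isUnit_iff_ne_zero.mpr hne)
  -- If all chosen polynomials vanished at s, so would the one for f = s; its value there is det(s
  -- sᵀ + 1) = det 2, which is not 0.
  have h1 := hker (Submodule.subset_span ⟨s, hs, rfl⟩)
  rw [RingHom.mem_ker, hP, mul_eq_one_comm.mp (hS s hs), ← two_smul ℂ (1 : Matrix _ _ ℂ),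
    Matrix.det_smul] at h1
  simp at h1

end MatStratum

end

section

open Filter Topology Matrix

/-! ### The dimension of a stratum -/

section Dimension

variable {t : ℕ} {n : ℕ → ℕ}

theorem chart_eq_act (A : RectFam t n) (w : SqTgt t n × SqSrc t n) :
    chart A w = act (fun i => cay (w.1 i)) (fun i => cay (w.2 i)) A := by
  funext i
  simp only [chart, act, cay_shiftL]

theorem cay_commute {m : ℕ} {a c : Matrix (Fin m) (Fin m) ℂ} (h : a * c = c * a)
    (ha : IsUnit (1 - a).det) : cay a * c = c * cay a := cay_intertwine h ha ha

theorem chart_mem_matStratum {τ : Fin t → ABDiagram} {A : RectFam t n} (hA : A ∈ matStratum n τ)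
    {w : paramSpace A} (hw : w ∈ chartDom A) : chart A w ∈ matStratum n τ := by
  rw [chart_eq_act]
  exact act_mem_matStratum hA (fun i => cay_transpose_mul_cay (w.2.1 i) (hw i).1)
    (fun i => cay_transpose_mul_cay (w.2.2.1 i) (hw i).2)
    fun i => cay_commute (w.2.2.2 i) (hw i).2

theorem finrank_range_chartDeriv {A : RectFam t n} (hA : IsLinked A) {s : ℕ}
    (hs : Module.finrank ℂ (paramSpace A) = Module.finrank ℂ (stabSpace A) + s) :
    Module.finrank ℂ (LinearMap.range (chartDeriv A ∘ₗ (paramSpace A).subtype)) = s := by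
  have h := LinearMap.finrank_range_add_finrank_ker (chartDeriv A ∘ₗ (paramSpace A).subtype)
  rw [ker_chartDeriv hA, LinearMap.finrank_range_of_inj (stabIncl_injective hA)] at h
  omega

-- The chart stays in the stratum near 0 and its derivative has rank s. A linear map L that
-- restricts to coordinates on the image of the derivative turns the chart into a submersion onto
-- ℂ^s.
open scoped Matrix.Norms.Operator in
theorem exists_algebraicIndependent_matStratum {τ : Fin t → ABDiagram} {A : RectFam t n}
    (hA : A ∈ matStratum n τ) {s : ℕ}
    (hs : Module.finrank ℂ (paramSpace A) = Module.finrank ℂ (stabSpace A) + s) :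
    ∃ f : Fin s → polyFunctions (matStratum n τ), AlgebraicIndependent ℂ f := by
  set T := chartDeriv A ∘ₗ (paramSpace A).subtype with hT
  have hr : Module.finrank ℂ (LinearMap.range T) = s := finrank_range_chartDeriv hA.1 hs
  let e : LinearMap.range T ≃ₗ[ℂ] (Fin s → ℂ) :=
    LinearEquiv.ofFinrankEq _ _ (by rw [hr, Module.finrank_fin_fun])
  obtain ⟨L, hL⟩ := LinearMap.exists_leftInverse_of_injective
    ((LinearMap.range T).subtype ∘ₗ e.symm.toLinearMap) (LinearMap.ker_eq_bot.mpr
      ((Submodule.injective_subtype _).comp e.symm.injective))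
  have hsurj : Function.Surjective (L ∘ₗ T) := by
    intro y
    obtain ⟨x, hx⟩ := (e.symm y).2
    refine ⟨x, ?_⟩
    have := LinearMap.congr_fun hL y
    simp only [LinearMap.comp_apply, LinearEquiv.coe_coe, Submodule.subtype_apply,
      LinearMap.id_apply] at this
    rw [LinearMap.comp_apply, hx, this]
  refine ⟨_, algebraicIndependent_of_hasStrictFDerivAt (E := paramSpace A)
    (Ψ := fun w => chart A w) (f' := LinearMap.toContinuousLinearMap (L ∘ₗ T)) ?_ L ?_ hsurj⟩
  · filter_upwards [chartDom_mem_nhds A] with w hw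
    exact chart_mem_matStratum hA hw
  · have h := (LinearMap.toContinuousLinearMap L).hasStrictFDerivAt.comp (0 : paramSpace A)
      (hasStrictFDerivAt_chart A)
    exact h.congr_fderiv (ContinuousLinearMap.ext fun x => rfl)

theorem moment_act {g : SqTgt t n} {s : SqSrc t n} {A : RectFam t n}
    (hg : ∀ i, (g i)ᵀ * g i = 1) (hs : ∀ i, (s i)ᵀ * s i = 1) (i : Fin t) :
    moment (act g s A) i = shift 1 g i * moment A i * (shift 1 g i)ᵀ := by
  obtain ⟨i, hi⟩ := i
  cases i with
  | zero => simp [moment, shift]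
  | succ j => exact act_mul_transpose hg hs _

theorem shift_one_mul (g h : SqTgt t n) (i : Fin t) :
    shift 1 (fun j => g j * h j) i = shift 1 g i * shift 1 h i := by
  obtain ⟨i, hi⟩ := i
  cases i <;> simp [shift]

theorem shift_one_transpose (g : SqTgt t n) (i : Fin t) :
    shift 1 (fun j => (g j)ᵀ) i = (shift 1 g i)ᵀ := by
  obtain ⟨i, hi⟩ := i
  cases i <;> simp [shift]

/-- A point of a stratum lies in the image of a chart centred at a nearby translate. -/
theorem exists_mem_chartDom_chart_eq {A : RectFam t n} {g γ : SqTgt t n} {s f : SqSrc t n}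
    (hg : ∀ i, (g i)ᵀ * g i = 1) (hγ : ∀ i, (γ i)ᵀ * γ i = 1)
    (hs : ∀ i, (s i)ᵀ * s i = 1) (hf : ∀ i, (f i)ᵀ * f i = 1)
    (hsc : ∀ i, s i * moment A i = moment A i * s i)
    (hfc : ∀ i, f i * moment A i = moment A i * f i)
    (hu : ∀ i, IsUnit (g i * (γ i)ᵀ + 1).det) (hv : ∀ i, IsUnit (s i * (f i)ᵀ + 1).det) :
    ∃ w ∈ chartDom (act γ f A), chart (act γ f A) w = act g s A := by
  have hG := shift_orthogonal hγ
  set G := shift 1 γ with hGdef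
  have hG' : ∀ i, G i * (G i)ᵀ = 1 := fun i => mul_eq_one_comm.mp (hG i)
  have hf' : ∀ i, f i * (f i)ᵀ = 1 := fun i => mul_eq_one_comm.mp (hf i)
  have hγ' : ∀ i, γ i * (γ i)ᵀ = 1 := fun i => mul_eq_one_comm.mp (hγ i)
  have hv' : ∀ i, IsUnit (G i * (s i * (f i)ᵀ) * (G i)ᵀ + 1).det := fun i => by
    have : G i * (s i * (f i)ᵀ) * (G i)ᵀ + 1 = G i * (s i * (f i)ᵀ + 1) * (G i)ᵀ := by
      rw [Matrix.mul_add, Matrix.mul_one, Matrix.add_mul, hG']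
    have hd : (G i)ᵀ.det * (G i).det = 1 := by rw [← Matrix.det_mul, hG, Matrix.det_one]
    rw [this, Matrix.det_mul, Matrix.det_mul]
    exact ((IsUnit.of_mul_eq_one_right _ hd).mul (hv i)).mul (IsUnit.of_mul_eq_one _ hd)
  have ho1 : ∀ i, (g i * (γ i)ᵀ)ᵀ * (g i * (γ i)ᵀ) = 1 := fun i =>
    moved_orthogonal_aux (hg i) (by rw [Matrix.transpose_transpose]; exact hγ' i)
  have ho2 : ∀ i, (G i * (s i * (f i)ᵀ) * (G i)ᵀ)ᵀ * (G i * (s i * (f i)ᵀ) * (G i)ᵀ) = 1 := fun i =>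
    moved_orthogonal_aux (moved_orthogonal_aux (hG i) (moved_orthogonal_aux (hs i)
      (by rw [Matrix.transpose_transpose]; exact hf' i)))
      (by rw [Matrix.transpose_transpose]; exact hG' i)
  have hfc' : ∀ i, (f i)ᵀ * moment A i = moment A i * (f i)ᵀ := fun i => by
    calc (f i)ᵀ * moment A i = (f i)ᵀ * (moment A i * f i) * (f i)ᵀ := by
          rw [Matrix.mul_assoc, Matrix.mul_assoc (moment A i), hf', Matrix.mul_one]
      _ = _ := by rw [← hfc, ← Matrix.mul_assoc, hf, Matrix.one_mul]
  refine ⟨⟨(fun i => cayInv (g i * (γ i)ᵀ), fun i => cayInv (G i * (s i * (f i)ᵀ) * (G i)ᵀ)),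
    fun i => cayInv_transpose (ho1 i) (hu i), fun i => cayInv_transpose (ho2 i) (hv' i),
    fun i => cayInv_commute ?_⟩, fun i => ⟨isUnit_det_one_sub_cayInv (hu i),
      isUnit_det_one_sub_cayInv (hv' i)⟩, ?_⟩
  · rw [moment_act hγ hf, ← hGdef]
    calc G i * (s i * (f i)ᵀ) * (G i)ᵀ * (G i * moment A i * (G i)ᵀ)
        = G i * (s i * (f i)ᵀ) * ((G i)ᵀ * G i) * (moment A i * (G i)ᵀ) := by
          simp only [Matrix.mul_assoc]
      _ = G i * (s i * ((f i)ᵀ * moment A i)) * (G i)ᵀ := by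
          rw [hG, Matrix.mul_one]; simp only [Matrix.mul_assoc]
      _ = G i * (s i * moment A i * (f i)ᵀ) * (G i)ᵀ := by
          rw [hfc']; simp only [Matrix.mul_assoc]
      _ = G i * moment A i * ((G i)ᵀ * G i) * (s i * (f i)ᵀ) * (G i)ᵀ := by
          rw [hsc, hG, Matrix.mul_one]; simp only [Matrix.mul_assoc]
      _ = _ := by simp only [Matrix.mul_assoc]
  · rw [chart_eq_act]
    funext i
    simp only [act, cay_cayInv (hu _), cay_cayInv (hv' _)]
    rw [shift_one_mul g fun j => (γ j)ᵀ, shift_one_transpose, ← hGdef]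
    simp only [Matrix.transpose_mul, Matrix.transpose_transpose]
    calc g i * (γ i)ᵀ * (γ i * A i * ((f i)ᵀ * (G i)ᵀ)) *
          (G i * (f i * (s i)ᵀ * (G i)ᵀ) * (G i * (shift 1 g i)ᵀ))
        = g i * ((γ i)ᵀ * γ i) * A i * (f i)ᵀ * ((G i)ᵀ * G i) *
          (f i * (s i)ᵀ) * ((G i)ᵀ * G i) * (shift 1 g i)ᵀ := by simp only [Matrix.mul_assoc]
      _ = g i * A i * ((f i)ᵀ * f i) * ((s i)ᵀ * (shift 1 g i)ᵀ) := by
          rw [hγ, hG, Matrix.mul_one, Matrix.mul_one, Matrix.mul_one]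
          simp only [Matrix.mul_assoc]
      _ = _ := by rw [hf, Matrix.mul_one]

theorem ratOn_chart (A : RectFam t n) (φ : Module.Dual ℂ (RectFam t n)) :
    RatOn (chartDom A) fun w : paramSpace A => φ (chart A w) :=
  ratOn_dual_of_entries (fun i => ratMat_chart A i) φ

open scoped Matrix.Norms.Operator in
/-- A polynomial vanishing on the image of a slice vanishes on the image of the chart. -/
theorem eq_zero_of_vanish_on_slice {A : RectFam t n} (hA : IsLinked A)
    {M : Submodule ℂ (paramSpace A)} (hM : IsCompl M (LinearMap.range (stabIncl hA)))
    {P : RectFam t n → ℂ} (hP : P ∈ polyMaps (RectFam t n))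
    (hvan : ∀ x ∈ M, x ∈ chartDom A → P (chart A x) = 0) {w : paramSpace A}
    (hw : w ∈ chartDom A) : P (chart A w) = 0 := by
  have hr : RatOn (chartDom A) fun w : paramSpace A => P (chart A w) :=
    RatOn.comp_polyMaps (ratOn_chart A) hP
  refine hr.eq_zero_of_eventually (chartDom_mem_nhds A) ?_ hw
  filter_upwards [eventually_chart_mem_slice hA M hM] with y hy
  obtain ⟨x, hxM, hxD, hxe⟩ := hy
  rw [hxe]
  exact hvan x hxM hxD

theorem RatOn.restrict {E : Type*} [AddCommGroup E] [Module ℂ E] {D : Set E} {f : E → ℂ}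
    (h : RatOn D f) (M : Submodule ℂ E) : RatOn (M.subtype ⁻¹' D) fun x : M => f (x : E) :=
  h.comp_linear M.subtype

theorem finrank_slice {A : RectFam t n} (hA : IsLinked A)
    {M : Submodule ℂ (paramSpace A)} (hM : IsCompl M (LinearMap.range (stabIncl hA))) {s : ℕ}
    (hs : Module.finrank ℂ (paramSpace A) = Module.finrank ℂ (stabSpace A) + s) :
    Module.finrank ℂ M = s := by
  have h1 := Submodule.finrank_add_eq_of_isCompl hM
  rw [LinearMap.finrank_range_of_inj (stabIncl_injective hA), hs] at h1
  omega

/-- The orthogonal parameters are covered by finitely many translates of the Cayley domain, so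
charts centred at finitely many points cover the stratum. A polynomial vanishing on the
s-dimensional slice of a chart vanishes on the whole chart, so the slices are dense; the lower bound
comes from one chart. -/
theorem zariskiDim_matStratum {τ : Fin t → ABDiagram} (hne : (matStratum n τ).Nonempty) {s : ℕ}
    (hs : ∀ A ∈ matStratum n τ,
      Module.finrank ℂ (paramSpace A) = Module.finrank ℂ (stabSpace A) + s) :
    zariskiDim (matStratum n τ) = s := by
  obtain ⟨A, hA⟩ := hne
  choose F hFfin hFS hFcov using fun i : Fin t => exists_finite_cover
    {f | fᵀ * f = 1 ∧ f * moment A i = moment A i * f} fun f hf => hf.1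
  choose Γ hΓfin hΓS hΓcov using fun i : Fin t => exists_finite_cover
    {γ : Matrix (Fin (n (i + 1))) (Fin (n (i + 1))) ℂ | γᵀ * γ = 1} fun γ hγ => hγ
  have : ∀ i, Finite (F i) := fun i => hFfin i
  have : ∀ i, Finite (Γ i) := fun i => hΓfin i
  obtain ⟨z, hzdef⟩ : ∃ z : (∀ i, Γ i) × (∀ i, F i) → RectFam t n, ∀ j, z j =
    act (fun i => (j.1 i : Matrix _ _ ℂ)) (fun i => (j.2 i : Matrix _ _ ℂ)) A := ⟨_, fun _ => rfl⟩
  have hz : ∀ j, z j ∈ matStratum n τ := fun j => by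
    rw [hzdef]
    exact act_mem_matStratum hA (fun i => hΓS i (j.1 i).2) (fun i => (hFS i (j.2 i).2).1)
      fun i => (hFS i (j.2 i).2).2
  choose M hM using fun j => exists_isCompl (LinearMap.range (stabIncl (hz j).1))
  have hfin : ∀ j, Module.finrank ℂ (M j) = s := fun j => finrank_slice _ (hM j).symm (hs _ (hz j))
  have hrat : ∀ j (φ : Module.Dual ℂ (RectFam t n)),
      RatOn ((M j).subtype ⁻¹' chartDom (z j)) fun x : M j => φ (chart (z j) (x : paramSpace (z j))) :=
    fun j φ => (ratOn_chart (z j) φ).restrict (M j)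
  have hlow := exists_algebraicIndependent_matStratum hA (hs A hA)
  have hne : (matStratum n τ).Nonempty := ⟨A, hA⟩
  refine zariskiDim_eq_of_charts (W := RectFam t n) (X := matStratum n τ) hne hlow
    (fun j => M j) hfin (fun j => (M j).subtype ⁻¹' chartDom (z j))
    (fun j x => chart (z j) (x : paramSpace (z j))) hrat ?_
  intro P hP hvan A' hA'
  obtain ⟨g, s', hg, hs', hc, rfl⟩ := exists_act_eq hA hA'
  choose f hf hfu using fun i => hFcov i (s' i) ⟨hs' i, hc i⟩
  choose γ hγ hγu using fun i => hΓcov i (g i) (hg i)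
  obtain ⟨j, hj⟩ : ∃ j : (∀ i, Γ i) × (∀ i, F i), z j = act γ f A :=
    ⟨(fun i => ⟨γ i, hγ i⟩, fun i => ⟨f i, hf i⟩), hzdef _⟩
  obtain ⟨w, hw, hwe⟩ := exists_mem_chartDom_chart_eq hg (fun i => hΓS i (hγ i)) hs'
    (fun i => (hFS i (hf i)).1) hc (fun i => (hFS i (hf i)).2) hγu hfu
  rw [← hwe]
  revert w
  rw [← hj]
  intro w hw _
  exact eq_zero_of_vanish_on_slice (hz j).1 (hM j).symm hP
    (fun x hxM hxD => hvan j ⟨x, hxM⟩ hxD) hw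

end Dimension

end

section

open Filter Topology Matrix

/-! ### Skew matrices commuting with symmetric ones -/

section SkewForms

variable {ι κ : Type*} [Fintype ι] [Fintype κ]

/-- Skew-symmetric matrices commuting with `T` and `E`. -/
def skewComm (T E : Matrix ι ι ℂ) : Submodule ℂ (Matrix ι ι ℂ) where
  carrier := {M | Mᵀ = -M ∧ M * T = T * M ∧ M * E = E * M}
  add_mem' := fun {a b} ha hb => ⟨by simp [ha.1, hb.1, add_comm],
    by simp [add_mul, mul_add, ha.2.1, hb.2.1], by simp [add_mul, mul_add, ha.2.2, hb.2.2]⟩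
  zero_mem' := ⟨by simp, by simp, by simp⟩
  smul_mem' := fun c a ha => ⟨by simp [ha.1], by simp [ha.2.1], by simp [ha.2.2]⟩

/-- Alternating forms for which `J` and `F` are self-adjoint. -/
def skewForm (J F : Matrix κ κ ℂ) : Submodule ℂ (Matrix κ κ ℂ) where
  carrier := {M | Mᵀ = -M ∧ M * J = Jᵀ * M ∧ M * F = Fᵀ * M}
  add_mem' := fun {a b} ha hb => ⟨by simp [ha.1, hb.1, add_comm],
    by simp [add_mul, mul_add, ha.2.1, hb.2.1], by simp [add_mul, mul_add, ha.2.2, hb.2.2]⟩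
  zero_mem' := ⟨by simp, by simp, by simp⟩
  smul_mem' := fun c a ha => ⟨by simp [ha.1], by simp [ha.2.1], by simp [ha.2.2]⟩

theorem congr_selfAdjoint {T : Matrix ι ι ℂ} {J : Matrix κ κ ℂ} {P : Matrix ι κ ℂ}
    (hT : Tᵀ = T) (h : T * P = P * J) {M : Matrix ι ι ℂ} (hM : M * T = T * M) :
    Pᵀ * M * P * J = Jᵀ * (Pᵀ * M * P) := by
  have h' : Pᵀ * T = Jᵀ * Pᵀ := by
    have := congrArg Matrix.transpose h
    rwa [Matrix.transpose_mul, Matrix.transpose_mul, hT] at this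
  calc Pᵀ * M * P * J = Pᵀ * M * (P * J) := by simp only [Matrix.mul_assoc]
    _ = Pᵀ * (M * T) * P := by rw [← h]; simp only [Matrix.mul_assoc]
    _ = (Pᵀ * T) * (M * P) := by rw [hM]; simp only [Matrix.mul_assoc]
    _ = _ := by rw [h']; simp only [Matrix.mul_assoc]

variable [DecidableEq ι] [DecidableEq κ]

theorem congr_commute {T : Matrix ι ι ℂ} {J : Matrix κ κ ℂ} {P : Matrix ι κ ℂ}
    {Q : Matrix κ ι ℂ} (hPQ : P * Q = 1) (hQP : Q * P = 1)
    (hT : Tᵀ = T) (h : T * P = P * J) {M : Matrix κ κ ℂ} (hM : M * J = Jᵀ * M) :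
    Qᵀ * M * Q * T = T * (Qᵀ * M * Q) := by
  have h1 : Q * T = J * Q := by
    calc Q * T = Q * (T * P) * Q := by
          rw [Matrix.mul_assoc, Matrix.mul_assoc T, hPQ, Matrix.mul_one]
      _ = _ := by rw [h, ← Matrix.mul_assoc, hQP, Matrix.one_mul]
  have h2 : T * Qᵀ = Qᵀ * Jᵀ := by
    have := congrArg Matrix.transpose h1
    rwa [Matrix.transpose_mul, Matrix.transpose_mul, hT] at this
  calc Qᵀ * M * Q * T = Qᵀ * M * (Q * T) := by simp only [Matrix.mul_assoc]
    _ = Qᵀ * (M * J) * Q := by rw [h1]; simp only [Matrix.mul_assoc]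
    _ = (Qᵀ * Jᵀ) * (M * Q) := by rw [hM]; simp only [Matrix.mul_assoc]
    _ = _ := by rw [← h2]; simp only [Matrix.mul_assoc]

/-- The basis change P need not be orthogonal, so conjugation would destroy skewness. The congruence
M ↦ PᵀMP preserves it, and it turns commuting with a symmetric T into self-adjointness of J for the
form. -/
theorem finrank_skewComm_eq {T E : Matrix ι ι ℂ} {J F : Matrix κ κ ℂ} {P : Matrix ι κ ℂ}
    {Q : Matrix κ ι ℂ} (hPQ : P * Q = 1) (hQP : Q * P = 1) (hT : Tᵀ = T) (hE : Eᵀ = E)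
    (hTP : T * P = P * J) (hEP : E * P = P * F) :
    Module.finrank ℂ (skewComm T E) = Module.finrank ℂ (skewForm J F) := by
  have hPQ' : Qᵀ * Pᵀ = 1 := by rw [← Matrix.transpose_mul, hPQ, Matrix.transpose_one]
  have hQP' : Pᵀ * Qᵀ = 1 := by rw [← Matrix.transpose_mul, hQP, Matrix.transpose_one]
  refine LinearEquiv.finrank_eq
    { toFun := fun M => ⟨Pᵀ * M.1 * P, by
        simp [Matrix.transpose_mul, M.2.1, Matrix.mul_assoc],
        congr_selfAdjoint hT hTP M.2.2.1, congr_selfAdjoint hE hEP M.2.2.2⟩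
      invFun := fun M => ⟨Qᵀ * M.1 * Q, by
        simp [Matrix.transpose_mul, M.2.1, Matrix.mul_assoc],
        congr_commute hPQ hQP hT hTP M.2.2.1, congr_commute hPQ hQP hE hEP M.2.2.2⟩
      map_add' := fun M N => Subtype.ext (by simp [Matrix.mul_add, Matrix.add_mul])
      map_smul' := fun c M => Subtype.ext (by simp)
      left_inv := fun M => Subtype.ext ?_
      right_inv := fun M => Subtype.ext ?_ }
  · change Qᵀ * (Pᵀ * M.1 * P) * Q = M.1
    calc _ = (Qᵀ * Pᵀ) * M.1 * (P * Q) := by simp only [Matrix.mul_assoc]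
      _ = _ := by rw [hPQ', hPQ, Matrix.one_mul, Matrix.mul_one]
  · change Pᵀ * (Qᵀ * M.1 * Q) * P = M.1
    calc _ = (Pᵀ * Qᵀ) * M.1 * (Q * P) := by simp only [Matrix.mul_assoc]
      _ = _ := by rw [hQP', hQP, Matrix.one_mul, Matrix.mul_one]

end SkewForms

/-! ### Forms adapted to a string basis -/

section Strings

variable {k : ℕ} {len : Fin k → ℕ}

/-- The matrix of the operator moving each basis vector of a string to the next one. -/
def stringShift (len : Fin k → ℕ) : Matrix (Σ i, Fin (len i)) (Σ i, Fin (len i)) ℂ :=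
  Matrix.of fun x y => if x.1 = y.1 ∧ (x.2 : ℕ) = y.2 + 1 then 1 else 0

/-- Matrix entries on strings, extended by zero. -/
def entry (M : Matrix (Σ i, Fin (len i)) (Σ i, Fin (len i)) ℂ) (i : Fin k) (j : ℕ)
    (i' : Fin k) (j' : ℕ) : ℂ :=
  if h : j < len i ∧ j' < len i' then M ⟨i, ⟨j, h.1⟩⟩ ⟨i', ⟨j', h.2⟩⟩ else 0

theorem mul_stringShift_apply (M : Matrix (Σ i, Fin (len i)) (Σ i, Fin (len i)) ℂ)
    {i : Fin k} {j : ℕ} (hj : j < len i) {i' : Fin k} {j' : ℕ} (hj' : j' < len i') :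
    (M * stringShift len) ⟨i, ⟨j, hj⟩⟩ ⟨i', ⟨j', hj'⟩⟩ = entry M i j i' (j' + 1) := by
  rw [Matrix.mul_apply]
  by_cases h : j' + 1 < len i'
  · rw [entry, dif_pos ⟨hj, h⟩, Finset.sum_eq_single ⟨i', ⟨j' + 1, h⟩⟩]
    · simp [stringShift]
    · rintro ⟨a, b⟩ _ hne
      simp only [stringShift, Matrix.of_apply]
      rw [if_neg, mul_zero]
      rintro ⟨h1, h2⟩
      subst h1
      exact hne (congrArg (Sigma.mk a) (Fin.ext h2))
    · simp
  · rw [entry, dif_neg fun h' => h h'.2]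
    refine Finset.sum_eq_zero fun ⟨a, b⟩ _ => ?_
    simp only [stringShift, Matrix.of_apply]
    rw [if_neg, mul_zero]
    rintro ⟨h1, h2⟩
    subst h1
    exact h (h2 ▸ b.2)

theorem stringShift_transpose_mul_apply (M : Matrix (Σ i, Fin (len i)) (Σ i, Fin (len i)) ℂ)
    {i : Fin k} {j : ℕ} (hj : j < len i) {i' : Fin k} {j' : ℕ} (hj' : j' < len i') :
    ((stringShift len)ᵀ * M) ⟨i, ⟨j, hj⟩⟩ ⟨i', ⟨j', hj'⟩⟩ = entry M i (j + 1) i' j' := by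
  have h := mul_stringShift_apply Mᵀ hj' hj
  rw [← Matrix.transpose_transpose M, ← Matrix.transpose_mul, Matrix.transpose_apply, h]
  simp [entry, and_comm]

theorem entry_of_lt (M : Matrix (Σ i, Fin (len i)) (Σ i, Fin (len i)) ℂ)
    {i : Fin k} {j : ℕ} (hj : j < len i) {i' : Fin k} {j' : ℕ} (hj' : j' < len i') :
    entry M i j i' j' = M ⟨i, ⟨j, hj⟩⟩ ⟨i', ⟨j', hj'⟩⟩ := dif_pos ⟨hj, hj'⟩

theorem entry_eq_zero {M : Matrix (Σ i, Fin (len i)) (Σ i, Fin (len i)) ℂ}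
    {i : Fin k} {j : ℕ} {i' : Fin k} {j' : ℕ} (h : j < len i → ¬ j' < len i') :
    entry M i j i' j' = 0 := dif_neg fun h' => h h'.1 h'.2

variable {M F : Matrix (Σ i, Fin (len i)) (Σ i, Fin (len i)) ℂ}

theorem entry_succ (hM : M ∈ skewForm (stringShift len) F) {i : Fin k} {j : ℕ} (hj : j < len i)
    {i' : Fin k} {j' : ℕ} (hj' : j' < len i') :
    entry M i (j + 1) i' j' = entry M i j i' (j' + 1) := by
  rw [← mul_stringShift_apply M hj hj', ← stringShift_transpose_mul_apply M hj hj', hM.2.1]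

/-- Self-adjointness of the shift makes each block of two strings a Hankel block, determined by its
first row. -/
theorem entry_eq_entry_zero (hM : M ∈ skewForm (stringShift len) F) {i : Fin k} {j : ℕ}
    (hj : j < len i) {i' : Fin k} {j' : ℕ} (hj' : j' < len i') :
    entry M i j i' j' = entry M i 0 i' (j + j') := by
  induction j generalizing j' with
  | zero => rw [zero_add]
  | succ j ih =>
    rw [entry_succ hM (by omega) hj']
    by_cases h : j' + 1 < len i'
    · rw [ih (by omega) h, show j + (j' + 1) = j + 1 + j' by omega]
    · rw [entry_eq_zero fun _ => h, entry_eq_zero fun _ => by omega]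

/-- Antidiagonals running past the end of the first string vanish: steps can be moved from the
second string to the first until that one is exhausted. -/
theorem entry_eq_zero_of_le (hM : M ∈ skewForm (stringShift len) F) {i : Fin k} {j : ℕ}
    {i' : Fin k} {j' : ℕ} (h : len i ≤ j + j') : entry M i j i' j' = 0 := by
  induction j' generalizing j with
  | zero => exact entry_eq_zero fun h' => by omega
  | succ j' ih =>
    by_cases hj : j < len i
    · by_cases hj' : j' < len i'
      · rw [← entry_succ hM hj hj']
        exact ih (by omega)
      · exact entry_eq_zero fun _ => by omega
    · exact entry_eq_zero fun h' => absurd h' hj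

theorem entry_swap (hM : M ∈ skewForm (stringShift len) F) (i : Fin k) (j : ℕ)
    (i' : Fin k) (j' : ℕ) : entry M i' j' i j = -entry M i j i' j' := by
  by_cases h : j < len i ∧ j' < len i'
  · rw [entry_of_lt M h.1 h.2, entry_of_lt M h.2 h.1]
    have := congrFun (congrFun hM.1 ⟨i, ⟨j, h.1⟩⟩) ⟨i', ⟨j', h.2⟩⟩
    simpa using this
  · rw [entry_eq_zero fun h1 h2 => h ⟨h1, h2⟩, entry_eq_zero fun h1 h2 => h ⟨h2, h1⟩, neg_zero]

/-- A diagonal block is Hankel, hence symmetric, and also skew, hence zero. -/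
theorem entry_self (hM : M ∈ skewForm (stringShift len) F) {i : Fin k} {j j' : ℕ} :
    entry M i j i j' = 0 := by
  by_cases h : j < len i ∧ j' < len i
  · have h1 := entry_swap hM i j i j'
    rw [entry_eq_entry_zero hM h.1 h.2, entry_eq_entry_zero hM h.2 h.1, add_comm j' j] at h1
    rw [entry_eq_entry_zero hM h.1 h.2]
    exact self_eq_neg.mp h1
  · exact entry_eq_zero fun h1 h2 => h ⟨h1, h2⟩

/-- Independent entries of a form adapted to a string basis. -/
abbrev StringPairs (len : Fin k → ℕ) (good : Fin k → Fin k → ℕ → Prop) :=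
  {x : (Σ _ : Fin k, Σ i' : Fin k, Fin (len i')) //
    x.1 < x.2.1 ∧ (x.2.2 : ℕ) < len x.1 ∧ good x.1 x.2.1 x.2.2}

variable {ε : (Σ i, Fin (len i)) → ℂ} {good : Fin k → Fin k → ℕ → Prop}

open Classical in
/-- Prescribed independent entries, extended by zero. -/
noncomputable def formOfPairs (ω : StringPairs len good → ℂ) (i : Fin k) (i' : Fin k) (s : ℕ) :
    ℂ :=
  if h : ∃ _ : s < len i', i < i' ∧ s < len i ∧ good i i' s then ω ⟨⟨i, i', ⟨s, h.1⟩⟩, h.2⟩ else 0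

theorem formOfPairs_eq_zero {ω : StringPairs len good → ℂ} {i i' : Fin k} {s : ℕ}
    (h : s < len i' → i < i' → s < len i → ¬ good i i' s) : formOfPairs ω i i' s = 0 :=
  dif_neg fun h' => h h'.1 h'.2.1 h'.2.2.1 h'.2.2.2

/-- The skew matrix with prescribed independent entries. -/
noncomputable def pairsMatrix (ω : StringPairs len good → ℂ) :
    Matrix (Σ i, Fin (len i)) (Σ i, Fin (len i)) ℂ :=
  Matrix.of fun x y => formOfPairs ω x.1 y.1 (x.2 + y.2) - formOfPairs ω y.1 x.1 (x.2 + y.2)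

theorem entry_of_formOfPairs (ω : StringPairs len good → ℂ) (i : Fin k) (j : ℕ)
    (i' : Fin k) (j' : ℕ) :
    entry (pairsMatrix ω) i j i' j' =
      formOfPairs ω i i' (j + j') - formOfPairs ω i' i (j + j') := by
  by_cases h : j < len i ∧ j' < len i'
  · rw [entry_of_lt _ h.1 h.2]; rfl
  · rw [entry_eq_zero fun h1 h2 => h ⟨h1, h2⟩, formOfPairs_eq_zero fun h1 _ h2 => by omega,
      formOfPairs_eq_zero fun h1 _ h2 => by omega, sub_zero]

theorem formOfPairs_mem (hε : ∀ i j i' j', ε ⟨i, j⟩ = ε ⟨i', j'⟩ ↔ good i i' (j + j'))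
    (ω : StringPairs len good → ℂ) :
    pairsMatrix ω ∈ skewForm (stringShift len) (Matrix.diagonal ε) := by
  refine ⟨?_, ?_, ?_⟩
  · ext x y
    simp [pairsMatrix, add_comm]
  · ext ⟨i, ⟨j, hj⟩⟩ ⟨i', ⟨j', hj'⟩⟩
    rw [mul_stringShift_apply, stringShift_transpose_mul_apply, entry_of_formOfPairs,
      entry_of_formOfPairs, show j + (j' + 1) = j + 1 + j' by omega]
  · ext ⟨i, j⟩ ⟨i', j'⟩
    rw [Matrix.diagonal_transpose, Matrix.mul_diagonal, Matrix.diagonal_mul]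
    by_cases h : ε ⟨i, j⟩ = ε ⟨i', j'⟩
    · rw [h, mul_comm]
    · have h1 : ¬ good i i' (j + j') := fun hg => h ((hε i j i' j').mpr hg)
      have h2 : ¬ good i' i (j + j') := fun hg => h ((hε i' j' i j).mpr (by
        rwa [add_comm])).symm
      simp only [pairsMatrix, Matrix.of_apply]
      rw [formOfPairs_eq_zero fun _ _ _ => h1, formOfPairs_eq_zero fun _ _ _ => h2]
      simp

/-- A form is determined by its values on (first vector of string i, vector s of string i') for i <
i' and s below both lengths. Commuting with the diagonal matrix kills exactly the s that are not
`good`, and the remaining values are free. -/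
theorem finrank_skewForm_eq_card (hε : ∀ i j i' j', ε ⟨i, j⟩ = ε ⟨i', j'⟩ ↔ good i i' (j + j')) :
    Module.finrank ℂ (skewForm (stringShift len) (Matrix.diagonal ε)) =
      Nat.card (StringPairs len good) := by
  have : Fintype (StringPairs len good) := Fintype.ofFinite _
  rw [Nat.card_eq_fintype_card, ← Module.finrank_fintype_fun_eq_card ℂ]
  refine LinearEquiv.finrank_eq
    { toFun := fun M x => entry M.1 x.1.1 0 x.1.2.1 x.1.2.2
      invFun := fun ω => ⟨_, formOfPairs_mem hε ω⟩
      map_add' := fun M N => funext fun x => ?_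
      map_smul' := fun c M => funext fun x => ?_
      left_inv := fun M => Subtype.ext ?_
      right_inv := fun ω => funext fun x => ?_ }
  · obtain ⟨⟨i, i', s⟩, h1, h2, h3⟩ := x
    have h0 : 0 < len i := by dsimp only at h2; omega
    simp [entry_of_lt _ h0 s.2]
  · obtain ⟨⟨i, i', s⟩, h1, h2, h3⟩ := x
    have h0 : 0 < len i := by dsimp only at h2; omega
    simp [entry_of_lt _ h0 s.2]
  · obtain ⟨M, hM⟩ := M
    have key : ∀ i i' s, i < i' →
        formOfPairs (fun x : StringPairs len good => entry M x.1.1 0 x.1.2.1 x.1.2.2) i i' s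
          = entry M i 0 i' s := by
      intro i i' s hlt
      rw [formOfPairs]
      split_ifs with h
      · rfl
      · by_cases h1 : s < len i'
        · by_cases h2 : s < len i
          · have h3 : ¬ good i i' s := fun hg => h ⟨h1, hlt, h2, hg⟩
            have h0 : 0 < len i := by omega
            have h4 := congrFun (congrFun hM.2.2 ⟨i, ⟨0, h0⟩⟩) ⟨i', ⟨s, h1⟩⟩
            rw [Matrix.diagonal_transpose, Matrix.mul_diagonal, Matrix.diagonal_mul, mul_comm] at h4
            have h5 : ε ⟨i', ⟨s, h1⟩⟩ ≠ ε ⟨i, ⟨0, h0⟩⟩ := fun he =>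
              h3 (by simpa using (hε i ⟨0, h0⟩ i' ⟨s, h1⟩).mp he.symm)
            rw [entry_of_lt M h0 h1]
            by_contra hne
            exact h5 (mul_right_cancel₀ (Ne.symm hne) h4)
          · rw [entry_eq_zero_of_le hM (by omega)]
        · rw [entry_eq_zero fun _ => h1]
    ext ⟨i, j⟩ ⟨i', j'⟩
    simp only [pairsMatrix, Matrix.of_apply]
    have hE : M ⟨i, j⟩ ⟨i', j'⟩ = entry M i j i' j' := (entry_of_lt M j.2 j'.2).symm
    rw [hE]
    rcases lt_trichotomy i i' with h | h | h
    · rw [key _ _ _ h, formOfPairs_eq_zero fun _ h' => absurd h' (by omega), sub_zero,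
        entry_eq_entry_zero hM j.2 j'.2]
    · subst h
      rw [entry_self hM, formOfPairs_eq_zero fun _ h' => absurd h' (lt_irrefl _), sub_zero]
    · rw [key _ _ _ h, formOfPairs_eq_zero fun _ h' => absurd h' (by omega), zero_sub,
        entry_swap hM i' j' i j, entry_eq_entry_zero hM j'.2 j.2, add_comm (j : ℕ)]
  · obtain ⟨⟨i, i', s⟩, h1, h2, h3⟩ := x
    dsimp only at h1 h2 h3
    change entry (pairsMatrix ω) i 0 i' s = _
    rw [entry_of_formOfPairs, formOfPairs_eq_zero (i := i') fun _ h' => absurd h' (by omega),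
      sub_zero]
    simp only [zero_add]
    rw [formOfPairs, dif_pos ⟨s.2, h1, h2, h3⟩]

open Classical in
theorem card_stringPairs (good : Fin k → Fin k → ℕ → Prop) :
    Nat.card (StringPairs len good) = ∑ i, ∑ i', if i < i' then
      ((Finset.range (min (len i) (len i'))).filter (good i i')).card else 0 := by
  rw [Nat.card_eq_fintype_card, Fintype.card_subtype, Finset.card_filter, Fintype.sum_sigma]
  refine Finset.sum_congr rfl fun i _ => ?_
  rw [Fintype.sum_sigma]
  refine Finset.sum_congr rfl fun i' _ => ?_
  dsimp only
  split_ifs with h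
  · rw [Fin.sum_univ_eq_sum_range (fun s => if i < i' ∧ s < len i ∧ good i i' s then 1 else 0),
      ← Finset.card_filter]
    congr 1
    ext s
    simp only [Finset.mem_filter, Finset.mem_range, lt_min_iff]
    tauto
  · exact Finset.sum_eq_zero fun s _ => if_neg fun h' => h h'.1

/-- A symmetric count over unordered pairs, in terms of all ordered pairs. -/
theorem two_mul_sum_lt (g : Fin k → Fin k → ℕ) (hg : ∀ i i', g i i' = g i' i) :
    2 * (∑ i, ∑ i', if i < i' then g i i' else 0) + ∑ i, g i i = ∑ i, ∑ i', g i i' := by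
  have h1 : (∑ i, ∑ i', if i < i' then g i i' else 0) = ∑ i, ∑ i', if i' < i then g i i' else 0 := by
    rw [Finset.sum_comm]
    exact Finset.sum_congr rfl fun i _ => Finset.sum_congr rfl fun i' _ => by rw [hg]
  have h2 : ∑ i, g i i = ∑ i, ∑ i', if i' = i then g i i' else 0 :=
    Finset.sum_congr rfl fun i _ => by simp
  rw [two_mul]
  nth_rewrite 2 [h1]
  rw [h2, ← Finset.sum_add_distrib, ← Finset.sum_add_distrib]
  refine Finset.sum_congr rfl fun i _ => ?_
  rw [← Finset.sum_add_distrib, ← Finset.sum_add_distrib]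
  refine Finset.sum_congr rfl fun i' _ => ?_
  rcases lt_trichotomy i i' with h | h | h
  · simp [h, h.not_gt, h.ne']
  · simp [h]
  · simp [h, h.not_gt, h.ne]

end Strings

end

section

open Filter Topology Matrix

/-! ### Letters in a string -/

section Letters

/-- The number of positions `j` with letter `l` such that `j + m` is still in the string. -/
def ABString.num (r : ABString) (l : Letter) (m : ℕ) : ℕ :=
  if r.first = l then (r.len - m + 1) / 2 else (r.len - m) / 2

theorem Letter.eq_swap_iff {l l' : Letter} : l.swap = l' ↔ l ≠ l' := by
  cases l <;> cases l' <;> simp [Letter.swap]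

theorem Letter.eq_a_or_eq_b (l : Letter) : l = Letter.a ∨ l = Letter.b := by
  cases l <;> simp

theorem ABString.letter_eq_iff (r : ABString) (j : ℕ) (l : Letter) :
    r.letter j = l ↔ (Even j ↔ r.first = l) := by
  unfold ABString.letter
  split_ifs with h
  · simp [h]
  · simp [h, Letter.eq_swap_iff]

theorem card_filter_even_iff (L : ℕ) (p : Prop) [Decidable p] [DecidablePred fun s : ℕ => Even s ↔ p] :
    ((Finset.range L).filter fun s => Even s ↔ p).card = if p then (L + 1) / 2 else L / 2 := by
  induction L with
  | zero => simp
  | succ L ih =>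
    rw [Finset.range_add_one, Finset.filter_insert]
    split_ifs at ih ⊢ with h1 h2 h2
    · rw [Finset.card_insert_of_notMem (by simp), ih]
      have : Even L := by simpa [h2] using h1
      rcases this with ⟨c, rfl⟩
      omega
    · rw [Finset.card_insert_of_notMem (by simp), ih]
      have : ¬ Even L := by simpa [h2] using h1
      rcases Nat.not_even_iff_odd.mp this with ⟨c, rfl⟩
      omega
    · rw [ih]
      have : ¬ Even L := by simpa [h2] using h1
      rcases Nat.not_even_iff_odd.mp this with ⟨c, rfl⟩
      omega
    · rw [ih]
      have : Even L := by simpa [h2] using h1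
      rcases this with ⟨c, rfl⟩
      omega

instance (r : ABString) (l : Letter) : DecidablePred fun j => r.letter j = l := fun _ =>
  inferInstance

theorem ABString.card_letter (r : ABString) (l : Letter) (m : ℕ) :
    ((Finset.range r.len).filter fun j => r.letter j = l ∧ j + m < r.len).card = r.num l m := by
  have : ((Finset.range r.len).filter fun j => r.letter j = l ∧ j + m < r.len)
      = (Finset.range (r.len - m)).filter fun j => Even j ↔ r.first = l := by
    ext j
    simp only [Finset.mem_filter, Finset.mem_range, r.letter_eq_iff]
    constructor
    · rintro ⟨h1, h2, h3⟩
      exact ⟨by omega, h2⟩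
    · rintro ⟨h1, h2⟩
      exact ⟨by omega, h2, by omega⟩
  rw [this, card_filter_even_iff]
  rfl

theorem ABString.countA_eq (r : ABString) : r.countA = r.num Letter.a 0 := by
  rw [← r.card_letter, ABString.countA]
  congr 1
  ext j
  simp +contextual

theorem ABString.num_two_mul (r : ABString) (l : Letter) (k : ℕ) :
    r.num l (2 * k) = r.num l 0 - k := by
  unfold ABString.num
  split_ifs <;> omega

/-- The position of the `m`-th letter `a`. -/
def ABString.pos (r : ABString) (m : ℕ) : ℕ := if r.first = Letter.a then 2 * m else 2 * m + 1

theorem ABString.pos_succ (r : ABString) (m : ℕ) : r.pos (m + 1) = r.pos m + 2 := by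
  unfold ABString.pos; split_ifs <;> omega

theorem ABString.pos_lt_iff (r : ABString) (m : ℕ) : r.pos m < r.len ↔ m < r.num Letter.a 0 := by
  unfold ABString.pos ABString.num; split_ifs <;> omega

theorem ABString.pos_injective (r : ABString) : Function.Injective r.pos := by
  intro m m' h
  unfold ABString.pos at h; split_ifs at h <;> omega

theorem ABString.letter_pos (r : ABString) (m : ℕ) : r.letter (r.pos m) = Letter.a := by
  rw [letter_eq_iff, ABString.pos]
  split_ifs with h <;> simp [h]

theorem ABString.exists_pos_eq (r : ABString) {j : ℕ} (h : r.letter j = Letter.a) :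
    ∃ m, r.pos m = j := by
  rw [letter_eq_iff] at h
  refine ⟨j / 2, ?_⟩
  unfold ABString.pos
  split_ifs with h1
  · have : Even j := h.mpr h1
    have := Nat.even_iff.mp this
    omega
  · have : ¬ Even j := fun he => h1 (h.mp he)
    have := Nat.not_even_iff.mp this
    omega

end Letters

/-! ### Ranks in a string basis -/

section StringRank

variable {k : ℕ} {len : Fin k → ℕ} {X : Type*}

theorem mul_stringShift_pow_apply (R : Matrix X (Σ i, Fin (len i)) ℂ) (m : ℕ) (x : X) (i : Fin k)
    (j : Fin (len i)) : (R * stringShift len ^ m) x ⟨i, j⟩ =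
      if h : (j : ℕ) + m < len i then R x ⟨i, ⟨j + m, h⟩⟩ else 0 := by
  induction m generalizing j with
  | zero => simp
  | succ m ih =>
    rw [pow_succ, ← Matrix.mul_assoc, Matrix.mul_apply]
    by_cases h : (j : ℕ) + 1 < len i
    · rw [Finset.sum_eq_single ⟨i, ⟨j + 1, h⟩⟩]
      · rw [ih]
        simp only [stringShift, Matrix.of_apply, and_self, if_true, mul_one]
        simp only [Nat.add_assoc, Nat.add_comm 1 m]
      · rintro ⟨a, b⟩ _ hne
        simp only [stringShift, Matrix.of_apply]
        rw [if_neg, mul_zero]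
        rintro ⟨h1, h2⟩
        subst h1
        exact hne (congrArg (Sigma.mk a) (Fin.ext h2))
      · simp
    · rw [dif_neg (by omega)]
      refine Finset.sum_eq_zero fun ⟨a, b⟩ _ => ?_
      simp only [stringShift, Matrix.of_apply]
      rw [if_neg, mul_zero]
      rintro ⟨h1, h2⟩
      subst h1
      exact h (h2 ▸ b.2)

theorem stringShift_pow_transpose_mul (len : Fin k → ℕ) (m : ℕ) :
    (stringShift len ^ m)ᵀ * stringShift len ^ m =
      Matrix.diagonal fun x => if (x.2 : ℕ) + m < len x.1 then 1 else 0 := by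
  ext ⟨i, j⟩ ⟨i', j'⟩
  rw [mul_stringShift_pow_apply]
  split_ifs with h
  · rw [Matrix.transpose_apply]
    have h2 := mul_stringShift_pow_apply (1 : Matrix (Σ i, Fin (len i)) (Σ i, Fin (len i)) ℂ) m
      ⟨i', ⟨j' + m, h⟩⟩ i j
    rw [Matrix.one_mul] at h2
    rw [h2]
    split_ifs with h3
    · rw [Matrix.one_apply, Matrix.diagonal_apply]
      dsimp only
      rw [if_pos h3]
      refine if_congr ⟨fun he => ?_, fun he => ?_⟩ rfl rfl
      · obtain ⟨rfl, he⟩ := Sigma.mk.inj_iff.mp he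
        have := congrArg Fin.val (eq_of_heq he)
        dsimp only at this
        exact congrArg _ (Fin.ext (by omega))
      · obtain ⟨rfl, he⟩ := Sigma.mk.inj_iff.mp he
        obtain rfl := eq_of_heq he
        rfl
    · rw [Matrix.diagonal_apply]
      dsimp only
      rw [if_neg h3, ite_self]
  · rw [Matrix.diagonal_apply]
    dsimp only
    split_ifs with h1 h2
    · obtain ⟨rfl, he⟩ := Sigma.mk.inj_iff.mp h1
      rw [eq_of_heq he] at h2
      exact absurd h2 h
    · rfl
    · rfl

theorem stringShift_pow_mul_diagonal (len : Fin k → ℕ) (m : ℕ) :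
    stringShift len ^ m * (Matrix.diagonal fun x => if (x.2 : ℕ) + m < len x.1 then 1 else 0) =
      stringShift len ^ m := by
  ext x ⟨i, j⟩
  rw [Matrix.mul_diagonal]
  have h := mul_stringShift_pow_apply (1 : Matrix (Σ i, Fin (len i)) (Σ i, Fin (len i)) ℂ) m x i j
  rw [Matrix.one_mul] at h
  rw [h]
  split_ifs <;> simp

theorem rank_diagonal_ite {Y : Type*} [Fintype Y] [DecidableEq Y] (p : Y → Prop) [DecidablePred p] :
    (Matrix.diagonal fun y => if p y then (1 : ℂ) else 0).rank = Fintype.card {y // p y} := by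
  rw [Matrix.rank_diagonal]
  exact Fintype.card_congr (Equiv.subtypeEquivRight fun y => by simp)

/-- The m-th power of the shift is a partial isometry: its transpose times itself is the diagonal
projection onto the positions from which m steps remain in the string. -/
theorem rank_stringShift_pow_mul (len : Fin k → ℕ) (m : ℕ) (p : (Σ i, Fin (len i)) → Prop)
    [DecidablePred p] :
    (stringShift len ^ m * Matrix.diagonal fun x => if p x then (1 : ℂ) else 0).rank =
      Fintype.card {x : Σ i, Fin (len i) // p x ∧ (x.2 : ℕ) + m < len x.1} := by
  have hd : (Matrix.diagonal fun x : Σ i, Fin (len i) => if (x.2 : ℕ) + m < len x.1 then (1 : ℂ) else 0)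
      * (Matrix.diagonal fun x => if p x then (1 : ℂ) else 0) =
      Matrix.diagonal fun x => if p x ∧ (x.2 : ℕ) + m < len x.1 then (1 : ℂ) else 0 := by
    rw [Matrix.diagonal_mul_diagonal]
    congr 1
    funext x
    by_cases h1 : p x <;> by_cases h2 : (x.2 : ℕ) + m < len x.1 <;> simp [h1, h2]
  rw [← rank_diagonal_ite]
  refine le_antisymm ?_ ?_
  · rw [← stringShift_pow_mul_diagonal, Matrix.mul_assoc, hd]
    exact Matrix.rank_mul_le_right _ _
  · rw [← hd]
    refine le_trans (le_of_eq ?_) (Matrix.rank_mul_le_right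
      (Matrix.diagonal (fun x => if p x then (1 : ℂ) else 0) * (stringShift len ^ m)ᵀ) _)
    congr 1
    rw [Matrix.mul_assoc, ← Matrix.mul_assoc _ᵀ, stringShift_pow_transpose_mul, hd,
      Matrix.diagonal_mul_diagonal]
    congr 1
    funext x
    by_cases h1 : p x <;> simp [h1]

theorem rank_eq_of_conj {κ : Type*} [Fintype κ] [DecidableEq κ] [Fintype X] [DecidableEq X] {P : Matrix X κ ℂ}
    {Q : Matrix κ X ℂ} (hPQ : P * Q = 1) (hQP : Q * P = 1) {M : Matrix X X ℂ} {N : Matrix κ κ ℂ}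
    (h : M * P = P * N) : M.rank = N.rank := by
  refine le_antisymm ?_ ?_
  · have : M = P * N * Q := by rw [← h, Matrix.mul_assoc, hPQ, Matrix.mul_one]
    rw [this]
    exact (Matrix.rank_mul_le_left _ _).trans (Matrix.rank_mul_le_right _ _)
  · have : N = Q * (M * P) := by rw [h, ← Matrix.mul_assoc, hQP, Matrix.one_mul]
    rw [this]
    exact (Matrix.rank_mul_le_right _ _).trans (Matrix.rank_mul_le_left _ _)

end StringRank

/-! ### The string basis of a matrix with given `ab`-diagram -/

section StringBasis

variable {p q : ℕ}

/-- The symmetric matrix combining a matrix and its transpose. -/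
def bigT (A : Matrix (Fin p) (Fin q) ℂ) : Matrix (Fin q ⊕ Fin p) (Fin q ⊕ Fin p) ℂ :=
  Matrix.fromBlocks 0 Aᵀ A 0

/-- The projection to the source or to the target. -/
def proj (p q : ℕ) : Letter → Matrix (Fin q ⊕ Fin p) (Fin q ⊕ Fin p) ℂ
  | .a => Matrix.fromBlocks 1 0 0 0
  | .b => Matrix.fromBlocks 0 0 0 1

/-- A string basis of a matrix, in matrix form. -/
structure StringBasis (A : Matrix (Fin p) (Fin q) ℂ) (δ : ABDiagram) where
  k : ℕ
  row : Fin k → ABString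
  P : Matrix (Fin q ⊕ Fin p) (Σ i, Fin (row i).len) ℂ
  Q : Matrix (Σ i, Fin (row i).len) (Fin q ⊕ Fin p) ℂ
  map_row : Multiset.map row Finset.univ.val = δ
  mul_inv : P * Q = 1
  inv_mul : Q * P = 1
  bigT_mul : bigT A * P = P * stringShift fun i => (row i).len
  apply_inl : ∀ i (j : Fin (row i).len), (row i).letter j = Letter.b → ∀ x, P (Sum.inl x) ⟨i, j⟩ = 0
  apply_inr : ∀ i (j : Fin (row i).len), (row i).letter j = Letter.a → ∀ x, P (Sum.inr x) ⟨i, j⟩ = 0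

theorem exists_stringBasis {A : Matrix (Fin p) (Fin q) ℂ} {δ : ABDiagram}
    (h : HasABDiagram (Matrix.toLin' A) (Matrix.toLin' Aᵀ) δ) : Nonempty (StringBasis A δ) := by
  obtain ⟨k, row, e, hrow, ha, hb, hstep⟩ := h
  let e' := e.map (LinearEquiv.sumArrowLequivProdArrow (Fin q) (Fin p) ℂ ℂ).symm
  have hP : ∀ x κ, (Pi.basisFun ℂ (Fin q ⊕ Fin p)).toMatrix e' x κ
      = Sum.elim (e κ).1 (e κ).2 x := by
    intro x κ
    rw [Module.Basis.toMatrix_apply, Pi.basisFun_repr, Module.Basis.map_apply]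
    cases x <;> rfl
  refine ⟨⟨k, row, (Pi.basisFun ℂ _).toMatrix e', e'.toMatrix (Pi.basisFun ℂ _), hrow,
    Module.Basis.toMatrix_mul_toMatrix_flip _ _, Module.Basis.toMatrix_mul_toMatrix_flip _ _,
    ?_, ?_, ?_⟩⟩
  · ext x ⟨i, j⟩
    have h1 := mul_stringShift_pow_apply ((Pi.basisFun ℂ (Fin q ⊕ Fin p)).toMatrix e') 1 x i j
    rw [pow_one] at h1
    rw [h1]
    have h2 := hstep i j
    have h3 : (bigT A * (Pi.basisFun ℂ (Fin q ⊕ Fin p)).toMatrix e') x ⟨i, j⟩ =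
        Sum.elim (Matrix.toLin' Aᵀ (e ⟨i, j⟩).2) (Matrix.toLin' A (e ⟨i, j⟩).1) x := by
      rw [Matrix.mul_apply, Fintype.sum_sum_type]
      cases x <;> simp [hP, bigT, Matrix.toLin'_apply, Matrix.mulVec, dotProduct]
    rw [h3]
    have h4 := congrArg (fun v : (Fin q → ℂ) × (Fin p → ℂ) => Sum.elim v.1 v.2 x) h2
    dsimp only at h4
    rw [h4]
    split_ifs with hlt
    · rw [hP]
    · cases x <;> rfl
  · intro i j hj x
    rw [hP, Sum.elim_inl, hb i j hj]
    rfl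
  · intro i j hj x
    rw [hP, Sum.elim_inr, ha i j hj]
    rfl

variable {A : Matrix (Fin p) (Fin q) ℂ} {δ : ABDiagram} (S : StringBasis A δ)

namespace StringBasis

/-- The diagonal matrix selecting the letters `l`. -/
def select (l : Letter) :
    Matrix (Σ i, Fin (S.row i).len) (Σ i, Fin (S.row i).len) ℂ :=
  Matrix.diagonal fun x => if (S.row x.1).letter x.2 = l then (1 : ℂ) else 0

theorem proj_mul (l : Letter) : proj p q l * S.P = S.P * S.select l := by
  ext x ⟨i, j⟩
  unfold select
  rw [Matrix.mul_diagonal, Matrix.mul_apply, Fintype.sum_sum_type]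
  rcases ((S.row i).letter j).eq_a_or_eq_b with hl | hl
  · have h0 := S.apply_inr i j hl
    cases l <;> cases x <;> simp [proj, hl, h0, Matrix.one_apply]
  · have h0 := S.apply_inl i j hl
    cases l <;> cases x <;> simp [proj, hl, h0, Matrix.one_apply]

theorem bigT_pow_mul (m : ℕ) : bigT A ^ m * S.P = S.P * stringShift (fun i => (S.row i).len) ^ m := by
  induction m with
  | zero => simp
  | succ m ih =>
    rw [pow_succ, Matrix.mul_assoc, S.bigT_mul, ← Matrix.mul_assoc, ih, Matrix.mul_assoc,
      ← pow_succ]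

theorem rank_bigT_pow_mul_proj (m : ℕ) (l : Letter) :
    (bigT A ^ m * proj p q l).rank = ∑ i, (S.row i).num l m := by
  rw [rank_eq_of_conj S.mul_inv S.inv_mul (N := stringShift (fun i => (S.row i).len) ^ m *
    S.select l), select, rank_stringShift_pow_mul, Fintype.card_subtype, Finset.card_filter, Fintype.sum_sigma]
  · refine Finset.sum_congr rfl fun i _ => ?_
    dsimp only
    rw [Fin.sum_univ_eq_sum_range (fun j => if (S.row i).letter j = l ∧ j + m < (S.row i).len
      then 1 else 0), ← Finset.card_filter, ABString.card_letter]
  · rw [Matrix.mul_assoc, S.proj_mul, ← Matrix.mul_assoc, S.bigT_pow_mul, Matrix.mul_assoc]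

end StringBasis

theorem bigT_transpose (A : Matrix (Fin p) (Fin q) ℂ) : (bigT A)ᵀ = bigT A := by
  simp [bigT, Matrix.fromBlocks_transpose]

theorem proj_transpose (l : Letter) : (proj p q l)ᵀ = proj p q l := by
  cases l <;> simp [proj, Matrix.fromBlocks_transpose]

theorem bigT_mul_proj (A : Matrix (Fin p) (Fin q) ℂ) (l : Letter) :
    bigT A * proj p q l = proj p q l.swap * bigT A := by
  cases l <;> simp [bigT, proj, Letter.swap, Matrix.fromBlocks_multiply]

theorem bigT_sq (A : Matrix (Fin p) (Fin q) ℂ) (k : ℕ) :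
    bigT A ^ (2 * k) = Matrix.fromBlocks ((Aᵀ * A) ^ k) 0 0 ((A * Aᵀ) ^ k) := by
  rw [pow_mul]
  have : bigT A ^ 2 = Matrix.fromBlocks (Aᵀ * A) 0 0 (A * Aᵀ) := by
    simp [pow_two, bigT, Matrix.fromBlocks_multiply]
  rw [this, Matrix.fromBlocks_diagonal_pow]

theorem bigT_pow_odd_mul_proj (A : Matrix (Fin p) (Fin q) ℂ) (k : ℕ) :
    bigT A ^ (2 * k + 1) * proj p q .a = proj p q .b * bigT A ^ (2 * k + 1) := by
  have h : ∀ k l, bigT A ^ (2 * k) * proj p q l = proj p q l * bigT A ^ (2 * k) := by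
    intro k l
    rw [bigT_sq]
    cases l <;> simp [proj, Matrix.fromBlocks_multiply]
  rw [pow_succ, Matrix.mul_assoc, bigT_mul_proj, ← Matrix.mul_assoc, h, Matrix.mul_assoc]
  rfl

/-- Here the bilinear form restricts the diagram. An odd power of the symmetric `bigT A` exchanges
the projections to source and target, so its products with the two projections are transposes of
each other and have equal rank. -/
theorem StringBasis.sum_num_odd (S : StringBasis A δ) (k : ℕ) :
    ∑ i, (S.row i).num .a (2 * k + 1) = ∑ i, (S.row i).num .b (2 * k + 1) := by
  rw [← S.rank_bigT_pow_mul_proj, ← S.rank_bigT_pow_mul_proj, bigT_pow_odd_mul_proj,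
    ← Matrix.rank_transpose, Matrix.transpose_mul, Matrix.transpose_pow, bigT_transpose,
    proj_transpose]

theorem rank_fromBlocks_left (X : Matrix (Fin q) (Fin q) ℂ) :
    (Matrix.fromBlocks X 0 0 (0 : Matrix (Fin p) (Fin p) ℂ)).rank = X.rank := by
  refine le_antisymm ?_ ?_
  · have : Matrix.fromBlocks X 0 0 (0 : Matrix (Fin p) (Fin p) ℂ) =
        Matrix.fromRows (1 : Matrix (Fin q) (Fin q) ℂ) (0 : Matrix (Fin p) (Fin q) ℂ) * X * Matrix.fromCols (1 : Matrix (Fin q) (Fin q) ℂ) (0 : Matrix (Fin q) (Fin p) ℂ) := by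
      rw [Matrix.fromRows_mul, Matrix.fromRows_mul_fromCols]
      simp
    rw [this]
    exact (Matrix.rank_mul_le_left _ _).trans (Matrix.rank_mul_le_right _ _)
  · exact Matrix.rank_submatrix_le (Matrix.fromBlocks X 0 0 (0 : Matrix (Fin p) (Fin p) ℂ))
      Sum.inl Sum.inl

theorem rank_fromBlocks_right (X : Matrix (Fin p) (Fin p) ℂ) :
    (Matrix.fromBlocks (0 : Matrix (Fin q) (Fin q) ℂ) 0 0 X).rank = X.rank := by
  refine le_antisymm ?_ ?_
  · have : Matrix.fromBlocks (0 : Matrix (Fin q) (Fin q) ℂ) 0 0 X =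
        Matrix.fromRows (0 : Matrix (Fin q) (Fin p) ℂ) (1 : Matrix (Fin p) (Fin p) ℂ) * X * Matrix.fromCols (0 : Matrix (Fin p) (Fin q) ℂ) (1 : Matrix (Fin p) (Fin p) ℂ) := by
      rw [Matrix.fromRows_mul, Matrix.fromRows_mul_fromCols]
      simp
    rw [this]
    exact (Matrix.rank_mul_le_left _ _).trans (Matrix.rank_mul_le_right _ _)
  · exact Matrix.rank_submatrix_le (Matrix.fromBlocks (0 : Matrix (Fin q) (Fin q) ℂ) 0 0 X)
      Sum.inr Sum.inr

theorem StringBasis.rank_transpose_mul_pow (S : StringBasis A δ) (k : ℕ) :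
    ((Aᵀ * A) ^ k).rank = ∑ i, ((S.row i).num .a 0 - k) := by
  rw [← rank_fromBlocks_left (p := p)]
  simp only [← ABString.num_two_mul]
  rw [← S.rank_bigT_pow_mul_proj, bigT_sq]
  simp [proj, Matrix.fromBlocks_multiply]

theorem StringBasis.rank_mul_transpose_pow (S : StringBasis A δ) (k : ℕ) :
    ((A * Aᵀ) ^ k).rank = ∑ i, ((S.row i).num .b 0 - k) := by
  rw [← rank_fromBlocks_right (q := q)]
  simp only [← ABString.num_two_mul]
  rw [← S.rank_bigT_pow_mul_proj, bigT_sq]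
  simp [proj, Matrix.fromBlocks_multiply]

end StringBasis

end

section

open Filter Topology Matrix

/-! ### Dimension counts -/

section Counts

variable {p q : ℕ} {A : Matrix (Fin p) (Fin q) ℂ} {δ : ABDiagram}

/-- The number of `s < min len len'` for which the letters at distance `s` agree. -/
def pairNum (r r' : ABString) : ℕ :=
  if r.first = r'.first then (min r.len r'.len + 1) / 2 else min r.len r'.len / 2

theorem pairNum_comm (r r' : ABString) : pairNum r r' = pairNum r' r := by
  simp only [pairNum, eq_comm (a := r.first), min_comm r.len]

/-- The involution which is `1` on the source and `-1` on the target. -/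
def signMat (p q : ℕ) : Matrix (Fin q ⊕ Fin p) (Fin q ⊕ Fin p) ℂ := Matrix.fromBlocks 1 0 0 (-1)

/-- The sign of a letter. -/
def Letter.sign : Letter → ℂ
  | .a => 1
  | .b => -1

theorem Letter.sign_inj {l l' : Letter} : l.sign = l'.sign ↔ l = l' := by
  have h : (1 : ℂ) ≠ -1 := by norm_num
  cases l <;> cases l' <;> simp [Letter.sign, h, h.symm]

theorem StringBasis.signMat_mul (S : StringBasis A δ) : signMat p q * S.P =
    S.P * Matrix.diagonal (fun x : Σ i, Fin (S.row i).len => ((S.row x.1).letter x.2).sign) := by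
  ext x ⟨i, j⟩
  rw [Matrix.mul_diagonal, Matrix.mul_apply, Fintype.sum_sum_type]
  rcases ((S.row i).letter j).eq_a_or_eq_b with hl | hl
  · have h0 := S.apply_inr i j hl
    cases x <;> simp [signMat, hl, h0, Matrix.one_apply, Letter.sign]
  · have h0 := S.apply_inl i j hl
    cases x <;> simp [signMat, hl, h0, Matrix.one_apply, Letter.sign]

theorem ABString.letter_eq_letter_iff (r r' : ABString) (j j' : ℕ) :
    r.letter j = r'.letter j' ↔ (Even (j + j') ↔ r.first = r'.first) := by
  rw [letter_eq_iff, eq_comm, letter_eq_iff, Nat.even_add, eq_comm (a := r'.first)]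
  tauto

/-- Commuting with the sign matrix leaves only pairings of equal letters, and whether letters at
positions j, j' agree depends only on the parity of j + j'. The sum over i < i' is then rewritten
over all ordered pairs. -/
theorem StringBasis.two_mul_finrank_skewComm (S : StringBasis A δ) :
    2 * Module.finrank ℂ (skewComm (bigT A) (signMat p q)) + ∑ i, pairNum (S.row i) (S.row i) =
      ∑ i, ∑ i', pairNum (S.row i) (S.row i') := by
  classical
  rw [finrank_skewComm_eq S.mul_inv S.inv_mul (bigT_transpose A)
    (by simp [signMat, Matrix.fromBlocks_transpose]) S.bigT_mul S.signMat_mul,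
    finrank_skewForm_eq_card (good := fun i i' s => Even s ↔ (S.row i).first = (S.row i').first)
      (fun i j i' j' => by rw [Letter.sign_inj, ABString.letter_eq_letter_iff]),
    card_stringPairs, ← two_mul_sum_lt _ fun i i' => pairNum_comm (S.row i) (S.row i')]
  congr 3
  funext i
  congr 1
  funext i'
  rw [card_filter_even_iff]
  rfl

/-- The position of a letter `a` in the whole diagram. -/
def StringBasis.embA (S : StringBasis A δ) (x : Σ i, Fin ((S.row i).num .a 0)) :
    Σ i, Fin (S.row i).len :=
  ⟨x.1, ⟨(S.row x.1).pos x.2, ((S.row x.1).pos_lt_iff x.2).mpr x.2.2⟩⟩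

theorem StringBasis.embA_injective (S : StringBasis A δ) : Function.Injective S.embA := by
  rintro ⟨i, j⟩ ⟨i', j'⟩ h
  obtain ⟨rfl, h2⟩ := Sigma.mk.inj_iff.mp h
  have := congrArg Fin.val (eq_of_heq h2)
  exact congrArg _ (Fin.ext ((S.row i).pos_injective this))

theorem StringBasis.mem_range_embA (S : StringBasis A δ) (i : Fin S.k) (j : Fin (S.row i).len)
    (h : (S.row i).letter j = .a) : ⟨i, j⟩ ∈ Set.range S.embA := by
  obtain ⟨m, hm⟩ := (S.row i).exists_pos_eq h
  exact ⟨⟨i, ⟨m, ((S.row i).pos_lt_iff m).mp (hm ▸ j.2)⟩⟩, congrArg (Sigma.mk i) (Fin.ext hm)⟩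

theorem StringBasis.mulA_inv (S : StringBasis A δ) :
    S.P.submatrix Sum.inl S.embA * S.Q.submatrix S.embA Sum.inl = 1 := by
  ext x y
  have h := congrFun (congrFun S.mul_inv (Sum.inl x)) (Sum.inl y)
  rw [Matrix.mul_apply] at h ⊢
  have h1 : (1 : Matrix (Fin q) (Fin q) ℂ) x y =
      (1 : Matrix (Fin q ⊕ Fin p) (Fin q ⊕ Fin p) ℂ) (Sum.inl x) (Sum.inl y) := by
    simp [Matrix.one_apply]
  rw [h1, ← h]
  refine Finset.sum_of_injOn S.embA S.embA_injective.injOn (by simp) ?_ (fun _ _ => rfl)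
  rintro ⟨i, j⟩ _ hj
  have : (S.row i).letter j = .b := by
    rcases ((S.row i).letter j).eq_a_or_eq_b with hl | hl
    · exact absurd (S.mem_range_embA i j hl) (by simpa using hj)
    · exact hl
  rw [S.apply_inl i j this, zero_mul]

theorem StringBasis.invA_mul (S : StringBasis A δ) :
    S.Q.submatrix S.embA Sum.inl * S.P.submatrix Sum.inl S.embA = 1 := by
  ext x y
  have h := congrFun (congrFun S.inv_mul (S.embA x)) (S.embA y)
  rw [Matrix.mul_apply, Fintype.sum_sum_type] at h
  have h1 : (1 : Matrix (Σ i, Fin ((S.row i).num .a 0)) (Σ i, Fin ((S.row i).num .a 0)) ℂ) x y =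
      (1 : Matrix (Σ i, Fin (S.row i).len) (Σ i, Fin (S.row i).len) ℂ) (S.embA x) (S.embA y) := by
    simp [Matrix.one_apply, S.embA_injective.eq_iff]
  rw [Matrix.mul_apply, h1, ← h]
  have h0 : ∀ z, S.P (Sum.inr z) (S.embA y) = 0 :=
    S.apply_inr y.1 _ ((S.row y.1).letter_pos y.2)
  simp [h0]

/-- Two steps along a string lead from one a to the next. So the letters a alone form a string basis
for AᵀA, with string lengths the numbers of a's. -/
theorem StringBasis.transpose_mul_mulA (S : StringBasis A δ) :
    Aᵀ * A * S.P.submatrix Sum.inl S.embA =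
      S.P.submatrix Sum.inl S.embA * stringShift fun i => (S.row i).num .a 0 := by
  ext x ⟨i, m⟩
  have h1 := mul_stringShift_pow_apply (S.P.submatrix Sum.inl S.embA) 1 x i m
  rw [pow_one] at h1
  have h2 := mul_stringShift_pow_apply S.P 2 (Sum.inl x) i
    ⟨(S.row i).pos m, ((S.row i).pos_lt_iff m).mpr m.2⟩
  rw [← S.bigT_pow_mul, show 2 = 2 * 1 from rfl, bigT_sq, Matrix.mul_apply,
    Fintype.sum_sum_type] at h2
  simp only [Matrix.fromBlocks_apply₁₁, Matrix.fromBlocks_apply₁₂, Matrix.zero_apply, zero_mul,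
    Finset.sum_const_zero, add_zero, pow_one] at h2
  rw [h1, Matrix.mul_apply]
  refine h2.trans ?_
  by_cases h3 : (m : ℕ) + 1 < (S.row i).num .a 0
  · have h4 := ((S.row i).pos_lt_iff (m + 1)).mpr h3
    rw [ABString.pos_succ] at h4
    rw [dif_pos h4, dif_pos h3, Matrix.submatrix_apply]
    congr 2
    exact Fin.ext ((S.row i).pos_succ m).symm
  · have h4 : ¬ _ := fun h => h3 (((S.row i).pos_lt_iff (m + 1)).mp h)
    rw [ABString.pos_succ] at h4
    rw [dif_neg h4, dif_neg h3]

theorem one_eq_diagonal {ι : Type*} [DecidableEq ι] :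
    (1 : Matrix ι ι ℂ) = Matrix.diagonal fun _ => 1 := Matrix.diagonal_one.symm

theorem StringBasis.two_mul_finrank_skewComm_transpose_mul (S : StringBasis A δ) :
    2 * Module.finrank ℂ (skewComm (Aᵀ * A) 1) + ∑ i, (S.row i).num .a 0 =
      ∑ i, ∑ i', min ((S.row i).num .a 0) ((S.row i').num .a 0) := by
  classical
  rw [finrank_skewComm_eq (F := Matrix.diagonal fun _ => 1) S.mulA_inv S.invA_mul (by simp) (by simp)
    S.transpose_mul_mulA (by rw [← one_eq_diagonal, Matrix.one_mul, Matrix.mul_one]),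
    finrank_skewForm_eq_card (good := fun _ _ _ => True) (by simp), card_stringPairs,
    ← two_mul_sum_lt _ fun i i' => min_comm _ _]
  simp

theorem two_mul_finrank_skewComm_zero (m : ℕ) :
    2 * Module.finrank ℂ (skewComm (0 : Matrix (Fin m) (Fin m) ℂ) 1) + m = m * m := by
  classical
  let P : Matrix (Fin m) (Σ _ : Fin m, Fin 1) ℂ := Matrix.of fun x y => if x = y.1 then 1 else 0
  have hsum : ∀ f : (Σ _ : Fin m, Fin 1) → ℂ, ∑ x, f x = ∑ i, f ⟨i, 0⟩ := fun f => by
    rw [Fintype.sum_sigma]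
    simp
  have h1 : P * Pᵀ = 1 := by
    ext x y
    rw [Matrix.mul_apply, hsum]
    simp [P, Matrix.one_apply]
  have h2 : Pᵀ * P = 1 := by
    ext ⟨x, a⟩ ⟨y, b⟩
    rw [Matrix.mul_apply]
    have : a = b := Subsingleton.elim _ _
    simp [P, Matrix.one_apply, this, eq_comm]
  have h3 : stringShift (fun _ : Fin m => 1) = 0 := by
    ext ⟨x, a⟩ ⟨y, b⟩
    simp [stringShift]
  rw [finrank_skewComm_eq (J := stringShift fun _ => 1) (F := Matrix.diagonal fun _ => 1) h1 h2
    (by simp) (by simp) (by simp [h3]) (by rw [← one_eq_diagonal, Matrix.one_mul, Matrix.mul_one]),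
    finrank_skewForm_eq_card (good := fun _ _ _ => True) (by simp), card_stringPairs]
  have := two_mul_sum_lt (fun _ _ : Fin m => 1) fun _ _ => rfl
  simpa using this

/-- Stabilizers as skew matrices commuting with two symmetric matrices. -/
theorem finrank_stabSpace {t : ℕ} {n : ℕ → ℕ} (A : RectFam t n) :
    Module.finrank ℂ (stabSpace A) =
      ∑ i, Module.finrank ℂ (skewComm (bigT (A i)) (signMat (n (i + 1)) (n i))) := by
  rw [← Module.finrank_pi_fintype]
  -- Commuting with the sign matrix is the same as being block diagonal; the blocks are the source
  -- and target parts of a stabilizer.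
  have hoff : ∀ {p q : ℕ} {M : Matrix (Fin q ⊕ Fin p) (Fin q ⊕ Fin p) ℂ},
      M * signMat p q = signMat p q * M →
        M = Matrix.fromBlocks M.toBlocks₁₁ 0 0 M.toBlocks₂₂ := by
    intro p q M h
    have hM := Matrix.fromBlocks_toBlocks M
    rw [← hM, signMat, Matrix.fromBlocks_multiply, Matrix.fromBlocks_multiply,
      Matrix.fromBlocks_inj] at h
    simp only [Matrix.mul_zero, Matrix.mul_neg, Matrix.mul_one, Matrix.one_mul, Matrix.zero_mul,
      add_zero, zero_add, Matrix.neg_mul] at h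
    conv_lhs => rw [← hM]
    have hz : ∀ {a b : ℕ} {X : Matrix (Fin a) (Fin b) ℂ}, X = -X → X = 0 := fun {a b X} hX => by
      ext i j
      exact self_eq_neg.mp (congrFun (congrFun hX i) j)
    rw [hz h.2.1.symm, hz h.2.2.1]
  refine LinearEquiv.finrank_eq
    { toFun := fun w i => ⟨Matrix.fromBlocks (w.1.1 i) 0 0 (w.1.2 i), ?_, ?_, ?_⟩
      invFun := fun M => ⟨(fun i => (M i).1.toBlocks₁₁, fun i => (M i).1.toBlocks₂₂),
        fun i => ?_, fun i => ?_, fun i => ?_⟩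
      map_add' := fun w w' => ?_
      map_smul' := fun c w => ?_
      left_inv := fun w => ?_
      right_inv := fun M => ?_ }
  · rw [Matrix.fromBlocks_transpose, Matrix.fromBlocks_neg, w.2.1 i, w.2.2.1 i]; simp
  · rw [bigT, Matrix.fromBlocks_multiply, Matrix.fromBlocks_multiply]
    simp [w.2.2.2 i, stab_transpose w.2 i]
  · rw [signMat, Matrix.fromBlocks_multiply, Matrix.fromBlocks_multiply]; simp
  · funext i
    refine Subtype.ext ?_
    simp [Matrix.fromBlocks_add]
  · funext i
    refine Subtype.ext ?_
    simp [Matrix.fromBlocks_smul]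
  · have h := (M i).2.1
    rw [hoff (M i).2.2.2, Matrix.fromBlocks_transpose, Matrix.fromBlocks_neg,
      Matrix.fromBlocks_inj] at h
    exact h.1
  · have h := (M i).2.1
    rw [hoff (M i).2.2.2, Matrix.fromBlocks_transpose, Matrix.fromBlocks_neg,
      Matrix.fromBlocks_inj] at h
    exact h.2.2.2
  · have h : (M i).1 * bigT (A i) = bigT (A i) * (M i).1 := (M i).2.2.1
    unfold bigT at h
    rw [hoff (M i).2.2.2, Matrix.fromBlocks_multiply, Matrix.fromBlocks_multiply,
      Matrix.fromBlocks_inj] at h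
    simpa using h.2.2.1
  · exact Subtype.ext (Prod.ext (funext fun i => by simp) (funext fun i => by simp))
  · funext i
    exact Subtype.ext (hoff (M i).2.2.2).symm

theorem finrank_paramSpace {t : ℕ} {n : ℕ → ℕ} (A : RectFam t n) :
    Module.finrank ℂ (paramSpace A) =
      ∑ i : Fin t, Module.finrank ℂ (skewComm (0 : Matrix (Fin (n (i + 1))) (Fin (n (i + 1))) ℂ) 1)
        + ∑ i, Module.finrank ℂ (skewComm (moment A i) 1) := by
  rw [← Module.finrank_pi_fintype, ← Module.finrank_pi_fintype, ← Module.finrank_prod]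
  exact LinearEquiv.finrank_eq
    { toFun := fun w => (fun i => ⟨w.1.1 i, w.2.1 i, by simp, by simp⟩,
        fun i => ⟨w.1.2 i, w.2.2.1 i, w.2.2.2 i, by simp⟩)
      invFun := fun M => ⟨(fun i => (M.1 i).1, fun i => (M.2 i).1),
        fun i => (M.1 i).2.1, fun i => (M.2 i).2.1, fun i => (M.2 i).2.2.1⟩
      map_add' := fun w w' => rfl
      map_smul' := fun c w => rfl
      left_inv := fun w => rfl
      right_inv := fun M => rfl }

end Counts

end

section

/-! ### Sums over the rows of a diagram -/

section RowSums

/-- The sum of a function over the strings of a diagram. -/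
def rowSum (δ : ABDiagram) (f : ABString → ℤ) : ℤ := (δ.map f).sum

variable {δ : ABDiagram} {f g : ABString → ℤ}

@[simp] theorem rowSum_empty (f : ABString → ℤ) : rowSum 0 f = 0 := rfl

theorem rowSum_congr (h : ∀ r ∈ δ, f r = g r) : rowSum δ f = rowSum δ g :=
  congrArg Multiset.sum (Multiset.map_congr rfl h)

theorem rowSum_le (h : ∀ r ∈ δ, f r ≤ g r) : rowSum δ f ≤ rowSum δ g :=
  Multiset.sum_map_le_sum_map f g h

theorem rowSum_add (δ : ABDiagram) (f g : ABString → ℤ) :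
    rowSum δ (fun r => f r + g r) = rowSum δ f + rowSum δ g := Multiset.sum_map_add

theorem rowSum_sub (δ : ABDiagram) (f g : ABString → ℤ) :
    rowSum δ (fun r => f r - g r) = rowSum δ f - rowSum δ g := Multiset.sum_map_sub

theorem rowSum_mul_left (δ : ABDiagram) (c : ℤ) (f : ABString → ℤ) :
    rowSum δ (fun r => c * f r) = c * rowSum δ f := Multiset.sum_map_mul_left

theorem rowSum_mul_right (δ : ABDiagram) (c : ℤ) (f : ABString → ℤ) :
    rowSum δ (fun r => f r * c) = rowSum δ f * c := Multiset.sum_map_mul_right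

theorem rowSum_zero (δ : ABDiagram) : rowSum δ (fun _ => 0) = 0 := Multiset.sum_map_zero

theorem rowSum_comm (δ δ' : ABDiagram) (g : ABString → ABString → ℤ) :
    rowSum δ (fun r => rowSum δ' fun r' => g r r') =
      rowSum δ' fun r' => rowSum δ fun r => g r r' := Multiset.sum_map_sum_map δ δ'

theorem rowSum_finsetSum {ι : Type*} (s : Finset ι) (δ : ABDiagram) (F : ι → ABString → ℤ) :
    rowSum δ (fun r => ∑ i ∈ s, F i r) = ∑ i ∈ s, rowSum δ (F i) :=
  Multiset.sum_map_sum_map δ s.val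

theorem rowSum_nonneg (h : ∀ r ∈ δ, 0 ≤ f r) : 0 ≤ rowSum δ f := by
  rw [← rowSum_zero δ]
  exact rowSum_le h

theorem eq_zero_of_rowSum_eq_zero (h : ∀ r ∈ δ, 0 ≤ f r) (h0 : rowSum δ f ≤ 0) {r : ABString}
    (hr : r ∈ δ) : f r = 0 := by
  refine le_antisymm (le_trans ?_ h0) (h r hr)
  refine Multiset.single_le_sum (fun x hx => ?_) _ (Multiset.mem_map_of_mem f hr)
  obtain ⟨r', hr', rfl⟩ := Multiset.mem_map.mp hx
  exact h r' hr'

theorem rowSum_eq_sum {k : ℕ} {row : Fin k → ABString} (h : Multiset.map row Finset.univ.val = δ)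
    (f : ABString → ℤ) : rowSum δ f = ∑ i, f (row i) := by
  rw [← h, rowSum, Multiset.map_map]
  rfl

/-- The sum of a function over the ordered pairs of strings of a diagram. -/
def rowSum₂ (δ : ABDiagram) (g : ABString → ABString → ℤ) : ℤ := rowSum δ fun r => rowSum δ (g r)

@[simp] theorem rowSum₂_empty (g : ABString → ABString → ℤ) : rowSum₂ 0 g = 0 := rfl

theorem rowSum₂_congr {g g' : ABString → ABString → ℤ} (h : ∀ r ∈ δ, ∀ r' ∈ δ, g r r' = g' r r') :
    rowSum₂ δ g = rowSum₂ δ g' := rowSum_congr fun r hr => rowSum_congr (h r hr)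

theorem rowSum₂_le {g g' : ABString → ABString → ℤ} (h : ∀ r ∈ δ, ∀ r' ∈ δ, g r r' ≤ g' r r') :
    rowSum₂ δ g ≤ rowSum₂ δ g' := rowSum_le fun r hr => rowSum_le (h r hr)

theorem rowSum₂_add (δ : ABDiagram) (g g' : ABString → ABString → ℤ) :
    rowSum₂ δ (fun r r' => g r r' + g' r r') = rowSum₂ δ g + rowSum₂ δ g' := by
  simp only [rowSum₂, rowSum_add]

theorem rowSum₂_mul (δ : ABDiagram) (f g : ABString → ℤ) :
    rowSum₂ δ (fun r r' => f r * g r') = rowSum δ f * rowSum δ g := by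
  simp only [rowSum₂, rowSum_mul_left, rowSum_mul_right]

theorem rowSum₂_eq_sum {k : ℕ} {row : Fin k → ABString}
    (h : Multiset.map row Finset.univ.val = δ) (g : ABString → ABString → ℤ) :
    rowSum₂ δ g = ∑ i, ∑ i', g (row i) (row i') := by
  simp only [rowSum₂, rowSum_eq_sum h]

end RowSums

/-! ### Numbers attached to a string -/

namespace ABString

variable (r r' : ABString)

/-- The number of letters `a`, as an integer. -/
def pa : ℤ := r.num .a 0

/-- The number of letters `b`, as an integer. -/
def pb : ℤ := r.num .b 0

/-- Odd strings beginning with `a`. -/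
def IsDown : Prop := r.first = .a ∧ r.len % 2 = 1

/-- Odd strings beginning with `b`. -/
def IsUp : Prop := r.first = .b ∧ r.len % 2 = 1

instance : Decidable r.IsDown := inferInstanceAs (Decidable (_ ∧ _))

instance : Decidable r.IsUp := inferInstanceAs (Decidable (_ ∧ _))

theorem cases_type : (∃ h, r.first = .a ∧ r.len = 2 * h + 1) ∨ (∃ h, r.first = .b ∧ r.len = 2 * h + 1)
    ∨ (∃ h, r.first = .a ∧ r.len = 2 * (h + 1)) ∨ (∃ h, r.first = .b ∧ r.len = 2 * (h + 1)) := by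
  have hpos := r.len_pos
  rcases r.first.eq_a_or_eq_b with hf | hf <;> rcases Nat.even_or_odd' r.len with ⟨c, hc | hc⟩
  · exact Or.inr (Or.inr (Or.inl ⟨c - 1, hf, by omega⟩))
  · exact Or.inl ⟨c, hf, hc⟩
  · exact Or.inr (Or.inr (Or.inr ⟨c - 1, hf, by omega⟩))
  · exact Or.inr (Or.inl ⟨c, hf, hc⟩)

/-- Pairs of odd strings of the same length with different first letters. -/
def opp : ℤ := if r.IsDown ∧ r'.IsUp ∧ r.len = r'.len ∨ r.IsUp ∧ r'.IsDown ∧ r.len = r'.len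
  then 1 else 0

/-- The excess of letters `a` over letters `b` followed by at least `2 h + 1` letters. -/
def excess (h : ℕ) : ℤ := (r.num .a (2 * h + 1) : ℤ) - r.num .b (2 * h + 1)

/-- The right side is arranged so that it sums well over a diagram: the minima depend only on the
two partitions, the product of differences only on dimensions, and the `excess` terms sum to 0 by
`StringBasis.sum_num_odd`. Only `opp` remains as information about the individual strings. -/
theorem two_mul_pairNum : 2 * (pairNum r r' : ℤ) = min r.pa r'.pa + min r.pb r'.pb +
    (r.pa - r.pb) * (r'.pa - r'.pb) + r.opp r' + (r.pa - r.pb) * r'.excess (r.len / 2) +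
    r.excess (r'.len / 2) * (r'.pa - r'.pb) := by
  have e1 : ∀ h : ℕ, 2 * h / 2 = h := fun h => by omega
  have e2 : ∀ h : ℕ, (2 * h + 1) / 2 = h := fun h => by omega
  have e3 : ∀ h : ℕ, 2 * h % 2 = 0 := fun h => by omega
  have e4 : ∀ h : ℕ, (2 * h + 1) % 2 = 1 := fun h => by omega
  have e5 : ∀ h : ℕ, (2 * h + 1 + 1) / 2 = h + 1 := fun h => by omega
  have x1 : ∀ h k : ℕ, (((2 * h + 1 - (2 * k + 1) + 1) / 2 : ℕ) : ℤ)
      = ((2 * h + 1 - (2 * k + 1)) / 2 : ℕ) := fun h k => by omega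
  rcases r.cases_type with ⟨h, hf, hl⟩ | ⟨h, hf, hl⟩ | ⟨h, hf, hl⟩ | ⟨h, hf, hl⟩ <;>
  rcases r'.cases_type with ⟨h', hf', hl'⟩ | ⟨h', hf', hl'⟩ | ⟨h', hf', hl'⟩ | ⟨h', hf', hl'⟩ <;>
  simp only [pairNum, pa, pb, opp, excess, num, IsDown, IsUp, hf, hl, hf', hl', if_true,
    reduceCtorEq, if_false, true_and, false_and, and_false, or_false, false_or, and_true, e1, e2,
    e3, e4, e5, Nat.sub_zero, zero_ne_one, x1, sub_self, mul_zero, zero_mul, add_zero] <;>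
  push_cast <;> ring_nf <;> (try split_ifs) <;> omega

end ABString

end

section

/-! ### Numerical constraints on the diagrams of a stratum -/

section Admissible

theorem sum_sub_add_sum_sub (M : Multiset ℕ) (k : ℕ) :
    (M.map fun x => x - k).sum + (M.map fun x => x - (k + 2)).sum =
      2 * (M.map fun x => x - (k + 1)).sum + M.count (k + 1) := by
  induction M using Multiset.induction with
  | empty => simp
  | cons a M ih =>
    simp only [Multiset.map_cons, Multiset.sum_cons, Multiset.count_cons]
    split_ifs <;> omega

/-- The second differences of k ↦ ∑ (x - k) are the multiplicities of the positive values. Zeros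
remain invisible, which is why f 0 = 0 is required. -/
theorem sum_map_eq_of_sum_sub_eq {M N : Multiset ℕ}
    (h : ∀ k, (M.map fun x => x - k).sum = (N.map fun x => x - k).sum) {f : ℕ → ℤ}
    (hf : f 0 = 0) : (M.map f).sum = (N.map f).sum := by
  have hc : ∀ k, M.count (k + 1) = N.count (k + 1) := fun k => by
    have h1 := sum_sub_add_sum_sub M k
    have h2 := sum_sub_add_sum_sub N k
    rw [h k, h (k + 1), h (k + 2)] at h1
    omega
  have hfil : M.filter (· ≠ 0) = N.filter (· ≠ 0) := by
    ext k
    rw [Multiset.count_filter, Multiset.count_filter]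
    cases k with
    | zero => simp
    | succ k => simp [hc k]
  have key : ∀ L : Multiset ℕ, (L.map f).sum = ((L.filter (· ≠ 0)).map f).sum := by
    intro L
    induction L using Multiset.induction with
    | empty => simp
    | cons a L ih =>
      by_cases ha : a = 0
      · simp [ha, hf, ih]
      · simp [ha, ih]
  rw [key M, key N, hfil]

/-- The constraints satisfied by the diagrams `T 0, T 1, …` of a point of `Z`. -/
structure Admissible (n : ℕ → ℕ) (T : ℕ → ABDiagram) : Prop where
  sum_pa : ∀ i, rowSum (T i) ABString.pa = n i
  sum_pb : ∀ i, rowSum (T i) ABString.pb = n (i + 1)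
  sum_excess : ∀ i k, rowSum (T i) (fun r => r.excess k) = 0
  sum_sub : ∀ i k, rowSum (T i) (fun r => ((r.num .b 0 - k : ℕ) : ℤ)) =
    rowSum (T (i + 1)) fun r => ((r.num .a 0 - k : ℕ) : ℤ)

variable {n : ℕ → ℕ} {T : ℕ → ABDiagram}

theorem rowSum_natCast (δ : ABDiagram) (φ : ABString → ℕ) :
    rowSum δ (fun r => (φ r : ℤ)) = ((δ.map φ).sum : ℕ) := by
  rw [rowSum, Nat.cast_multiset_sum, Multiset.map_map]
  rfl

/-- A_i A_iᵀ and A_{i+1}ᵀ A_{i+1} are the same nilpotent matrix, so the b-counts of one diagram and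
the a-counts of the next agree as multisets up to zeros. All telescoping rests on this. -/
theorem Admissible.transfer (h : Admissible n T) (i : ℕ) {f : ℤ → ℤ} (hf : f 0 = 0) :
    rowSum (T i) (fun r => f r.pb) = rowSum (T (i + 1)) fun r => f r.pa := by
  have h1 := sum_map_eq_of_sum_sub_eq (M := (T i).map fun r => r.num .b 0)
    (N := (T (i + 1)).map fun r => r.num .a 0) (f := fun m => f m) (fun k => by
      have := h.sum_sub i k
      rw [rowSum_natCast, rowSum_natCast] at this
      rw [Multiset.map_map, Multiset.map_map]
      exact_mod_cast this) (by simpa using hf)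
  rw [Multiset.map_map, Multiset.map_map] at h1
  exact h1

theorem Admissible.transfer_min (h : Admissible n T) (i : ℕ) :
    rowSum₂ (T i) (fun r r' => min r.pb r'.pb) =
      rowSum₂ (T (i + 1)) fun r r' => min r.pa r'.pa := by
  have h1 : ∀ r : ABString, rowSum (T i) (fun r' => min r.pb r'.pb) =
      rowSum (T (i + 1)) fun r' => min r.pb r'.pa := fun r =>
    h.transfer i (f := fun x => min r.pb x) (min_eq_right (Nat.cast_nonneg _))
  simp only [rowSum₂, h1]
  refine (rowSum_comm _ _ _).trans (Eq.trans (rowSum_congr fun r' _ => ?_) (rowSum_comm _ _ _))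
  exact h.transfer i (f := fun x => min x r'.pa) (min_eq_left (Nat.cast_nonneg _))

/-- Four times the dimension of a stratum, up to the constant determined by `n`. -/
theorem Admissible.two_mul_rowSum₂_pairNum (h : Admissible n T) (i : ℕ) :
    2 * rowSum₂ (T i) (fun r r' => (pairNum r r' : ℤ)) =
      rowSum₂ (T i) (fun r r' => min r.pa r'.pa) + rowSum₂ (T (i + 1)) (fun r r' => min r.pa r'.pa)
      + ((n i : ℤ) - n (i + 1)) ^ 2 + rowSum₂ (T i) ABString.opp := by
  have h1 : 2 * rowSum₂ (T i) (fun r r' => (pairNum r r' : ℤ)) =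
      rowSum₂ (T i) fun r r' => 2 * (pairNum r r' : ℤ) := by
    simp only [rowSum₂, rowSum_mul_left]
  have h2 : rowSum₂ (T i) (fun r r' => (r.pa - r.pb) * r'.excess (r.len / 2)) = 0 := by
    simp only [rowSum₂, rowSum_mul_left, h.sum_excess, mul_zero, rowSum_zero]
  have h3 : rowSum₂ (T i) (fun r r' => r.excess (r'.len / 2) * (r'.pa - r'.pb)) = 0 := by
    rw [rowSum₂, rowSum_comm]
    simp only [rowSum_mul_right, h.sum_excess, zero_mul, rowSum_zero]
  have h4 : rowSum (T i) (fun r => r.pa - r.pb) = (n i : ℤ) - n (i + 1) := by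
    rw [rowSum_sub]
    exact congrArg₂ _ (h.sum_pa i) (h.sum_pb i)
  rw [h1, rowSum₂_congr fun r _ r' _ => ABString.two_mul_pairNum r r', rowSum₂_add, rowSum₂_add,
    rowSum₂_add, rowSum₂_add, rowSum₂_add, h2, h3, rowSum₂_mul, h4,
    h.transfer_min i]
  ring

end Admissible

/-! ### The dimension of a stratum in terms of its diagrams -/

section DimFormula

variable {t : ℕ} {n : ℕ → ℕ}

/-- A finite sequence of diagrams, continued by empty diagrams. -/
def extendDiag (τ : Fin t → ABDiagram) (i : ℕ) : ABDiagram := if h : i < t then τ ⟨i, h⟩ else 0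

@[simp] theorem extendDiag_fin (τ : Fin t → ABDiagram) (i : Fin t) : extendDiag τ i = τ i :=
  dif_pos i.2

theorem extendDiag_of_le (τ : Fin t → ABDiagram) {i : ℕ} (h : t ≤ i) : extendDiag τ i = 0 :=
  dif_neg h.not_gt

theorem StringBasis.sum_pa_eq {p q : ℕ} {A : Matrix (Fin p) (Fin q) ℂ} {δ : ABDiagram}
    (S : StringBasis A δ) : rowSum δ ABString.pa = q := by
  rw [rowSum_eq_sum S.map_row]
  have := S.rank_transpose_mul_pow 0
  simp only [pow_zero, Matrix.rank_one, Fintype.card_fin, Nat.sub_zero] at this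
  refine Eq.trans ?_ (congrArg (Nat.cast : ℕ → ℤ) this).symm
  push_cast
  rfl

theorem StringBasis.sum_pb_eq {p q : ℕ} {A : Matrix (Fin p) (Fin q) ℂ} {δ : ABDiagram}
    (S : StringBasis A δ) : rowSum δ ABString.pb = p := by
  rw [rowSum_eq_sum S.map_row]
  have := S.rank_mul_transpose_pow 0
  simp only [pow_zero, Matrix.rank_one, Fintype.card_fin, Nat.sub_zero] at this
  refine Eq.trans ?_ (congrArg (Nat.cast : ℕ → ℤ) this).symm
  push_cast
  rfl

open Matrix in
theorem admissible_of_mem_matStratum (hn : ∀ i, t ≤ i → n i = 0) {τ : Fin t → ABDiagram}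
    {A : RectFam t n} (hA : A ∈ matStratum n τ) : Admissible n (extendDiag τ) := by
  have S : ∀ i, StringBasis (A i) (τ i) := fun i => (exists_stringBasis (hA.2 i)).some
  refine ⟨fun i => ?_, fun i => ?_, fun i k => ?_, fun i k => ?_⟩
  · by_cases h : i < t
    · exact (congrArg (rowSum · _) (extendDiag_fin τ ⟨i, h⟩)).trans (S ⟨i, h⟩).sum_pa_eq
    · simp [extendDiag_of_le τ (not_lt.mp h), hn i (not_lt.mp h)]
  · by_cases h : i < t
    · exact (congrArg (rowSum · _) (extendDiag_fin τ ⟨i, h⟩)).trans (S ⟨i, h⟩).sum_pb_eq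
    · simp [extendDiag_of_le τ (not_lt.mp h), hn (i + 1) (by omega)]
  · by_cases h : i < t
    · refine (congrArg (rowSum · _) (extendDiag_fin τ ⟨i, h⟩)).trans ?_
      rw [rowSum_eq_sum (S ⟨i, h⟩).map_row]
      simp only [ABString.excess, Finset.sum_sub_distrib]
      rw [sub_eq_zero]
      exact_mod_cast (S ⟨i, h⟩).sum_num_odd k
    · simp [extendDiag_of_le τ (not_lt.mp h)]
  · by_cases h : i + 1 < t
    · have hi : i < t := by omega
      rw [show extendDiag τ i = τ ⟨i, hi⟩ from dif_pos hi,
        show extendDiag τ (i + 1) = τ ⟨i + 1, h⟩ from dif_pos h,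
        rowSum_eq_sum (S ⟨i, hi⟩).map_row, rowSum_eq_sum (S ⟨i + 1, h⟩).map_row]
      have h1 := (S ⟨i, hi⟩).rank_mul_transpose_pow k
      have h2 := (S ⟨i + 1, h⟩).rank_transpose_mul_pow k
      rw [← hA.1 i h, h1] at h2
      exact_mod_cast h2
    · rw [extendDiag_of_le τ (not_lt.mp h), rowSum_empty]
      by_cases hi : i < t
      · have h1 : rowSum (extendDiag τ i) ABString.pb = 0 := by
          refine (congrArg (rowSum · _) (extendDiag_fin τ ⟨i, hi⟩)).trans ?_
          rw [(S ⟨i, hi⟩).sum_pb_eq, hn (i + 1) (by omega), Nat.cast_zero]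
        refine (rowSum_congr fun r hr => ?_).trans (rowSum_zero _)
        have h2 := eq_zero_of_rowSum_eq_zero (fun r _ => Nat.cast_nonneg _) h1.le hr
        simp only [Nat.cast_eq_zero] at h2
        rw [h2, Nat.zero_sub, Nat.cast_zero]
      · rw [extendDiag_of_le τ (not_lt.mp hi), rowSum_empty]

open Matrix in
/-- The dimension count on a stratum. -/
theorem four_mul_finrank_sub (hn : ∀ i, t ≤ i → n i = 0) {τ : Fin t → ABDiagram}
    {A : RectFam t n} (hA : A ∈ matStratum n τ) :
    4 * ((Module.finrank ℂ (paramSpace A) : ℤ) - Module.finrank ℂ (stabSpace A)) =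
      (∑ i ∈ Finset.range t, (2 * ((n (i + 1) : ℤ) ^ 2 - n (i + 1)) - 2 * n i
        - ((n i : ℤ) - n (i + 1)) ^ 2 + n i + n (i + 1)) + 2 * (n 0 : ℤ) ^ 2)
      - rowSum₂ (extendDiag τ 0) (fun r r' => min r.pa r'.pa)
      + ∑ i ∈ Finset.range t, (rowSum (extendDiag τ i) (fun r => r.len % 2)
        - rowSum₂ (extendDiag τ i) ABString.opp) := by
  have S : ∀ i, StringBasis (A i) (τ i) := fun i => (exists_stringBasis (hA.2 i)).some
  have hadm := admissible_of_mem_matStratum hn hA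
  set f : ℕ → ℤ := fun i => rowSum₂ (extendDiag τ i) fun r r' => min r.pa r'.pa with hf
  have h1 : ∀ i : Fin t, 2 * (Module.finrank ℂ (skewComm
      (0 : Matrix (Fin (n (i + 1))) (Fin (n (i + 1))) ℂ) 1) : ℤ) =
      (n (i + 1) : ℤ) ^ 2 - n (i + 1) := fun i => by
    have := two_mul_finrank_skewComm_zero (n (i + 1))
    zify at this
    linarith
  -- At the first source the moment is 0 instead of A_0ᵀ A_0, so all skew matrices count; the
  -- conditional term corrects the uniform formula there.
  have h2 : ∀ i : Fin t, 2 * (Module.finrank ℂ (skewComm (moment A i) 1) : ℤ) =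
      f i - n i + if (i : ℕ) = 0 then (n 0 : ℤ) ^ 2 - f 0 else 0 := by
    rintro ⟨i, hi⟩
    cases i with
    | zero =>
      have := two_mul_finrank_skewComm_zero (n 0)
      zify at this
      have hm : moment A ⟨0, hi⟩ = 0 := rfl
      rw [hm]
      simp only [if_true]
      linarith
    | succ j =>
      have h := (S ⟨j + 1, hi⟩).two_mul_finrank_skewComm_transpose_mul
      have hm : moment A ⟨j + 1, hi⟩ = (A ⟨j + 1, hi⟩)ᵀ * A ⟨j + 1, hi⟩ := hA.1 j hi
      rw [hm]
      zify at h
      have e1 := rowSum_eq_sum (S ⟨j + 1, hi⟩).map_row ABString.pa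
      rw [(S ⟨j + 1, hi⟩).sum_pa_eq] at e1
      have e2 : f (j + 1) = _ := (congrArg (rowSum₂ · _) (extendDiag_fin τ ⟨j + 1, hi⟩)).trans
        (rowSum₂_eq_sum (S ⟨j + 1, hi⟩).map_row fun r r' => min r.pa r'.pa)
      have e3 : ∑ i, ABString.pa ((S ⟨j + 1, hi⟩).row i) =
        ∑ i, (((S ⟨j + 1, hi⟩).row i).num .a 0 : ℤ) := rfl
      have e4 : (∑ i, ∑ i', min ((S ⟨j + 1, hi⟩).row i).pa ((S ⟨j + 1, hi⟩).row i').pa) =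
        ∑ i, ∑ i', min (((S ⟨j + 1, hi⟩).row i).num .a 0 : ℤ) (((S ⟨j + 1, hi⟩).row i').num .a 0 : ℤ)
        := rfl
      rw [e3] at e1
      rw [e4] at e2
      simp only [Nat.succ_ne_zero, if_false, add_zero]
      rw [e2, e1]
      push_cast at h ⊢
      linarith
  have h3 : ∀ i : Fin t, 4 * (Module.finrank ℂ (skewComm (bigT (A i)) (signMat (n (i + 1)) (n i))) : ℤ) =
      f i + f (i + 1) + ((n i : ℤ) - n (i + 1)) ^ 2 + rowSum₂ (extendDiag τ i) ABString.opp
      - n i - n (i + 1) - rowSum (extendDiag τ i) (fun r => r.len % 2) := fun i => by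
    have h := (S i).two_mul_finrank_skewComm
    zify at h
    have e1 := hadm.two_mul_rowSum₂_pairNum i
    have e2 : rowSum₂ (extendDiag τ i) (fun r r' => (pairNum r r' : ℤ)) = _ :=
      (congrArg (rowSum₂ · _) (extendDiag_fin τ i)).trans (rowSum₂_eq_sum (S i).map_row _)
    have e3 : rowSum (extendDiag τ i) (fun r => (pairNum r r : ℤ)) = _ :=
      (congrArg (rowSum · _) (extendDiag_fin τ i)).trans (rowSum_eq_sum (S i).map_row _)
    -- A string paired with itself contributes half its length rounded up; this rounding is the
    -- source of the odd strings in the dimension formula.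
    have e4 : 2 * rowSum (extendDiag τ i) (fun r => (pairNum r r : ℤ)) =
        n i + n (i + 1) + rowSum (extendDiag τ i) (fun r => r.len % 2) := by
      rw [← hadm.sum_pa, ← hadm.sum_pb, ← rowSum_add, ← rowSum_add, ← rowSum_mul_left]
      refine rowSum_congr fun r _ => ?_
      simp only [pairNum, ABString.pa, ABString.pb, ABString.num, if_true, min_self]
      rcases r.first.eq_a_or_eq_b with hl | hl <;> simp [hl] <;> omega
    rw [e2] at e1
    rw [e3] at e4
    linarith
  rw [finrank_paramSpace, finrank_stabSpace]
  push_cast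
  rw [mul_sub, mul_add, Finset.mul_sum, Finset.mul_sum, Finset.mul_sum]
  simp_rw [show (4 : ℤ) = 2 * 2 by norm_num] at h3 ⊢
  simp_rw [h3, mul_assoc, h1, h2]
  rw [Fin.sum_univ_eq_sum_range (fun i => 2 * ((n (i + 1) : ℤ) ^ 2 - n (i + 1))),
    Fin.sum_univ_eq_sum_range (fun i => 2 * (f i - n i + if i = 0 then (n 0 : ℤ) ^ 2 - f 0 else 0)),
    Fin.sum_univ_eq_sum_range (fun i => f i + f (i + 1) + ((n i : ℤ) - n (i + 1)) ^ 2 +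
      rowSum₂ (extendDiag τ i) ABString.opp - n i - n (i + 1)
      - rowSum (extendDiag τ i) (fun r => r.len % 2))]
  have hft : f t = 0 := by simp [hf, extendDiag_of_le τ le_rfl]
  have htel : ∑ i ∈ Finset.range t, f (i + 1) = ∑ i ∈ Finset.range t, f i - f 0 := by
    have := Finset.sum_range_sub f t
    rw [Finset.sum_sub_distrib, hft] at this
    linarith
  have hite : ∑ i ∈ Finset.range t, (if i = 0 then (n 0 : ℤ) ^ 2 - f 0 else 0) =
      (n 0 : ℤ) ^ 2 - f 0 := by
    rcases Nat.eq_zero_or_pos t with rfl | ht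
    · simp [hn 0 le_rfl, hft]
    · rw [Finset.sum_ite_eq' (Finset.range t) 0, if_pos (Finset.mem_range.mpr ht)]
  simp only [Finset.sum_add_distrib, Finset.sum_sub_distrib, ← Finset.mul_sum, htel, hite]
  ring

end DimFormula

end

section

/-! ### Sums over the boxes of a Young diagram -/

section Boxes

variable {μ : YoungDiagram}

theorem sum_cells_eq_sum_cols (μ : YoungDiagram) {N : ℕ} (hN : μ.rowLen 0 ≤ N) (f : ℕ × ℕ → ℤ) :
    ∑ B ∈ μ.cells, f B = ∑ k ∈ Finset.range N, ∑ j ∈ Finset.range (μ.colLen k), f (j, k) := by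
  refine Finset.sum_finset_product_right μ.cells (Finset.range N)
    (fun k => Finset.range (μ.colLen k)) fun B => ?_
  obtain ⟨i, j⟩ := B
  rw [YoungDiagram.mem_cells, Finset.mem_range, Finset.mem_range, YoungDiagram.mem_iff_lt_colLen]
  refine ⟨fun h => ⟨?_, h⟩, fun h => h.2⟩
  have h1 : (0, j) ∈ μ := μ.up_left_mem (Nat.zero_le _) le_rfl (YoungDiagram.mem_iff_lt_colLen.mpr h)
  exact (YoungDiagram.mem_iff_lt_rowLen.mp h1).trans_le hN

/-- The indicator of the strings with more than `k` letters `a`. -/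
def ABString.ind (k : ℕ) (r : ABString) : ℤ := if (k : ℤ) < r.pa then 1 else 0

theorem colLen_eq_zero {k : ℕ} (h : μ.rowLen 0 ≤ k) : μ.colLen k = 0 := by
  by_contra hne
  have h1 : (0, k) ∈ μ := YoungDiagram.mem_iff_lt_colLen.mpr (Nat.pos_of_ne_zero hne)
  exact absurd (YoungDiagram.mem_iff_lt_rowLen.mp h1) (by omega)

variable {δ : ABDiagram}

theorem pa_le_of_ind (h : ∀ k, rowSum δ (ABString.ind k) = μ.colLen k) {r : ABString} (hr : r ∈ δ) :
    r.pa ≤ μ.rowLen 0 := by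
  have h0 := h (μ.rowLen 0)
  rw [colLen_eq_zero le_rfl, Nat.cast_zero] at h0
  have := eq_zero_of_rowSum_eq_zero (fun r _ => by unfold ABString.ind; split_ifs <;> simp) h0.le hr
  unfold ABString.ind at this
  split_ifs at this with h1
  · exact absurd this one_ne_zero
  · exact not_lt.mp h1

theorem sum_range_indicator (f : ℕ → ℤ) (N : ℕ) {x : ℤ} (h0 : 0 ≤ x) (hx : x ≤ N) :
    ∑ k ∈ Finset.range N, (if (k : ℤ) < x then f k else 0) = ∑ k ∈ Finset.range x.toNat, f k := by
  rw [← Finset.sum_filter]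
  congr 1
  ext k
  simp only [Finset.mem_filter, Finset.mem_range]
  omega

theorem sum_range_succ_toNat {x : ℤ} (h0 : 0 ≤ x) :
    2 * ∑ k ∈ Finset.range x.toNat, ((k : ℤ) + 1) = x * (x + 1) := by
  lift x to ℕ using h0
  rw [Int.toNat_natCast]
  induction x with
  | zero => simp
  | succ m ih =>
    rw [Finset.sum_range_succ, mul_add, ih]
    push_cast
    ring

theorem pa_nonneg (r : ABString) : 0 ≤ r.pa := Nat.cast_nonneg _

/-- A row of length p contributes 1 + 2 + … + p = p(p+1)/2, and the hypothesis says that the rows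
are the a-counts of the strings. -/
theorem two_mul_sum_col (h : ∀ k, rowSum δ (ABString.ind k) = μ.colLen k) :
    2 * ∑ B ∈ μ.cells, ((B.2 : ℤ) + 1) = rowSum δ fun r => r.pa * (r.pa + 1) := by
  rw [sum_cells_eq_sum_cols μ le_rfl]
  have h1 : ∀ k, ∑ j ∈ Finset.range (μ.colLen k), ((k : ℤ) + 1) =
      rowSum δ fun r => if (k : ℤ) < r.pa then (k : ℤ) + 1 else 0 := fun k => by
    rw [Finset.sum_const, Finset.card_range, nsmul_eq_mul, ← h, ← rowSum_mul_right]
    exact rowSum_congr fun r _ => by unfold ABString.ind; split_ifs <;> simp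
  rw [Finset.sum_congr rfl fun k _ => h1 k, ← rowSum_finsetSum, ← rowSum_mul_left]
  refine rowSum_congr fun r hr => ?_
  rw [sum_range_indicator (fun k => (k : ℤ) + 1) _ (pa_nonneg r) (pa_le_of_ind h hr),
    sum_range_succ_toNat (pa_nonneg r)]

/-- A column of length m contributes 1 + 3 + … + (2m - 1) = m², the number of ordered pairs of rows
meeting it; two rows share as many columns as the minimum of their lengths. -/
theorem sum_row_eq (h : ∀ k, rowSum δ (ABString.ind k) = μ.colLen k) :
    ∑ B ∈ μ.cells, (2 * (B.1 : ℤ) + 1) = rowSum₂ δ fun r r' => min r.pa r'.pa := by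
  rw [sum_cells_eq_sum_cols μ le_rfl]
  have h0 : ∀ m : ℕ, ∑ j ∈ Finset.range m, (2 * (j : ℤ) + 1) = m * m := fun m => by
    induction m with
    | zero => simp
    | succ m ih =>
      rw [Finset.sum_range_succ, ih]
      push_cast
      ring
  have h1 : ∀ k, ∑ j ∈ Finset.range (μ.colLen k), (2 * (j : ℤ) + 1) =
      rowSum δ fun r => rowSum δ fun r' => r.ind k * r'.ind k := fun k => by
    rw [h0, ← h, ← rowSum₂_mul]
    rfl
  rw [Finset.sum_congr rfl fun k _ => h1 k, ← rowSum_finsetSum]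
  refine rowSum_congr fun r hr => ?_
  rw [← rowSum_finsetSum]
  refine rowSum_congr fun r' hr' => ?_
  have h2 : ∀ k : ℕ, r.ind k * r'.ind k = if (k : ℤ) < min r.pa r'.pa then 1 else 0 := fun k => by
    unfold ABString.ind
    simp only [lt_min_iff]
    split_ifs with h1 h2 h3 <;> simp_all
  have h3 : 0 ≤ min r.pa r'.pa := le_min (pa_nonneg r) (pa_nonneg r')
  rw [Finset.sum_congr rfl fun k _ => h2 k,
    sum_range_indicator (fun _ => (1 : ℤ)) _ h3 ((min_le_left _ _).trans (pa_le_of_ind h hr)),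
    Finset.sum_const, Finset.card_range, nsmul_eq_mul, mul_one, Int.toNat_of_nonneg h3]

theorem two_mul_rDiff {lam mu : YoungDiagram} {δ₀ δ : ABDiagram} (hcard : lam.card = mu.card)
    (h₀ : ∀ k, rowSum δ₀ (ABString.ind k) = lam.colLen k)
    (h : ∀ k, rowSum δ (ABString.ind k) = mu.colLen k) :
    2 * rDiff lam mu = rowSum₂ δ (fun r r' => min r.pa r'.pa) -
      rowSum₂ δ₀ fun r r' => min r.pa r'.pa := by
  have key : ∀ μ : YoungDiagram, 2 * ∑ B ∈ μ.cells, ((B.1 : ℤ) + 1) =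
      ∑ B ∈ μ.cells, (2 * (B.1 : ℤ) + 1) + μ.card := fun μ => by
    rw [Finset.mul_sum, YoungDiagram.card, Finset.cast_card, ← Finset.sum_add_distrib]
    exact Finset.sum_congr rfl fun B _ => by ring
  rw [rDiff, mul_sub, key, key, sum_row_eq h₀, sum_row_eq h, hcard]
  ring

theorem two_mul_cDiff {lam mu : YoungDiagram} {δ₀ δ : ABDiagram}
    (h₀ : ∀ k, rowSum δ₀ (ABString.ind k) = lam.colLen k)
    (h : ∀ k, rowSum δ (ABString.ind k) = mu.colLen k) :
    2 * cDiff lam mu = rowSum δ₀ (fun r => r.pa * (r.pa + 1)) -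
      rowSum δ fun r => r.pa * (r.pa + 1) := by
  rw [cDiff, mul_sub, two_mul_sum_col h₀, two_mul_sum_col h]

theorem dimVec_eq (lam : YoungDiagram) (i : ℕ) :
    dimVec lam i = lam.colLen i + dimVec lam (i + 1) := by
  unfold dimVec
  by_cases h : i < numCols lam
  · exact Finset.sum_eq_sum_Ico_succ_bot h _
  · rw [Finset.Ico_eq_empty (by omega), Finset.Ico_eq_empty (by omega),
      colLen_eq_zero (not_lt.mp h)]
    simp

theorem dimVec_eq_zero (lam : YoungDiagram) {i : ℕ} (h : numCols lam ≤ i) : dimVec lam i = 0 := by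
  unfold dimVec
  rw [Finset.Ico_eq_empty (by omega), Finset.sum_empty]

end Boxes

/-! ### The open stratum -/

section OpenStratum

variable {lam : YoungDiagram} {T : ℕ → ABDiagram}

theorem ABString.pa_sub_pb (r : ABString) :
    r.pa - r.pb = if r.IsDown then 1 else if r.IsUp then -1 else 0 := by
  rcases r.cases_type with ⟨h, hf, hl⟩ | ⟨h, hf, hl⟩ | ⟨h, hf, hl⟩ | ⟨h, hf, hl⟩ <;>
  simp [pa, pb, num, IsDown, IsUp, hf, hl] <;> omega

/-- Each string has pa - pb at most 1, and at most 0 if it has no a; equality with its indicator of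
containing an a holds only for odd strings beginning with a. The sums of both sides equal the column
length, so equality holds throughout. -/
theorem forall_isDown_of_rowSum_ind (h : Admissible (dimVec lam) T) {i : ℕ}
    (hi : rowSum (T i) (ABString.ind 0) = lam.colLen i) {r : ABString} (hr : r ∈ T i) :
    r.IsDown := by
  have h1 : rowSum (T i) (fun r => r.pa - r.pb) = lam.colLen i := by
    rw [rowSum_sub]
    refine (congrArg₂ _ (h.sum_pa i) (h.sum_pb i)).trans ?_
    rw [dimVec_eq]
    push_cast
    ring
  have h2 : rowSum (T i) (fun r => r.ind 0 - (r.pa - r.pb)) = 0 := by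
    rw [rowSum_sub, h1, ← hi, sub_eq_zero]
  have h3 : ∀ r : ABString, 0 ≤ r.ind 0 - (r.pa - r.pb) ∧
      (r.ind 0 - (r.pa - r.pb) = 0 → r.IsDown) := fun r => by
    rcases r.cases_type with ⟨h, hf, hl⟩ | ⟨h, hf, hl⟩ | ⟨h, hf, hl⟩ | ⟨h, hf, hl⟩ <;>
    simp [ABString.ind, ABString.pa, ABString.pb, ABString.num, ABString.IsDown, hf, hl] <;>
    (try split_ifs) <;> omega
  exact (h3 r).2 (eq_zero_of_rowSum_eq_zero (fun r _ => (h3 r).1) h2.le hr)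

theorem ABString.IsDown.pb_eq {r : ABString} (h : r.IsDown) : r.pb = r.pa - 1 := by
  have := r.pa_sub_pb
  rw [if_pos h] at this
  linarith

/-- Since pb = pa - 1 on every string, passing to the next diagram removes the first column of the
partition. -/
theorem rowSum_ind_eq (h : Admissible (dimVec lam) T)
    (h₀ : ∀ k, rowSum (T 0) (ABString.ind k) = lam.colLen k) (i k : ℕ) :
    rowSum (T i) (ABString.ind k) = lam.colLen (i + k) := by
  induction i generalizing k with
  | zero => rw [h₀, zero_add]
  | succ i ih =>
    rw [show i + 1 + k = i + (k + 1) by omega, ← ih]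
    refine (h.transfer i (f := fun x => if (k : ℤ) < x then 1 else 0) (by simp)).symm.trans
      (rowSum_congr fun r hr => ?_)
    have hd := forall_isDown_of_rowSum_ind h (by rw [ih, add_zero]) hr
    unfold ABString.ind
    rw [hd.pb_eq]
    push_cast
    exact if_congr (by omega) rfl rfl

theorem forall_isDown (h : Admissible (dimVec lam) T)
    (h₀ : ∀ k, rowSum (T 0) (ABString.ind k) = lam.colLen k) {i : ℕ} {r : ABString} (hr : r ∈ T i) :
    r.IsDown :=
  forall_isDown_of_rowSum_ind h (by rw [rowSum_ind_eq h h₀, add_zero]) hr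

instance : DecidableEq ABString := fun r r' =>
  decidable_of_iff (r.first = r'.first ∧ r.len = r'.len) ABString.ext_iff.symm

theorem natCast_count_eq (δ : ABDiagram) (r : ABString) :
    (δ.count r : ℤ) = rowSum δ fun r' => if r = r' then 1 else 0 := by
  induction δ using Multiset.induction with
  | empty => simp
  | cons a δ ih =>
    rw [Multiset.count_cons, rowSum, Multiset.map_cons, Multiset.sum_cons, Nat.cast_add, ih, add_comm]
    push_cast
    rfl

/-- The diagrams of the open stratum are determined by the partition. -/
theorem eq_of_rowSum_ind {T' : ℕ → ABDiagram} (h : Admissible (dimVec lam) T)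
    (h' : Admissible (dimVec lam) T') (h₀ : ∀ k, rowSum (T 0) (ABString.ind k) = lam.colLen k)
    (h₀' : ∀ k, rowSum (T' 0) (ABString.ind k) = lam.colLen k) : T = T' := by
  -- The multiplicity of an odd string beginning with a is a difference of consecutive columns of
  -- `lam`, and no other strings occur; thus the multiplicities depend on `lam` alone.
  have key : ∀ {T : ℕ → ABDiagram}, Admissible (dimVec lam) T →
      (∀ k, rowSum (T 0) (ABString.ind k) = lam.colLen k) → ∀ i r, ((T i).count r : ℤ) =
        if r.IsDown then (lam.colLen (i + r.len / 2) : ℤ) - lam.colLen (i + (r.len / 2 + 1)) else 0 := by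
    intro T h h₀ i r
    split_ifs with hr
    · rw [← rowSum_ind_eq h h₀, ← rowSum_ind_eq h h₀, ← rowSum_sub, natCast_count_eq]
      refine rowSum_congr fun r' hr' => ?_
      have hd := forall_isDown h h₀ hr'
      obtain ⟨hf, hl⟩ := hr
      obtain ⟨hf', hl'⟩ := hd
      simp only [ABString.ind, ABString.pa, ABString.num, hf', if_true, ABString.ext_iff, hf, true_and]
      split_ifs <;> omega
    · rw [Nat.cast_eq_zero, Multiset.count_eq_zero]
      exact fun hm => hr (forall_isDown h h₀ hm)
  funext i
  refine Multiset.ext.mpr fun r => ?_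
  have := (key h h₀ i r).trans (key h' h₀' i r).symm
  exact_mod_cast this

end OpenStratum

/-! ### The codimension inequality -/

section Codim

variable {lam : YoungDiagram} {T : ℕ → ABDiagram}

/-- Telescoping of the sum of column numbers. -/
theorem sum_pa_mul_eq {n : ℕ → ℕ} (h : Admissible n T) {t : ℕ} (ht : T t = 0) :
    rowSum (T 0) (fun r => r.pa * (r.pa + 1)) = ∑ i ∈ Finset.range t,
      rowSum (T i) fun r => r.pa * (r.pa + 1) - r.pb * (r.pb + 1) := by
  have h1 : ∀ i, rowSum (T i) (fun r => r.pa * (r.pa + 1) - r.pb * (r.pb + 1)) =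
      rowSum (T i) (fun r => r.pa * (r.pa + 1)) - rowSum (T (i + 1)) fun r => r.pa * (r.pa + 1) :=
    fun i => by
      rw [rowSum_sub]
      exact congrArg _ (h.transfer i (f := fun x => x * (x + 1)) (by simp))
  rw [Finset.sum_congr rfl fun i _ => h1 i,
    Finset.sum_range_sub' (fun i => rowSum (T i) fun r => r.pa * (r.pa + 1)), ht, rowSum_empty,
    sub_zero]

/-- The number of strings satisfying a condition. -/
def rowCount (δ : ABDiagram) (P : ABString → Prop) [DecidablePred P] : ℤ :=
  rowSum δ fun r => if P r then 1 else 0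

theorem rowCount_nonneg (δ : ABDiagram) (P : ABString → Prop) [DecidablePred P] :
    0 ≤ rowCount δ P := rowSum_nonneg fun r _ => by split_ifs <;> simp

/-- Even strings. -/
def evenCount (δ : ABDiagram) : ℤ := rowCount δ fun r => r.len % 2 = 0

/-- Strings consisting of one letter `b`. -/
def singleUp (δ : ABDiagram) : ℤ := rowCount δ fun r => r.IsUp ∧ r.len = 1

/-- Longer odd strings beginning with `b`. -/
def longUp (δ : ABDiagram) : ℤ := rowCount δ fun r => r.IsUp ∧ r.len ≠ 1

/-- Strings consisting of one letter `a`. -/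
def singleDown (δ : ABDiagram) : ℤ := rowCount δ fun r => r.IsDown ∧ r.len = 1

/-- Longer odd strings beginning with `a`. -/
def longDown (δ : ABDiagram) : ℤ := rowCount δ fun r => r.IsDown ∧ r.len ≠ 1

theorem rowSum_pa_sub_pb (δ : ABDiagram) : rowSum δ (fun r => r.pa - r.pb) =
    singleDown δ + longDown δ - singleUp δ - longUp δ := by
  simp only [singleDown, longDown, singleUp, longUp, rowCount, ← rowSum_add, ← rowSum_sub]
  refine rowSum_congr fun r _ => ?_
  rw [r.pa_sub_pb]
  rcases r.cases_type with ⟨h, hf, hl⟩ | ⟨h, hf, hl⟩ | ⟨h, hf, hl⟩ | ⟨h, hf, hl⟩ <;>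
  simp [ABString.IsDown, ABString.IsUp, hf, hl] <;> (try split_ifs) <;> omega

theorem rowSum_ind_pb (δ : ABDiagram) : rowSum δ (fun r => if 0 < r.pb then 1 else 0) =
    longDown δ + singleUp δ + longUp δ + evenCount δ := by
  simp only [evenCount, longDown, singleUp, longUp, rowCount, ← rowSum_add]
  refine rowSum_congr fun r _ => ?_
  rcases r.cases_type with ⟨h, hf, hl⟩ | ⟨h, hf, hl⟩ | ⟨h, hf, hl⟩ | ⟨h, hf, hl⟩ <;>
  simp [ABString.pb, ABString.num, ABString.IsDown, ABString.IsUp, hf, hl] <;> (try split_ifs) <;> omega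

theorem rowSum_ind_pa (δ : ABDiagram) : rowSum δ (fun r => if 0 < r.pa then 1 else 0) =
    singleDown δ + longDown δ + longUp δ + evenCount δ := by
  simp only [evenCount, longDown, singleDown, longUp, rowCount, ← rowSum_add]
  refine rowSum_congr fun r _ => ?_
  rcases r.cases_type with ⟨h, hf, hl⟩ | ⟨h, hf, hl⟩ | ⟨h, hf, hl⟩ | ⟨h, hf, hl⟩ <;>
  simp [ABString.pa, ABString.num, ABString.IsDown, ABString.IsUp, hf, hl] <;> (try split_ifs) <;> omega

theorem singleUp_le (δ : ABDiagram) : singleUp δ ≤ rowSum δ fun r => if r.pb = 1 then 1 else 0 := by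
  refine rowSum_le fun r _ => ?_
  rcases r.cases_type with ⟨h, hf, hl⟩ | ⟨h, hf, hl⟩ | ⟨h, hf, hl⟩ | ⟨h, hf, hl⟩ <;>
  simp [ABString.pb, ABString.num, ABString.IsUp, hf, hl] <;> (try split_ifs) <;> omega

theorem le_singleDown_add (δ : ABDiagram) : rowSum δ (fun r => if r.pa = 1 then 1 else 0) ≤
    singleDown δ + longUp δ + evenCount δ := by
  simp only [evenCount, singleDown, longUp, rowCount, ← rowSum_add]
  refine rowSum_le fun r _ => ?_
  rcases r.cases_type with ⟨h, hf, hl⟩ | ⟨h, hf, hl⟩ | ⟨h, hf, hl⟩ | ⟨h, hf, hl⟩ <;>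
  simp [ABString.pa, ABString.num, ABString.IsDown, ABString.IsUp, hf, hl] <;> (try split_ifs) <;> omega

theorem two_mul_singleUp_mul_singleDown_le (δ : ABDiagram) :
    2 * (singleUp δ * singleDown δ) ≤ rowSum₂ δ ABString.opp := by
  have h1 : 2 * (singleUp δ * singleDown δ) = singleUp δ * singleDown δ + singleDown δ * singleUp δ := by
    ring
  rw [h1]
  simp only [singleUp, singleDown, rowCount, ← rowSum₂_mul, ← rowSum₂_add]
  refine rowSum₂_le fun r _ r' _ => ?_
  by_cases h : r.len = 1 <;> by_cases h' : r'.len = 1 <;>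
  rcases r.first.eq_a_or_eq_b with hf | hf <;> rcases r'.first.eq_a_or_eq_b with hf' | hf' <;>
  simp [ABString.opp, ABString.IsDown, ABString.IsUp, hf, hf', h, h'] <;> split_ifs <;> simp

/-- The contribution of one diagram to the codimension inequality. -/
def defect (δ : ABDiagram) : ℤ :=
  -singleUp δ + longUp δ + evenCount δ + rowSum₂ δ ABString.opp

/-- A single b counts -1. If its diagram also contains a single a, the pairs counted by `opp`
compensate. Otherwise the debt is carried to the next diagram and paid there; it ends at the empty
diagram. -/
theorem sum_defect_nonneg (h : Admissible (dimVec lam) T) {t : ℕ} (ht : T t = 0) :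
    0 ≤ ∑ i ∈ Finset.range t, defect (T i) := by
  -- The conditional term is the debt still open after the diagram with index m.
  have key : ∀ m, 0 ≤ ∑ i ∈ Finset.range (m + 1), defect (T i) +
      if singleDown (T m) = 0 then singleUp (T m) else 0 := by
    have hS := fun i => rowCount_nonneg (T i) fun r => r.len % 2 = 0
    have hU0 := fun i => rowCount_nonneg (T i) fun r => r.IsUp ∧ r.len = 1
    have hU1 := fun i => rowCount_nonneg (T i) fun r => r.IsUp ∧ r.len ≠ 1
    have hD0 := fun i => rowCount_nonneg (T i) fun r => r.IsDown ∧ r.len = 1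
    have hdef : ∀ i, evenCount (T i) + longUp (T i) +
        (if singleDown (T i) = 0 then 0 else singleUp (T i)) ≤ defect (T i) +
          if singleDown (T i) = 0 then singleUp (T i) else 0 := by
      intro i
      have h1 := two_mul_singleUp_mul_singleDown_le (T i)
      have h2 := hU0 i
      have h3 := hD0 i
      change 0 ≤ singleUp (T i) at h2
      change 0 ≤ singleDown (T i) at h3
      unfold defect
      split_ifs with h0
      · rw [h0, mul_zero, mul_zero] at h1
        linarith
      · have h4 : 1 ≤ singleDown (T i) := by omega
        nlinarith
    intro m
    induction m with
    | zero =>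
      have h1 := hdef 0
      have h2 := hS 0
      have h3 := hU1 0
      have h4 := hU0 0
      change 0 ≤ evenCount (T 0) at h2
      change 0 ≤ longUp (T 0) at h3
      change 0 ≤ singleUp (T 0) at h4
      rw [Finset.sum_range_one]
      refine le_trans ?_ h1
      split_ifs <;> linarith
    | succ m ih =>
      rw [Finset.sum_range_succ]
      have h1 := hdef (m + 1)
      have a1 := hS m
      have a2 := hU1 m
      have a3 := hU0 m
      have b1 := hS (m + 1)
      have b2 := hU1 (m + 1)
      have b3 := hU0 (m + 1)
      have b4 := hD0 (m + 1)
      change 0 ≤ evenCount (T m) at a1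
      change 0 ≤ longUp (T m) at a2
      change 0 ≤ singleUp (T m) at a3
      change 0 ≤ evenCount (T (m + 1)) at b1
      change 0 ≤ longUp (T (m + 1)) at b2
      change 0 ≤ singleUp (T (m + 1)) at b3
      change 0 ≤ singleDown (T (m + 1)) at b4
      have c1 : ∀ i, rowSum (T i) (fun r => r.pa - r.pb) = lam.colLen i := fun i => by
        rw [rowSum_sub]
        refine (congrArg₂ _ (h.sum_pa i) (h.sum_pb i)).trans ?_
        rw [dimVec_eq]
        push_cast
        ring
      have c2 := c1 m
      have c3 := c1 (m + 1)
      rw [rowSum_pa_sub_pb] at c2 c3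
      have c4 : (lam.colLen (m + 1) : ℤ) ≤ lam.colLen m :=
        Nat.cast_le.mpr (lam.colLen_anti m (m + 1) (Nat.le_succ m))
      have c5 := h.transfer m (f := fun x => if 0 < x then 1 else 0) (by simp)
      rw [rowSum_ind_pb, rowSum_ind_pa] at c5
      have c6 := h.transfer m (f := fun x => if x = 1 then 1 else 0) (by simp)
      have c7 := (singleUp_le (T m)).trans (c6.le.trans (le_singleDown_add (T (m + 1))))
      -- Let U, D be the numbers of single b's and single a's at m, and U', D', L', E' the numbers
      -- of single b's, single a's, long strings beginning and ending in b, and even strings at m +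
      -- 1. A debt arises only if D = 0. If D' = 0, comparing parts equal to 1 gives U ≤ L' + E'. If
      -- D' > 0, the decrease of the columns and the equality of the numbers of nonzero parts give
      -- 2U ≤ 2L' + E' + U'.
      split_ifs at ih h1 ⊢ <;> linarith
  have h1 := key t
  rw [Finset.sum_range_succ, ht] at h1
  have h2 : singleUp 0 = 0 := rfl
  have h3 : defect 0 = 0 := rfl
  simpa [h2, h3] using h1

/-- Checked string by string. Odd strings beginning with a contribute 0 to both sides. An odd string
bab…b with h letters a contributes 4h - 2 to the right, negative only for h = 0; an even string
contributes its length. -/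
theorem defect_le (δ : ABDiagram) : 2 * defect δ ≤ 2 * rowSum δ ABString.pa -
    rowSum δ (fun r => r.pa * (r.pa + 1) - r.pb * (r.pb + 1)) +
      2 * (rowSum δ (fun r => r.pa - r.pb) - rowSum δ (fun r => r.len % 2)
        + rowSum₂ δ ABString.opp) := by
  have h1 : 2 * (-singleUp δ + longUp δ + evenCount δ) ≤ 2 * rowSum δ ABString.pa -
    rowSum δ (fun r => r.pa * (r.pa + 1) - r.pb * (r.pb + 1)) +
      2 * (rowSum δ (fun r => r.pa - r.pb) - rowSum δ (fun r => r.len % 2)) := by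
    rw [neg_add_eq_sub]
    simp only [singleUp, longUp, evenCount, rowCount, ← rowSum_sub, ← rowSum_add, ← rowSum_mul_left]
    refine rowSum_le fun r _ => ?_
    rcases r.cases_type with ⟨h, hf, hl⟩ | ⟨h, hf, hl⟩ | ⟨h, hf, hl⟩ | ⟨h, hf, hl⟩
    · have e1 : r.pa = h + 1 := by simp only [ABString.pa, ABString.num, hf, hl]; simp; omega
      have e2 : r.pb = h := by simp only [ABString.pb, ABString.num, hf, hl]; simp; omega
      have e3 : ((r.len : ℤ) % 2) = 1 := by omega
      have e4 : ¬ r.IsUp := by simp [ABString.IsUp, hf]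
      rw [e1, e2, e3, if_neg (by tauto), if_neg (by tauto), if_neg (by omega)]
      nlinarith
    · have e1 : r.pa = h := by simp only [ABString.pa, ABString.num, hf, hl]; simp; omega
      have e2 : r.pb = h + 1 := by simp only [ABString.pb, ABString.num, hf, hl]; simp; omega
      have e3 : ((r.len : ℤ) % 2) = 1 := by omega
      have e4 : r.IsUp := ⟨hf, by omega⟩
      rw [e1, e2, e3, if_neg (c := r.len % 2 = 0) (by omega)]
      by_cases h0 : r.len = 1
      · have h1 : h = 0 := by omega
        rw [if_neg (by tauto), if_pos ⟨e4, h0⟩, h1]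
        norm_num
      · have h1 : (1 : ℤ) ≤ h := by omega
        rw [if_pos ⟨e4, h0⟩, if_neg (by tauto)]
        nlinarith
    · have e1 : r.pa = h + 1 := by simp only [ABString.pa, ABString.num, hf, hl]; simp; omega
      have e2 : r.pb = h + 1 := by simp only [ABString.pb, ABString.num, hf, hl]; simp
      have e3 : ((r.len : ℤ) % 2) = 0 := by omega
      have e4 : ¬ r.IsUp := by simp [ABString.IsUp, hf]
      rw [e1, e2, e3, if_neg (by tauto), if_neg (by tauto), if_pos (by omega)]
      have : (0 : ℤ) ≤ h := Nat.cast_nonneg h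
      nlinarith
    · have e1 : r.pa = h + 1 := by simp only [ABString.pa, ABString.num, hf, hl]; simp
      have e2 : r.pb = h + 1 := by simp only [ABString.pb, ABString.num, hf, hl]; simp; omega
      have e3 : ((r.len : ℤ) % 2) = 0 := by omega
      have e4 : ¬ r.IsUp := by simp only [ABString.IsUp]; omega
      rw [e1, e2, e3, if_neg (by tauto), if_neg (by tauto), if_pos (by omega)]
      have : (0 : ℤ) ≤ h := Nat.cast_nonneg h
      nlinarith
  unfold defect
  linarith

/-- The codimension inequality for the dimensions computed from the diagrams. -/
theorem two_mul_rDiff_sub_cDiff_le {mu : YoungDiagram} {T₀ : ℕ → ABDiagram} {t : ℕ}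
    (hcard : lam.card = mu.card) (h : Admissible (dimVec lam) T) (ht : T t = 0)
    (hmu : ∀ k, rowSum (T 0) (ABString.ind k) = mu.colLen k)
    (h₀ : Admissible (dimVec lam) T₀) (ht₀ : T₀ t = 0)
    (hlam : ∀ k, rowSum (T₀ 0) (ABString.ind k) = lam.colLen k) :
    2 * rDiff lam mu - cDiff lam mu ≤
      (rowSum₂ (T 0) (fun r r' => min r.pa r'.pa) - rowSum₂ (T₀ 0) fun r r' => min r.pa r'.pa)
      + (∑ i ∈ Finset.range t, (rowSum (T₀ i) (fun r => r.len % 2) - rowSum₂ (T₀ i) ABString.opp)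
      - ∑ i ∈ Finset.range t, (rowSum (T i) (fun r => r.len % 2) - rowSum₂ (T i) ABString.opp)) := by
  rw [two_mul_rDiff hcard hlam hmu]
  have hd : ∀ i, ∀ r ∈ T₀ i, r.IsDown := fun i r hr => forall_isDown h₀ hlam hr
  have hχ : ∀ i, rowSum (T₀ i) (fun r => r.pa - r.pb) = rowSum (T i) fun r => r.pa - r.pb :=
    fun i => by
      rw [rowSum_sub, rowSum_sub]
      exact congrArg₂ _ ((h₀.sum_pa i).trans (h.sum_pa i).symm)
        ((h₀.sum_pb i).trans (h.sum_pb i).symm)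
  have h1 : ∀ i, rowSum (T₀ i) (fun r => r.len % 2) - rowSum₂ (T₀ i) ABString.opp =
      rowSum (T i) fun r => r.pa - r.pb := fun i => by
    have e1 : rowSum₂ (T₀ i) ABString.opp = 0 := by
      rw [rowSum₂_congr (g' := fun _ _ => 0) fun r hr r' hr' => ?_]
      · simp only [rowSum₂, rowSum_zero]
      · have a1 := (hd i r hr).1
        have a2 := (hd i r' hr').1
        simp [ABString.opp, ABString.IsUp, a1, a2]
    rw [e1, sub_zero, ← hχ]
    refine rowSum_congr fun r hr => ?_
    rw [(hd i r hr).pb_eq]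
    have := (hd i r hr).2
    omega
  -- In τ⁰ the telescoping summand pa(pa+1) - pb(pb+1) is 2 pa, whose sum 2 n_i is the same for both
  -- strata.
  have h2 : ∑ i ∈ Finset.range t, 2 * rowSum (T i) ABString.pa =
      rowSum (T₀ 0) fun r => r.pa * (r.pa + 1) := by
    rw [sum_pa_mul_eq h₀ ht₀]
    refine Finset.sum_congr rfl fun i _ => ?_
    rw [h.sum_pa, ← h₀.sum_pa, ← rowSum_mul_left]
    refine rowSum_congr fun r hr => ?_
    rw [(hd i r hr).pb_eq]
    ring
  have h3 := sum_defect_nonneg h ht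
  have h4 := Finset.sum_le_sum fun i (_ : i ∈ Finset.range t) => defect_le (T i)
  rw [Finset.sum_add_distrib, Finset.sum_sub_distrib, h2, ← sum_pa_mul_eq h ht,
    ← two_mul_cDiff hlam hmu, ← Finset.mul_sum, ← Finset.mul_sum] at h4
  rw [Finset.sum_congr rfl fun i _ => h1 i]
  simp only [Finset.sum_add_distrib, Finset.sum_sub_distrib] at h4 ⊢
  linarith

end Codim

end

section

open Matrix

/-! ### The partition of a diagram -/

section FirstPartition

theorem colLen_ofRowLens (w : List ℕ) (hw : w.SortedGE) (k : ℕ) :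
    (YoungDiagram.ofRowLens w hw).colLen k = w.countP (k < ·) := by
  have h1 : (YoungDiagram.ofRowLens w hw).col k =
      (Finset.univ.filter fun i : Fin w.length => k < w.get i).image fun i : Fin w.length => ((i : ℕ), k) := by
    ext ⟨i, j⟩
    rw [YoungDiagram.mem_col_iff, YoungDiagram.mem_ofRowLens]
    simp only [Finset.mem_image, Finset.mem_filter, Finset.mem_univ, true_and, Prod.mk.injEq]
    constructor
    · rintro ⟨⟨h, h'⟩, rfl⟩
      exact ⟨⟨i, h⟩, h', rfl, rfl⟩
    · rintro ⟨i', h, rfl, rfl⟩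
      exact ⟨⟨i'.2, h⟩, rfl⟩
  rw [YoungDiagram.colLen_eq_card, h1, Finset.card_image_of_injective _ fun i i' h =>
    Fin.ext (congrArg Prod.fst h)]
  have h2 : (Finset.univ.val.map w.get : Multiset ℕ) = w := by
    rw [Fin.univ_val_map, List.ofFn_get]
  rw [← Multiset.coe_countP, ← h2, Multiset.countP_map]
  rfl

theorem colLen_piDiagram (δ : ABDiagram) (k : ℕ) :
    rowSum δ (ABString.ind k) = (piDiagram δ).colLen k := by
  rw [piDiagram, colLen_ofRowLens, ← Multiset.coe_countP, Multiset.sort_eq]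
  induction δ using Multiset.induction with
  | empty => simp
  | cons r δ ih =>
    rw [rowSum, Multiset.map_cons, Multiset.map_cons, Multiset.sum_cons, Multiset.countP_cons,
      Nat.cast_add, ← ih, add_comm]
    unfold ABString.ind ABString.pa
    rw [ABString.countA_eq]
    simp only [Nat.cast_lt, Nat.cast_ite, Nat.cast_one, Nat.cast_zero]
    rfl

theorem colLen_firstPartition {t : ℕ} (τ : Fin t → ABDiagram) (k : ℕ) :
    rowSum (extendDiag τ 0) (ABString.ind k) = (firstPartition τ).colLen k := by
  by_cases h : 0 < t
  · rw [firstPartition, dif_pos h, ← colLen_piDiagram, extendDiag, dif_pos h]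
  · rw [firstPartition, dif_neg h, extendDiag, dif_neg h, rowSum_empty, YoungDiagram.colLen_eq_card]
    simp [YoungDiagram.col]

theorem eq_of_colLen_eq {μ ν : YoungDiagram} (h : ∀ k, μ.colLen k = ν.colLen k) : μ = ν := by
  ext ⟨i, j⟩
  rw [YoungDiagram.mem_cells, YoungDiagram.mem_cells, YoungDiagram.mem_iff_lt_colLen,
    YoungDiagram.mem_iff_lt_colLen, h]

end FirstPartition

/-! ### Reduction to matrices -/

section Reduction

/-- An orthogonal basis has nonzero norms by nondegeneracy and is rescaled by complex square roots
of them. -/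
theorem exists_orthonormal_equiv {V : Type*} [AddCommGroup V] [Module ℂ V]
    [FiniteDimensional ℂ V] {n : ℕ} (hn : Module.finrank ℂ V = n) (B : LinearMap.BilinForm ℂ V)
    (hB : B.IsSymm) (hnd : B.Nondegenerate) :
    ∃ φ : V ≃ₗ[ℂ] (Fin n → ℂ), ∀ x y, B x y = φ x ⬝ᵥ φ y := by
  subst hn
  obtain ⟨v, hv⟩ := LinearMap.BilinForm.exists_orthogonal_basis (LinearMap.BilinForm.isSymm_iff.mp hB)
  have hne := hv.not_isOrtho_basis_self_of_separatingLeft hnd.1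
  choose c hc using fun i => IsAlgClosed.exists_pow_nat_eq (B (v i) (v i)) two_pos
  have hc0 : ∀ i, c i ≠ 0 := fun i h0 => hne i (by rw [← hc i, h0]; simp)
  let e := v.isUnitSMul fun i => (isUnit_iff_ne_zero.mpr (inv_ne_zero (hc0 i)))
  have he : ∀ i j, B (e i) (e j) = if i = j then 1 else 0 := by
    intro i j
    simp only [e, Module.Basis.isUnitSMul_apply, map_smul, LinearMap.smul_apply, smul_eq_mul]
    split_ifs with h
    · subst h
      rw [← hc i]
      have := hc0 i
      field_simp
    · rw [hv h, mul_zero, mul_zero]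
  refine ⟨e.equivFun, fun x y => ?_⟩
  conv_lhs => rw [← e.sum_equivFun x, ← e.sum_equivFun y]
  simp only [map_sum, LinearMap.sum_apply, map_smul, LinearMap.smul_apply, smul_eq_mul, he]
  simp [dotProduct, mul_comm]

variable {t : ℕ} {n : ℕ → ℕ} {V : ℕ → Type*} [∀ i, AddCommGroup (V i)] [∀ i, Module ℂ (V i)]

/-- Matrix families as representations on spaces with chosen coordinates. -/
noncomputable def toRep (φ : ∀ i, V i ≃ₗ[ℂ] (Fin (n i) → ℂ)) : RectFam t n →ₗ[ℂ] RepSpace t V where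
  toFun A i := ((φ (i + 1)).symm.toLinearMap ∘ₗ Matrix.toLin' (A i) ∘ₗ (φ i).toLinearMap,
    (φ i).symm.toLinearMap ∘ₗ Matrix.toLin' (A i)ᵀ ∘ₗ (φ (i + 1)).toLinearMap)
  map_add' A A' := by
    funext i
    simp only [Pi.add_apply, Matrix.transpose_add, map_add, LinearMap.comp_add, LinearMap.add_comp]
    rfl
  map_smul' c A := by
    funext i
    simp only [Pi.smul_apply, Matrix.transpose_smul, map_smul, LinearMap.comp_smul,
      LinearMap.smul_comp]
    rfl

theorem toRep_injective (φ : ∀ i, V i ≃ₗ[ℂ] (Fin (n i) → ℂ)) :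
    Function.Injective (toRep (t := t) φ) := by
  intro A A' h
  funext i
  apply Matrix.toLin'.injective
  have h1 := congrArg Prod.fst (congrFun h i)
  refine LinearMap.ext fun x => ?_
  have h2 := LinearMap.congr_fun h1 ((φ i).symm x)
  simpa [toRep] using h2

variable (form : ∀ i, LinearMap.BilinForm ℂ (V i))

theorem toRep_mem_stratum_iff (φ : ∀ i, V i ≃ₗ[ℂ] (Fin (n i) → ℂ))
    (hφ : ∀ i x y, form i x y = φ i x ⬝ᵥ φ i y) (τ : Fin t → ABDiagram) (A : RectFam t n) :
    toRep φ A ∈ stratum t V form τ ↔ A ∈ matStratum n τ := by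
  constructor
  · rintro ⟨⟨-, h1⟩, h2⟩
    refine ⟨fun i hi => ?_, fun i => ?_⟩
    · apply Matrix.toLin'.injective
      rw [Matrix.toLin'_mul, Matrix.toLin'_mul]
      refine LinearMap.ext fun x => ?_
      have h := LinearMap.congr_fun (h1 i hi) ((φ (i + 1)).symm x)
      simpa [toRep] using h
    · exact (h2 i).of_equiv (φ i) (φ (i + 1)) (fun x => by simp [toRep]) fun y => by simp [toRep]
  · rintro ⟨h1, h2⟩
    refine ⟨⟨fun i x y => ?_, fun i hi => ?_⟩, fun i => ?_⟩
    · rw [hφ, hφ]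
      simp only [toRep, LinearMap.coe_mk, AddHom.coe_mk, LinearMap.comp_apply, LinearEquiv.coe_coe,
        LinearEquiv.apply_symm_apply, Matrix.toLin'_apply]
      rw [Matrix.mulVec_transpose, dotProduct_comm (A i *ᵥ _), Matrix.dotProduct_mulVec,
        dotProduct_comm]
    · have h := congrArg Matrix.toLin' (h1 i hi)
      rw [Matrix.toLin'_mul, Matrix.toLin'_mul] at h
      refine LinearMap.ext fun x => ?_
      have h' := LinearMap.congr_fun h (φ (i + 1) x)
      simp only [toRep, LinearMap.coe_mk, AddHom.coe_mk, LinearMap.comp_apply, LinearEquiv.coe_coe,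
        LinearEquiv.apply_symm_apply] at h' ⊢
      rw [h']
    · exact (h2 i).of_equiv (φ i).symm (φ (i + 1)).symm (fun x => by simp [toRep])
        fun y => by simp [toRep]

theorem stratum_eq_image (φ : ∀ i, V i ≃ₗ[ℂ] (Fin (n i) → ℂ))
    (hφ : ∀ i x y, form i x y = φ i x ⬝ᵥ φ i y) (τ : Fin t → ABDiagram) :
    stratum t V form τ = toRep φ '' matStratum n τ := by
  ext z
  constructor
  · intro hz
    let A : RectFam t n := fun i => LinearMap.toMatrix'
      ((φ (i + 1)).toLinearMap ∘ₗ (z i).1 ∘ₗ (φ i).symm.toLinearMap)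
    have hA : toRep φ A = z := by
      funext i
      refine Prod.ext ?_ ?_
      · refine LinearMap.ext fun x => ?_
        simp [toRep, A]
      · refine LinearMap.ext fun y => ?_
        apply (φ i).injective
        -- Nondegeneracy: the map B_i is determined by A_i through adjointness, so the matrices of
        -- the A_i suffice.
        refine dotProduct_eq _ _ fun w => ?_
        have h := hz.1.1 i ((φ i).symm w) y
        rw [hφ, hφ, LinearEquiv.apply_symm_apply] at h
        have h3 : A i *ᵥ w = φ (i + 1) ((z i).1 ((φ i).symm w)) := by
          rw [← Matrix.toLin'_apply]
          simp [A]
        rw [dotProduct_comm (φ i ((z i).2 y)) w, ← h, ← h3]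
        simp only [toRep, LinearMap.coe_mk, AddHom.coe_mk, LinearMap.comp_apply,
          LinearEquiv.coe_coe, LinearEquiv.apply_symm_apply, Matrix.toLin'_apply]
        rw [Matrix.mulVec_transpose, dotProduct_comm (A i *ᵥ _), Matrix.dotProduct_mulVec]
    exact ⟨A, (toRep_mem_stratum_iff form φ hφ τ A).mp (hA ▸ hz), hA⟩
  · rintro ⟨A, hA, rfl⟩
    exact (toRep_mem_stratum_iff form φ hφ τ A).mpr hA

end Reduction

end

section

/-! ### A point in the stratum of `lam` -/

section Model

variable (lam : YoungDiagram) (i : ℕ)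

/-- The boxes of `lam` outside the first `i` columns. -/
abbrev Box : Type := {c : ℕ × ℕ // c ∈ lam.cells.filter fun c => i ≤ c.2}

variable {lam i} in
theorem Box.lt (c : Box lam i) : c.1.2 < lam.rowLen c.1.1 :=
  YoungDiagram.mem_iff_lt_rowLen.mp
    ((YoungDiagram.mem_cells _).mp (Finset.mem_filter.mp c.2).1)

variable {lam i} in
theorem Box.le (c : Box lam i) : i ≤ c.1.2 := (Finset.mem_filter.mp c.2).2

variable {lam i} in
/-- The box in row `j` and column `k`. -/
def Box.mk (j k : ℕ) (h : i ≤ k) (h' : k < lam.rowLen j) : Box lam i :=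
  ⟨(j, k), Finset.mem_filter.mpr
    ⟨(YoungDiagram.mem_cells _).mpr (YoungDiagram.mem_iff_lt_rowLen.mpr h'), h⟩⟩

theorem card_box : Fintype.card (Box lam i) = dimVec lam i := by
  rw [Fintype.card_coe, dimVec, Finset.card_eq_sum_card_fiberwise (f := Prod.snd)
    (t := Finset.Ico i (numCols lam))]
  · refine Finset.sum_congr rfl fun k hk => ?_
    rw [YoungDiagram.colLen_eq_card, YoungDiagram.col, Finset.filter_filter]
    refine congrArg _ (Finset.filter_congr fun c _ => ?_)
    have := (Finset.mem_Ico.mp hk).1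
    omega
  · intro c hc
    have h := Finset.mem_filter.mp (Finset.mem_coe.mp hc)
    refine Finset.mem_coe.mpr (Finset.mem_Ico.mpr ⟨h.2, ?_⟩)
    have h1 := YoungDiagram.mem_iff_lt_rowLen.mp ((YoungDiagram.mem_cells _).mp h.1)
    exact h1.trans_le (lam.rowLen_anti 0 c.1 (Nat.zero_le _))

/-- The reflection of each row. -/
def refl : Equiv.Perm (Box lam i) where
  -- The part of a row that remains occupies the columns i, …, rowLen - 1; the reflection keeps the
  -- sum of the two columns equal to that of the endpoints.
  toFun c := .mk c.1.1 (lam.rowLen c.1.1 - 1 + i - c.1.2)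
    (by have := c.lt; omega) (by have := c.lt; have := c.le; omega)
  invFun c := .mk c.1.1 (lam.rowLen c.1.1 - 1 + i - c.1.2)
    (by have := c.lt; omega) (by have := c.lt; have := c.le; omega)
  left_inv c := by
    refine Subtype.ext (Prod.ext rfl ?_)
    have := c.lt; have := c.le
    simp only [Box.mk]
    omega
  right_inv c := by
    refine Subtype.ext (Prod.ext rfl ?_)
    have := c.lt; have := c.le
    simp only [Box.mk]
    omega

variable {lam i} in
theorem refl_refl (c : Box lam i) : refl lam i (refl lam i c) = c := (refl lam i).left_inv c

/-- The symmetric form that pairs each box with its reflection. -/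
noncomputable def modelForm : LinearMap.BilinForm ℂ (Box lam i → ℂ) :=
  LinearMap.mk₂ ℂ (fun x y => ∑ c, x c * y (refl lam i c))
    (fun x x' y => by simp only [Pi.add_apply, add_mul, Finset.sum_add_distrib])
    (fun a x y => by simp only [Pi.smul_apply, smul_eq_mul, mul_assoc, Finset.mul_sum])
    (fun x y y' => by simp only [Pi.add_apply, mul_add, Finset.sum_add_distrib])
    (fun a x y => by simp only [Pi.smul_apply, smul_eq_mul, mul_left_comm, Finset.mul_sum])

theorem modelForm_apply (x y : Box lam i → ℂ) :
    modelForm lam i x y = ∑ c, x c * y (refl lam i c) := rfl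

theorem modelForm_isSymm : (modelForm lam i).IsSymm := ⟨fun x y => by
  rw [modelForm_apply, modelForm_apply, ← Equiv.sum_comp (refl lam i)]
  exact Finset.sum_congr rfl fun c _ => by rw [refl_refl, mul_comm]⟩

theorem modelForm_nondegenerate : (modelForm lam i).Nondegenerate := by
  refine (LinearMap.BilinForm.IsSymm.isRefl
    (modelForm_isSymm lam i)).nondegenerate_iff_separatingLeft.mpr fun x hx => funext fun c => ?_
  have h := hx (Pi.single (refl lam i c) 1)
  rw [modelForm_apply, Finset.sum_eq_single c] at h
  · simpa using h
  · intro b _ hb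
    rw [Pi.single_eq_of_ne fun h' => hb ((refl lam i).injective h'), mul_zero]
  · simp

/-- The left neighbour. -/
def pred (c : Box lam (i + 1)) : Box lam i :=
  .mk c.1.1 (c.1.2 - 1) (by have := c.le; omega) (by have := c.lt; omega)

/-- Moving every box one step to the right. -/
noncomputable def modelA : (Box lam i → ℂ) →ₗ[ℂ] (Box lam (i + 1) → ℂ) :=
  LinearMap.funLeft ℂ ℂ (pred lam i)

theorem modelA_apply (x : Box lam i → ℂ) (c : Box lam (i + 1)) :
    modelA lam i x c = x (pred lam i c) := rfl

/-- Extension by zero. -/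
noncomputable def modelB : (Box lam (i + 1) → ℂ) →ₗ[ℂ] (Box lam i → ℂ) where
  toFun y c := if h : i + 1 ≤ c.1.2 then y (.mk c.1.1 c.1.2 h c.lt) else 0
  map_add' y y' := by
    funext c
    simp only [Pi.add_apply]
    split_ifs <;> simp
  map_smul' a y := by
    funext c
    simp only [Pi.smul_apply, RingHom.id_apply]
    split_ifs <;> simp

theorem modelB_apply (y : Box lam (i + 1) → ℂ) (c : Box lam i) :
    modelB lam i y c = if h : i + 1 ≤ c.1.2 then y (.mk c.1.1 c.1.2 h c.lt) else 0 := rfl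

/-- A box that is not a left neighbour ends its row. Its reflection lies in column i, where an
extension by zero vanishes, so only left neighbours contribute to the sum on the larger space. -/
theorem model_isAdjointPair : LinearMap.IsAdjointPair (modelForm lam i) (modelForm lam (i + 1))
    (modelA lam i) (modelB lam i) := by
  intro x y
  rw [modelForm_apply, modelForm_apply]
  refine Fintype.sum_of_injective (pred lam i) (fun c c' h => ?_) _ _ (fun c hc => ?_) fun c => ?_
  · have h1 := congrArg (fun c => c.1.1) h
    have h2 := congrArg (fun c => c.1.2) h
    simp only [pred, Box.mk] at h1 h2
    have := c.le; have := c'.le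
    exact Subtype.ext (Prod.ext h1 (by omega))
  · rw [modelB_apply, dif_neg, mul_zero]
    intro h
    simp only [refl, Box.mk, Equiv.coe_fn_mk] at h
    have := c.le
    have := c.lt
    refine hc ⟨.mk c.1.1 (c.1.2 + 1) (by omega) (by omega), Subtype.ext (Prod.ext rfl ?_)⟩
    simp only [pred, Box.mk, Nat.add_sub_cancel]
  · have := c.le
    have := c.lt
    rw [modelA_apply, modelB_apply, dif_pos]
    · congr 2
      refine Subtype.ext (Prod.ext rfl ?_)
      simp only [refl, pred, Box.mk, Equiv.coe_fn_mk]
      omega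
    · simp only [refl, pred, Box.mk, Equiv.coe_fn_mk]
      omega

theorem model_linked : modelA lam i ∘ₗ modelB lam i =
    modelB lam (i + 1) ∘ₗ modelA lam (i + 1) := by
  refine LinearMap.ext fun y => funext fun c => ?_
  rw [LinearMap.comp_apply, LinearMap.comp_apply, modelA_apply, modelB_apply, modelB_apply]
  have := c.le
  have hp : (pred lam i c).1.2 = c.1.2 - 1 := rfl
  by_cases h : i + 1 + 1 ≤ c.1.2
  · rw [dif_pos h, dif_pos (by omega)]
    rfl
  · rw [dif_neg h, dif_neg (by omega)]

/-- The string of row `j` of the diagram of the model. -/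
def modelRow (j : Fin (lam.colLen i)) : ABString where
  first := .a
  len := 2 * (lam.rowLen j - i) - 1
  len_pos := by
    have := YoungDiagram.mem_iff_lt_rowLen.mp (YoungDiagram.mem_iff_lt_colLen.mpr j.2)
    omega

/-- The diagram of the model. -/
def modelDiagram : ABDiagram := Multiset.map (modelRow lam i) Finset.univ.val

/-- The positions in the diagram of the model. -/
def modelPos : Box lam i ⊕ Box lam (i + 1) → Σ j, Fin (modelRow lam i j).len
  | .inl c => ⟨⟨c.1.1, YoungDiagram.mem_iff_lt_colLen.mp (YoungDiagram.mem_iff_lt_rowLen.mpr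
      (c.le.trans_lt c.lt))⟩, 2 * (c.1.2 - i), by
        have := c.le; have := c.lt; simp only [modelRow]; omega⟩
  | .inr c => ⟨⟨c.1.1, YoungDiagram.mem_iff_lt_colLen.mp (YoungDiagram.mem_iff_lt_rowLen.mpr
      (by have := c.le; have := c.lt; omega))⟩, 2 * (c.1.2 - i) - 1, by
        have := c.le; have := c.lt; simp only [modelRow]; omega⟩

variable {lam i} in
theorem modelPos_ext {p p' : Σ j, Fin (modelRow lam i j).len} (h : (p.1 : ℕ) = p'.1)
    (h' : (p.2 : ℕ) = p'.2) : p = p' := by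
  obtain ⟨⟨j, hj⟩, ⟨k, hk⟩⟩ := p
  obtain ⟨⟨j', hj'⟩, ⟨k', hk'⟩⟩ := p'
  simp only at h h'
  subst h h'
  rfl

theorem modelPos_bijective : Function.Bijective (modelPos lam i) := by
  constructor
  · rintro (c | c) (c' | c') h
    all_goals
      have h1 : ((modelPos lam i _).1 : ℕ) = (modelPos lam i _).1 := congrArg (fun p => (p.1 : ℕ)) h
      have h2 : ((modelPos lam i _).2 : ℕ) = (modelPos lam i _).2 := congrArg (fun p => (p.2 : ℕ)) h
      simp only [modelPos] at h1 h2
      have := c.le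
      have := c'.le
    · exact congrArg _ (Subtype.ext (Prod.ext h1 (by omega)))
    · omega
    · omega
    · exact congrArg _ (Subtype.ext (Prod.ext h1 (by omega)))
  · rintro ⟨j, k⟩
    have hk : (k : ℕ) < 2 * (lam.rowLen j - i) - 1 := k.2
    by_cases h : Even (k : ℕ)
    · obtain ⟨s, hs⟩ := h
      refine ⟨.inl (.mk j (i + s) (by omega) (by omega)), modelPos_ext rfl ?_⟩
      simp only [modelPos, Box.mk]
      omega
    · obtain ⟨s, hs⟩ := Nat.not_even_iff_odd.mp h
      refine ⟨.inr (.mk j (i + s + 1) (by omega) (by omega)), modelPos_ext rfl ?_⟩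
      simp only [modelPos, Box.mk]
      omega

/-- The basis of the model adapted to its diagram. -/
noncomputable def modelBasis : Module.Basis (Σ j, Fin (modelRow lam i j).len) ℂ
    ((Box lam i → ℂ) × (Box lam (i + 1) → ℂ)) :=
  ((Pi.basisFun ℂ _).prod (Pi.basisFun ℂ _)).reindex
    (Equiv.ofBijective (modelPos lam i) (modelPos_bijective lam i))

theorem modelBasis_inl (c : Box lam i) :
    modelBasis lam i (modelPos lam i (.inl c)) = (Pi.single c 1, 0) := by
  rw [modelBasis, Module.Basis.reindex_apply, ← Equiv.ofBijective_apply (modelPos lam i)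
    (modelPos_bijective lam i), Equiv.symm_apply_apply]
  simp

theorem modelBasis_inr (c : Box lam (i + 1)) :
    modelBasis lam i (modelPos lam i (.inr c)) = (0, Pi.single c 1) := by
  rw [modelBasis, Module.Basis.reindex_apply, ← Equiv.ofBijective_apply (modelPos lam i)
    (modelPos_bijective lam i), Equiv.symm_apply_apply]
  simp

/-- Along a row, the a of a box goes under A to the b of the box on its right, and B turns this b
into the a of the same box. So each row gives one string a b a … a. -/
theorem hasABDiagram_model : HasABDiagram (modelA lam i) (modelB lam i) (modelDiagram lam i) := by
  have key : ∀ p : Σ j, Fin (modelRow lam i j).len,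
      ((modelRow lam i p.1).letter p.2 = Letter.a → (modelBasis lam i p).2 = 0) ∧
      ((modelRow lam i p.1).letter p.2 = Letter.b → (modelBasis lam i p).1 = 0) ∧
      (modelB lam i (modelBasis lam i p).2, modelA lam i (modelBasis lam i p).1) =
        if h : (p.2 : ℕ) + 1 < (modelRow lam i p.1).len
          then modelBasis lam i ⟨p.1, ⟨p.2 + 1, h⟩⟩ else 0 := by
    intro p
    obtain ⟨c | c, rfl⟩ := (modelPos_bijective lam i).2 p
    · have hle := c.le
      have hlt := c.lt
      refine ⟨fun _ => by rw [modelBasis_inl], fun h => ?_, ?_⟩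
      · rw [ABString.letter_eq_iff] at h
        simp [modelPos, modelRow] at h
      · rw [modelBasis_inl, map_zero]
        split_ifs with h
        · have h' : c.1.2 + 1 < lam.rowLen c.1.1 := by
            simp only [modelPos, modelRow] at h
            omega
          have e : (⟨(modelPos lam i (.inl c)).1, ⟨(modelPos lam i (.inl c)).2 + 1, h⟩⟩ :
              Σ j, Fin (modelRow lam i j).len) =
              modelPos lam i (.inr (.mk c.1.1 (c.1.2 + 1) (by omega) h')) :=
            modelPos_ext rfl (by simp only [modelPos, Box.mk]; omega)
          rw [e, modelBasis_inr]
          refine Prod.ext rfl (funext fun d => ?_)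
          have := d.le
          simp only [modelA_apply, Pi.single_apply, pred, Box.mk, Subtype.ext_iff, Prod.ext_iff]
          refine if_congr (and_congr_right fun _ => ?_) rfl rfl
          omega
        · refine Prod.ext rfl (funext fun d => ?_)
          simp only [modelPos, modelRow] at h
          refine Pi.single_eq_of_ne (fun h' => ?_) _
          have h1 := congrArg (fun c => c.1.1) h'
          have h2 := congrArg (fun c => c.1.2) h'
          simp only [pred, Box.mk] at h1 h2
          have := d.le
          have := d.lt
          rw [h1] at this
          omega
    · have hle := c.le
      have hlt := c.lt
      refine ⟨fun h => ?_, fun _ => by rw [modelBasis_inr], ?_⟩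
      · rw [ABString.letter_eq_iff] at h
        simp only [modelPos, modelRow, iff_true, Nat.even_iff] at h
        omega
      · rw [modelBasis_inr, map_zero, dif_pos (by simp only [modelPos, modelRow]; omega)]
        have e : (⟨(modelPos lam i (.inr c)).1, ⟨(modelPos lam i (.inr c)).2 + 1,
              by simp only [modelPos, modelRow]; omega⟩⟩ : Σ j, Fin (modelRow lam i j).len) =
            modelPos lam i (.inl (.mk c.1.1 c.1.2 (by omega) hlt)) :=
          modelPos_ext rfl (by simp only [modelPos, Box.mk]; omega)
        rw [e, modelBasis_inl]
        refine Prod.ext (funext fun d => ?_) rfl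
        simp only [modelB_apply, Pi.single_apply, Box.mk, Subtype.ext_iff, Prod.ext_iff]
        split_ifs <;> first | rfl | omega
  exact ⟨_, modelRow lam i, modelBasis lam i, rfl, fun j k => (key ⟨j, k⟩).1,
    fun j k => (key ⟨j, k⟩).2.1, fun j k => (key ⟨j, k⟩).2.2⟩

theorem model_mem_stratum (t : ℕ) : (fun i : Fin t => (modelA lam i, modelB lam i)) ∈
    stratum t (fun i => Box lam i → ℂ) (modelForm lam) fun i : Fin t => modelDiagram lam i :=
  ⟨⟨fun i => model_isAdjointPair lam i, fun i _ => model_linked lam i⟩,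
    fun i => hasABDiagram_model lam i⟩

theorem firstPartition_modelDiagram :
    firstPartition (fun i : Fin (numCols lam) => modelDiagram lam i) = lam := by
  refine eq_of_colLen_eq fun k => ?_
  rw [← Nat.cast_inj (R := ℤ), ← colLen_firstPartition]
  by_cases h : 0 < numCols lam
  · rw [extendDiag, dif_pos h, modelDiagram, rowSum_eq_sum rfl]
    have h1 : ∀ j : Fin (lam.colLen 0), ABString.ind k (modelRow lam 0 j) =
        if (j : ℕ) < lam.colLen k then 1 else 0 := fun j => by
      have h0 := YoungDiagram.mem_iff_lt_rowLen.mp (YoungDiagram.mem_iff_lt_colLen.mpr j.2)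
      have h2 : ABString.pa (modelRow lam 0 j) = lam.rowLen j := by
        simp only [ABString.pa, ABString.num, modelRow, if_true]
        omega
      rw [ABString.ind, h2]
      refine if_congr ?_ rfl rfl
      rw [Nat.cast_lt, ← YoungDiagram.mem_iff_lt_rowLen, YoungDiagram.mem_iff_lt_colLen]
    refine (Finset.sum_congr rfl fun j _ => h1 j).trans ?_
    rw [Fin.sum_univ_eq_sum_range (fun j => if j < lam.colLen k then (1 : ℤ) else 0),
      Finset.sum_ite, Finset.sum_const_zero, add_zero, Finset.sum_const, nsmul_eq_mul, mul_one,
      Nat.cast_inj]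
    have h3 : (Finset.range (lam.colLen 0)).filter (· < lam.colLen k) =
        Finset.range (lam.colLen k) := by
      ext j
      have := lam.colLen_anti 0 k (Nat.zero_le _)
      simp only [Finset.mem_filter, Finset.mem_range]
      omega
    rw [h3, Finset.card_range]
  · rw [extendDiag_of_le _ (not_lt.mp h), rowSum_empty,
      colLen_eq_zero ((not_lt.mp h).trans (Nat.zero_le _)), Nat.cast_zero]

theorem matStratum_modelDiagram_nonempty (t : ℕ) :
    (matStratum (dimVec lam) fun i : Fin t => modelDiagram lam i).Nonempty := by
  choose φ hφ using fun i => exists_orthonormal_equiv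
    ((Module.finrank_fintype_fun_eq_card ℂ).trans (card_box lam i)) (modelForm lam i)
    (modelForm_isSymm lam i) (modelForm_nondegenerate lam i)
  have h := model_mem_stratum lam t
  rw [stratum_eq_image _ φ hφ] at h
  obtain ⟨A, hA, -⟩ := h
  exact ⟨A, hA⟩

end Model

end

end OrthoStrata

/-! ### Assembly of the proposition -/

open OrthoStrata in
theorem mainTheorem4
    (lam mu : YoungDiagram) (hdom : Dominates lam mu)
    (V : ℕ → Type*) [∀ i, AddCommGroup (V i)] [∀ i, Module ℂ (V i)]
    [∀ i, FiniteDimensional ℂ (V i)]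
    (hV : ∀ i, Module.finrank ℂ (V i) = dimVec lam i)
    (form : ∀ i, LinearMap.BilinForm ℂ (V i))
    (hsymm : ∀ i, (form i).IsSymm) (hnondeg : ∀ i, (form i).Nondegenerate) :
    (∃! τ₀ : Fin (numCols lam) → ABDiagram,
      (stratum (numCols lam) V form τ₀).Nonempty ∧ firstPartition τ₀ = lam) ∧
    ∀ τ₀ τ : Fin (numCols lam) → ABDiagram,
      (stratum (numCols lam) V form τ₀).Nonempty → firstPartition τ₀ = lam →
      (stratum (numCols lam) V form τ).Nonempty → firstPartition τ = mu →
      ∃ d₀ d : ℕ,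
        zariskiDim (stratum (numCols lam) V form τ₀) = d₀ ∧
        zariskiDim (stratum (numCols lam) V form τ) = d ∧
        ∀ x : ℝ, 2 * (rDiff lam mu : ℝ) - (cDiff lam mu : ℝ) - qDiff lam mu ≥ 4 * x →
          (d₀ : ℝ) - (d : ℝ) ≥ x := by
  choose φ hφ using fun i => exists_orthonormal_equiv (hV i) (form i) (hsymm i) (hnondeg i)
  set t := numCols lam
  have hn : ∀ i, t ≤ i → dimVec lam i = 0 := fun i hi => dimVec_eq_zero lam hi
  have hst : ∀ τ : Fin t → ABDiagram,
      stratum t V form τ = toRep φ '' matStratum (dimVec lam) τ := fun τ =>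
    stratum_eq_image form φ hφ τ
  have hcol : ∀ {τ : Fin t → ABDiagram} {nu : YoungDiagram}, firstPartition τ = nu →
      ∀ k, rowSum (extendDiag τ 0) (ABString.ind k) = nu.colLen k := fun h k =>
    h ▸ colLen_firstPartition _ k
  have hdim : ∀ {τ : Fin t → ABDiagram} {A : RectFam t (dimVec lam)},
      A ∈ matStratum (dimVec lam) τ → ∃ d : ℕ, zariskiDim (stratum t V form τ) = d ∧
        (d : ℤ) = Module.finrank ℂ (paramSpace A) - Module.finrank ℂ (stabSpace A) := by
    intro τ A hA
    have hle : ∀ A' ∈ matStratum (dimVec lam) τ,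
        Module.finrank ℂ (stabSpace A') ≤ Module.finrank ℂ (paramSpace A') := fun A' hA' =>
      LinearMap.finrank_le_finrank_of_injective (stabIncl_injective hA'.1)
    refine ⟨Module.finrank ℂ (paramSpace A) - Module.finrank ℂ (stabSpace A), ?_,
      Nat.cast_sub (hle A hA)⟩
    rw [hst, zariskiDim_image _ (toRep_injective φ)]
    -- The difference of the two ranks is the same at all points of the stratum, since its formula
    -- involves only the diagrams.
    refine zariskiDim_matStratum ⟨A, hA⟩ fun A' hA' => ?_
    have h := four_mul_finrank_sub hn hA
    have h' := four_mul_finrank_sub hn hA'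
    have := hle A hA
    omega
  refine ⟨⟨fun i => modelDiagram lam i, ⟨?_, firstPartition_modelDiagram lam⟩, ?_⟩, ?_⟩
  · rw [hst]
    exact (matStratum_modelDiagram_nonempty lam t).image _
  · rintro τ ⟨hne, hτ⟩
    rw [hst, Set.image_nonempty] at hne
    obtain ⟨A, hA⟩ := hne
    obtain ⟨A', hA'⟩ := matStratum_modelDiagram_nonempty lam t
    have h := eq_of_rowSum_ind (admissible_of_mem_matStratum hn hA)
      (admissible_of_mem_matStratum hn hA') (hcol hτ) (hcol (firstPartition_modelDiagram lam))
    funext i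
    rw [← extendDiag_fin τ i, h, extendDiag_fin]
  · intro τ₀ τ hne₀ hτ₀ hne hτ
    rw [hst, Set.image_nonempty] at hne₀ hne
    obtain ⟨A₀, hA₀⟩ := hne₀
    obtain ⟨A, hA⟩ := hne
    obtain ⟨d₀, hd₀, e₀⟩ := hdim hA₀
    obtain ⟨d, hd, e⟩ := hdim hA
    refine ⟨d₀, d, hd₀, hd, fun x hx => ?_⟩
    have h₀ := four_mul_finrank_sub hn hA₀
    have h := four_mul_finrank_sub hn hA
    have hmain := two_mul_rDiff_sub_cDiff_le hdom.1 (admissible_of_mem_matStratum hn hA)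
      (extendDiag_of_le τ le_rfl) (hcol hτ) (admissible_of_mem_matStratum hn hA₀)
      (extendDiag_of_le τ₀ le_rfl) (hcol hτ₀)
    have hint : 2 * rDiff lam mu - cDiff lam mu ≤ 4 * ((d₀ : ℤ) - d) := by
      rw [e₀, e]
      linarith
    have hreal : 2 * (rDiff lam mu : ℝ) - cDiff lam mu ≤ 4 * ((d₀ : ℝ) - d) := by
      exact_mod_cast hint
    -- The inequality already holds for 2r - c; subtracting q ≥ 0 only lowers the bound.
    have hq : 0 ≤ qDiff lam mu :=
      mul_nonneg (by norm_num) (Finset.sum_nonneg fun _ _ => abs_nonneg _)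
    linarith
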